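/- **Setting.** Let $t_1,\dots,t_{p+1}\in\mathbb C$ be distinct, no three of them on a line. Choose arguments $\theta_i=\arg(t_i-t_{p+1})$ $(1\le i\le p)$ and a real number $\theta_{p+1}$ with $\theta_1<\dots<\theta_p<\theta_{p+1}<\theta_1+2\pi$. Let $n=n_1+\dots+n_p$, $T=\mathrm{diag}(t_1I_{n_1},\dots,t_pI_{n_p})$, $A=(A_{ij})\in M(n;\mathbb C)$ partitioned as $T$, with $A_{ii}=\mathrm{diag}(\lambda_{i,1}I_{\ell_{i,1}},\dots,\lambda_{i,r_i}I_{\ell_{i,r_i}})$, and let $P\in GL(n;\mathbb C)$ be such that $A'=P^{-1}AP=\mathrm{diag}(\mu_1I_{m_1},\dots,\mu_qI_{m_q})$. Let $\rho_1,\rho_2\in\mathbb C$ and consider the rank $2n$ system $$\Bigl(xI_{2n}-\begin{pmatrix}T&\\&t_{p+1}I_n\end{pmatrix}\Bigr)\frac{dU}{dx}=\begin{pmatrix}A&P\\-(A'-\rho_1I_n)(A'-\rho_2I_n)P^{-1}&(\rho_1+\rho_2)I_n-A'\end{pmatrix}U.\qquad(1)$$ Assume the generic case: none of the numbers $\lambda_{i,k}$,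 $\lambda_{i,k}-\lambda_{i,h}$ $(k\ne h)$, $\mu_k$, $\mu_k-\mu_h$ $(k\neq h)$, $\rho_j$, $\rho_1-\rho_2$, $\rho_j-\lambda_{i,k}$, $\rho_j-\mu_k$, $\lambda_{i,k}-\mu_j$ is an integer. For $\delta>0$, with $\theta_0=\theta_{p+1}-2\pi$, put $$\mathcal S_i^+=\{\theta_i<\arg(x-t_{p+1})<\min(\theta_{i+1}-\delta,\theta_i+\pi)\},\quad \mathcal S_i^-=\{\max(\theta_{i-1}+\delta,\theta_i-\pi)<\arg(x-t_{p+1})<\theta_i\}.$$ Let $U_{t_i,k,h}$ $(1\le k\le r_i,\ 1\le h\le\ell_{i,k})$ be the unique solution of (1) of the form $(x-t_i)^{\lambda_{i,k}}\sum_{m\ge0}G(m)(x-t_i)^m$ near $t_i$ (a convergent power series) with $G(0)$ the unit vector at position $n_1+\dots+n_{i-1}+\ell_{i,1}+\dots+\ell_{i,k-1}+h$; its branch near $t_i$ is given by $\arg(x-t_i)\in(\theta_i,\theta_i+\pi)$ in $\mathcal S_i^+$ and $\arg(x-t_i)\in(\theta_i-\pi,\theta_i)$ in $\mathcal S_i^-$.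 Fix $\eta_0\in\mathbb C$ and put $t_i'=\eta_0+1/(t_i-t_{p+1})$, $\theta_i'=-\theta_i$, $T'=\mathrm{diag}(t'_1I_{n_1},\dots,t'_pI_{n_p})$ and $\mathcal P'=\mathbb C\setminus\bigcup_{i=1}^p\{\eta_0+(t_i'-\eta_0)s\mid s\ge1\}$. Let $w_{t'_i,k,h}$ be the unique solution on $\mathcal P'$ of the underlying system $(\zeta I_n-T')\,dw/d\zeta=Aw$ of the form $(\zeta-t_i')^{\lambda_{i,k}}\sum_{m\ge0}g(m)(\zeta-t_i')^m$ near $t'_i$, with $g(0)$ the unit vector at the same position and $\arg(\zeta-t_i')\in(\theta_i'-2\pi,\theta_i')$. For $\nu\ne i$ with $1\le\nu\le p$ let $c_{t'_\nu,\tilde k,\tilde h;t'_i,k,h}$ be the connection coefficients in $$w_{t_i',k,h}=\sum_{\tilde k=1}^{r_\nu}\sum_{\tilde h=1}^{\ell_{\nu,\tilde k}}c_{t'_\nu,\tilde k,\tilde h;t'_i,k,h}\,w_{t'_\nu,\tilde k,\tilde h}+\mathrm{hol}(\zeta-t'_\nu)\quad\text{in }\mathcal P'\text{ near }t'_\nu,$$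 where $\mathrm{hol}(\zeta-b)$ denotes a function holomorphic at $b$. **Theorem.** The solutions $w_{t'_i,k,h}$ exist and are unique on $\mathcal P'$. For all sufficiently small $\delta>0$ the following holds. For $1\le i\le p-1$ and $D=\mathcal S_i^+\cup\mathcal S_{i+1}^-$, the solutions $U_{t_i,k,h}$ and $U_{t_{i+1},k,h}$ of (1) exist and are unique as holomorphic functions on $D$. For $(a,b)=(i,i+1)$ and for $(a,b)=(i+1,i)$, and all $1\le k\le r_a$, $1\le h\le \ell_{a,k}$, the coefficients $c_{t_b',\tilde k,\tilde h;t_a',k,h}$ exist and are unique, there are unique coefficients $C_{t_b,\tilde k,\tilde h;t_a,k,h}$ such that $$U_{t_a,k,h}(x)=\sum_{\tilde k=1}^{r_b}\sum_{\tilde h=1}^{\ell_{b,\tilde k}}C_{t_b,\tilde k,\tilde h;t_a,k,h}\,U_{t_b,\tilde k,\tilde h}(x)+\mathrm{hol}(x-t_b)\quad\text{for }x\in D\text{ near }t_b,$$ and they are given by $$C_{t_b,\tilde k,\tilde h;t_a,k,h}=\frac{e^{\pi\sqrt{-1}\lambda_{a,k}}(t_a-t_{p+1})^{2\lambda_{a,k}-\rho_1-\rho_2}}{e^{\pi\sqrt{-1}\lambda_{b,\tilde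 k}}(t_b-t_{p+1})^{2\lambda_{b,\tilde k}-\rho_1-\rho_2}}\;c_{t_b',\tilde k,\tilde h;t_a',k,h},$$ where the powers of $t_i-t_{p+1}$ are taken with $\arg(t_i-t_{p+1})=\theta_i$. -/

import Mathlib

open scoped Topology Matrix

/-- The complex number `z` is not an integer. -/
def NotInt (z : ℂ) : Prop := ∀ N : ℤ, z ≠ (N : ℂ)

/-- The branch of `z ^ s` for which `arg z` is taken in `(c - π, c + π]`. -/
noncomputable def powNear (c : ℝ) (z s : ℂ) : ℂ :=
  Complex.exp (s * (Complex.log (z * Complex.exp (-(c * Complex.I))) + c * Complex.I))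

/-- `u` is a holomorphic solution on the (open) set `D` of the system of Okubo normal form
`(x I - diag T) du/dx = A u`. -/
def IsONFSolution {ι : Type} [Fintype ι] [DecidableEq ι]
    (T : ι → ℂ) (A : Matrix ι ι ℂ) (D : Set ℂ) (u : ℂ → ι → ℂ) : Prop :=
  ∀ x ∈ D, ∃ u' : ι → ℂ, HasDerivAt u u' x ∧
    (x • (1 : Matrix ι ι ℂ) - Matrix.diagonal T) *ᵥ u' = A *ᵥ u x

/-- For `x ∈ D` near `b`, the function `u` has the form
`(x - b) ^ s * ∑ m, G m * (x - b) ^ m`, where the power series has a positive radius of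
convergence and initial coefficient `G 0 = e`, and where the branch of the power is given by
`arg (x - b) ∈ (c - π, c + π]`. -/
def HasLocalForm {ι : Type} [Fintype ι]
    (D : Set ℂ) (b : ℂ) (c : ℝ) (s : ℂ) (e : ι → ℂ) (u : ℂ → ι → ℂ) : Prop :=
  ∃ G : ℕ → ι → ℂ, G 0 = e ∧
    (∃ R : ℝ, 0 < R ∧ ∀ z : ℂ, ‖z‖ < R → Summable fun m => z ^ m • G m) ∧
    ∀ᶠ x in 𝓝[D] b, u x = powNear c (x - b) s • ∑' m, (x - b) ^ m • G m

/-- The connection formula `u = ∑ κ, C κ * v κ + hol (x - b)` for `x ∈ D` near `b`. -/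
def IsConnectionFormula {ι κ : Type} [Fintype ι] [Fintype κ]
    (D : Set ℂ) (b : ℂ) (u : ℂ → ι → ℂ) (v : κ → ℂ → ι → ℂ) (C : κ → ℂ) : Prop :=
  ∃ f : ℂ → ι → ℂ, AnalyticAt ℂ f b ∧
    ∀ᶠ x in 𝓝[D] b, u x = (∑ k, C k • v k x) + f x

/-- The data of the rank `2n` system
`(x I - diag(T, t_{p+1} I)) dU/dx = A_P U`, with the standing normalisations.

Rows and columns of `T` and `A` are indexed by triples `(i, k, h)` (block `i`, sub-block `k`
of `A_ii`, position `h`), those of `A' = P⁻¹ A P` by pairs `(k, h)`; the order of the triples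
is the order of the rows. Since `P` is invertible both index sets have the same size `n`. -/
structure ExtendedOkuboSystem where
  p : ℕ
  q : ℕ
  r : Fin p → ℕ
  ell : (i : Fin p) → Fin (r i) → ℕ
  m : Fin q → ℕ
  /-- The singular points `t_1, …, t_{p+1}`. -/
  t : Fin (p + 1) → ℂ
  /-- `θ_i = arg (t_i - t_{p+1})` for `i ≤ p`, and the auxiliary angle `θ_{p+1}`. -/
  theta : Fin (p + 1) → ℝ
  lam : (i : Fin p) → Fin (r i) → ℂ
  mu : Fin q → ℂ
  rho₁ : ℂ
  rho₂ : ℂ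
  A : Matrix (Σ i : Fin p, Σ k : Fin (r i), Fin (ell i k))
    (Σ i : Fin p, Σ k : Fin (r i), Fin (ell i k)) ℂ
  P : Matrix (Σ i : Fin p, Σ k : Fin (r i), Fin (ell i k)) (Σ k : Fin q, Fin (m k)) ℂ
  /-- The inverse of `P`. -/
  Pinv : Matrix (Σ k : Fin q, Fin (m k)) (Σ i : Fin p, Σ k : Fin (r i), Fin (ell i k)) ℂ
  t_injective : Function.Injective t
  t_not_collinear : ∀ i j k : Fin (p + 1), i ≠ j → j ≠ k → i ≠ k →
    ¬ Collinear ℝ {t i, t j, t k}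
  theta_strictMono : StrictMono theta
  theta_last_lt : theta (Fin.last p) < theta 0 + 2 * Real.pi
  theta_arg : ∀ i : Fin p, t i.castSucc - t (Fin.last p) =
    (‖t i.castSucc - t (Fin.last p)‖ : ℂ) * Complex.exp (theta i.castSucc * Complex.I)
  /-- `A_ii` is diagonal with the eigenvalue `λ_{i,k}` of multiplicity `ℓ_{i,k}`. -/
  A_diag : ∀ (i : Fin p) (a b : Σ k : Fin (r i), Fin (ell i k)),
    A ⟨i, a⟩ ⟨i, b⟩ = if a = b then lam i a.1 else 0
  P_mul_Pinv : P * Pinv = 1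
  Pinv_mul_P : Pinv * P = 1
  /-- `A' = P⁻¹ A P` is diagonal with the eigenvalue `μ_k` of multiplicity `m_k`. -/
  Pinv_A_P : Pinv * A * P = Matrix.diagonal fun b => mu b.1

namespace ExtendedOkuboSystem

variable (S : ExtendedOkuboSystem)

/-- Positions `(k, h)` within the block `i`. -/
abbrev Block (i : Fin S.p) : Type := Σ k : Fin (S.r i), Fin (S.ell i k)

/-- Indices `(i, k, h)` of the entries of an `n`-vector. -/
abbrev Idx : Type := Σ i : Fin S.p, S.Block i

/-- Indices `(k, h)` of the eigenbasis of `A`. -/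
abbrev Idx' : Type := Σ k : Fin S.q, Fin (S.m k)

/-- The assumptions on the parameters in the generic case. -/
structure Generic : Prop where
  lam_notInt : ∀ i k, NotInt (S.lam i k)
  lam_sub_lam : ∀ i k h, k ≠ h → NotInt (S.lam i k - S.lam i h)
  mu_sub_mu : ∀ k h, k ≠ h → NotInt (S.mu k - S.mu h)
  rho₁_notInt : NotInt S.rho₁
  rho₂_notInt : NotInt S.rho₂
  rho₁_sub_rho₂ : NotInt (S.rho₁ - S.rho₂)
  rho₁_sub_lam : ∀ i k, NotInt (S.rho₁ - S.lam i k)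
  rho₂_sub_lam : ∀ i k, NotInt (S.rho₂ - S.lam i k)
  rho₁_sub_mu : ∀ k, NotInt (S.rho₁ - S.mu k)
  rho₂_sub_mu : ∀ k, NotInt (S.rho₂ - S.mu k)
  mu_notInt : ∀ k, NotInt (S.mu k)
  lam_sub_mu : ∀ i k j, NotInt (S.lam i k - S.mu j)

/-- The point `t_{p+1}`. -/
def tLast : ℂ := S.t (Fin.last S.p)

/-- The point `t_i`, `1 ≤ i ≤ p`. -/
def pt (i : Fin S.p) : ℂ := S.t i.castSucc

/-- The angle `θ_i`, `1 ≤ i ≤ p`. -/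
def ang (i : Fin S.p) : ℝ := S.theta i.castSucc

/-- The angle `θ_{i-1}`, with `θ_0 = θ_{p+1} - 2π`. -/
noncomputable def angPrev (i : Fin S.p) : ℝ :=
  if (i : ℕ) = 0 then S.theta (Fin.last S.p) - 2 * Real.pi
  else S.theta ⟨(i : ℕ) - 1, by omega⟩

/-- The angle `θ_{i+1}`. -/
def angNext (i : Fin S.p) : ℝ := S.theta i.succ

/-- `{x | arg (x - t_{p+1}) ∈ (α, β)}`. -/
def sector (α β : ℝ) : Set ℂ :=
  {x | ∃ s φ : ℝ, 0 < s ∧ α < φ ∧ φ < β ∧ x = S.tLast + s * Complex.exp (φ * Complex.I)}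

/-- The sector `S_i^+`. -/
def sectorPlus (δ : ℝ) (i : Fin S.p) : Set ℂ :=
  S.sector (S.ang i) (min (S.angNext i - δ) (S.ang i + Real.pi))

/-- The sector `S_i^-`. -/
def sectorMinus (δ : ℝ) (i : Fin S.p) : Set ℂ :=
  S.sector (max (S.angPrev i + δ) (S.ang i - Real.pi)) (S.ang i)

/-- The diagonal entries of `diag(T, t_{p+1} I_n)`. -/
def bigT : S.Idx ⊕ S.Idx' → ℂ := Sum.elim (fun a => S.pt a.1) (fun _ => S.tLast)

/-- The matrix `A_P` of the rank `2n` system. -/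
noncomputable def bigA : Matrix (S.Idx ⊕ S.Idx') (S.Idx ⊕ S.Idx') ℂ :=
  let A' : Matrix S.Idx' S.Idx' ℂ := S.Pinv * S.A * S.P
  Matrix.fromBlocks S.A S.P
    (-((A' - S.rho₁ • 1) * (A' - S.rho₂ • 1) * S.Pinv))
    ((S.rho₁ + S.rho₂) • 1 - A')

/-- `U` is, on `D`, the solution `U_{t_i,k,h}` of the rank `2n` system, `a = (i, k, h)`: the
exponent at `t_i` is `λ_{i,k}` and the initial vector is the unit vector at position `(i, k, h)`.
Near `t_i` the branch is given by `arg (x - t_i) ∈ (θ_i, θ_i + π)` on `S_i^+` and by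
`arg (x - t_i) ∈ (θ_i - π, θ_i)` on `S_i^-`; both are the branch centred at `θ_i`. -/
def IsU (D : Set ℂ) (a : S.Idx) (U : ℂ → S.Idx ⊕ S.Idx' → ℂ) : Prop :=
  IsONFSolution S.bigT S.bigA D U ∧
    HasLocalForm D (S.pt a.1) (S.ang a.1) (S.lam a.1 a.2.1) (Pi.single (Sum.inl a) 1) U

/-- The point `t'_i = η₀ + 1 / (t_i - t_{p+1})`. -/
noncomputable def pt' (η₀ : ℂ) (i : Fin S.p) : ℂ := η₀ + 1 / (S.pt i - S.tLast)

/-- The plane cut along the rays from `t'_i` to infinity in the direction `t'_i - η₀`. -/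
def cutPlane (η₀ : ℂ) : Set ℂ :=
  {z | ∀ (i : Fin S.p) (s : ℝ), 1 ≤ s → z ≠ η₀ + (S.pt' η₀ i - η₀) * s}

/-- `w` is, on the cut plane, the solution `w_{t'_i,k,h}(ρ; ·)` of the underlying system
`(ζ I - T') dw/dζ = (ρ I + A) w`, `a = (i, k, h)`, with the branch near `t'_i` given by
`arg (ζ - t'_i) ∈ (θ'_i - 2π, θ'_i)`, `θ'_i = -θ_i`. -/
def IsW (η₀ ρ : ℂ) (a : S.Idx) (w : ℂ → S.Idx → ℂ) : Prop :=
  IsONFSolution (fun b : S.Idx => S.pt' η₀ b.1) (ρ • (1 : Matrix S.Idx S.Idx ℂ) + S.A)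
      (S.cutPlane η₀) w ∧
    HasLocalForm (S.cutPlane η₀) (S.pt' η₀ a.1) (-S.ang a.1 - Real.pi)
      (ρ + S.lam a.1 a.2.1) (Pi.single a 1) w

/-- `e^{π √-1 λ_{i,k}} (t_i - t_{p+1})^{2 λ_{i,k} - ρ₁ - ρ₂}` for `a = (i, k, h)`, where
`arg (t_i - t_{p+1}) = θ_i`. -/
noncomputable def factor (a : S.Idx) : ℂ :=
  Complex.exp (Real.pi * Complex.I * S.lam a.1 a.2.1) *
    powNear (S.ang a.1) (S.pt a.1 - S.tLast) (2 * S.lam a.1 a.2.1 - S.rho₁ - S.rho₂)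

/-- With `w` and `U` the families of solutions of the underlying system (`ρ = 0`) and of the
rank `2n` system, for every index `(i, k, h)` the connection formulas from `t'_i` to `t'_j` on
the cut plane and from `t_i` to `t_j` on `D` hold with unique coefficients `c` and `C`, and
`C = (factor at t_i / factor at t_j) * c`. -/
def ConnectionCoefficients (η₀ : ℂ) (D : Set ℂ) (w : S.Idx → ℂ → S.Idx → ℂ)
    (U : S.Idx → ℂ → S.Idx ⊕ S.Idx' → ℂ) (i j : Fin S.p) : Prop :=
  ∀ a : S.Block i, ∃ c : S.Block j → ℂ,
    (∀ c' : S.Block j → ℂ,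
      IsConnectionFormula (S.cutPlane η₀) (S.pt' η₀ j) (w ⟨i, a⟩) (fun b => w ⟨j, b⟩) c' ↔
        c' = c) ∧
    ∀ C : S.Block j → ℂ,
      IsConnectionFormula D (S.pt j) (U ⟨i, a⟩) (fun b => U ⟨j, b⟩) C ↔
        C = fun b => S.factor ⟨i, a⟩ / S.factor ⟨j, b⟩ * c b

end ExtendedOkuboSystem

/-!
The connection coefficients of the rank `2n` system are compared with those of the underlying
system by an integral transform, carried out in the variable `X = log (x - t_{p+1})`, in which it
is a convolution.

Write `T = diag (t_i - t_{p+1})`, `σ = ρ₁ + ρ₂` and `p = ρ₁ ρ₂`. Eliminating the lower half `V` of a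
solution of the rank `2n` system leaves the second order equation `extOp u = 0` for its upper half
`u`. With `ζ = η₀ + e ^ (-X)`, a solution `w` of the underlying system gives
`f = e ^ ((1 + σ) X) T⁻¹ w`, which satisfies the first order equation `UnderlyingEq`. There is a
kernel `κ`, holomorphic on `|Im X| < 2π` and independent of `A` (`exists_kernel`), such that
`u = f + κ * f`, with the convolution taken from a base point `c`, satisfies
`extOp u = e ^ (-(X - c)) κ' (X - c) (f c - e ^ (-c) T f c)` (`extOp_add_segConv`). The right-hand
side is holomorphic beyond the boundary of the domain of `f`.

Near `τ = log (t_i - t_{p+1})` let `f = (X - τ) ^ λ g`. The convolution becomes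
`(X - τ) ^ (λ + 1)` times a holomorphic function once a function `R`, holomorphic in a larger strip,
is added (`ConvSetting.exists_regularization`): this is the replacement of the base point `c` by the
singular point `τ`, with the divergent integrals interpreted through integration by parts. For
`u = f + κ * f + R`, the function `extOp u` is at the same time holomorphic at `τ` and
`(X - τ) ^ (λ - 2)` times a holomorphic function. As `λ` is not an integer, `extOp u = 0`
(`ConvSetting.extOp_eq_zero`). Hence `u` is the upper half of a solution of the rank `2n` system
with exponent `λ` (`ConvSetting.exists_transform`), and the equation for the lower half makes it
vanish to the required order (`exists_lowerPart_localForm`). Comparing the branches of `(x - t_i) ^ λ`,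
`(ζ - t'_i) ^ λ` and `(X - τ) ^ λ`, one finds that the leading coefficient is the inverse of
`ExtendedOkuboSystem.factor` (`exists_underlyingLog_localForm`).

The convolution with the difference `f_a - ∑ c_b f_b`, holomorphic at `τ_b`, is again holomorphic at
`τ_b`, and so are the functions `R`. So the transform preserves connection formulas up to the
factors (`StripSetting.exists_solutions`).

The remaining facts concern systems of Okubo normal form: existence of local solutions by power
series (`exists_okuboFactor`), their continuation to star-shaped domains
(`exists_linear_ode_solution`), their uniqueness (`localForm_eqOn`), and the independence of powers
with exponents distinct modulo `ℤ` (`powNear_independent`), which gives uniqueness of connection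
coefficients and, through a basis adapted to `t'_j`, their existence (`Generic.exists_connection`).
-/

/-! ### Convolutions along segments -/

section Convolution

open Set Filter intervalIntegral

variable {E : Type*} [NormedAddCommGroup E] [NormedSpace ℂ E]

/-- Differentiation under the integral sign. -/
theorem hasDerivAt_integral_of_continuousOn {U : Set ℂ} (hU : IsOpen U) {H H' : ℂ → ℝ → E}
    (hH : ContinuousOn (Function.uncurry H) (U ×ˢ Icc (0 : ℝ) 1))
    (hH' : ContinuousOn (Function.uncurry H') (U ×ˢ Icc (0 : ℝ) 1))
    (hd : ∀ z ∈ U, ∀ s ∈ Icc (0 : ℝ) 1, HasDerivAt (fun w => H w s) (H' z s) z)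
    {z : ℂ} (hz : z ∈ U) :
    HasDerivAt (fun w => ∫ s in (0 : ℝ)..1, H w s) (∫ s in (0 : ℝ)..1, H' z s) z := by
  obtain ⟨r, hr, hrU⟩ := Metric.nhds_basis_closedBall.mem_iff.1 (hU.mem_nhds hz)
  have hslice : ∀ G : ℂ → ℝ → E, ContinuousOn (Function.uncurry G) (U ×ˢ Icc (0 : ℝ) 1) →
      ∀ w ∈ U, ContinuousOn (G w) (Icc (0 : ℝ) 1) := fun G hG w hw =>
    hG.comp (f := fun s : ℝ => (w, s)) (by fun_prop) fun s hs => ⟨hw, hs⟩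
  have hcpt : IsCompact (Metric.closedBall z r ×ˢ Icc (0 : ℝ) 1) :=
    (isCompact_closedBall z r).prod isCompact_Icc
  obtain ⟨B, hB⟩ := hcpt.exists_bound_of_continuousOn
    (hH'.mono (prod_mono hrU subset_rfl))
  have hIoc : uIoc (0 : ℝ) 1 ⊆ Icc 0 1 := by
    rw [uIoc_of_le zero_le_one]; exact Ioc_subset_Icc_self
  have hmeas : ∀ G : ℝ → E, ContinuousOn G (Icc (0 : ℝ) 1) →
      MeasureTheory.AEStronglyMeasurable G
        (MeasureTheory.volume.restrict (uIoc (0 : ℝ) 1)) := fun G hG =>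
    (hG.mono hIoc).aestronglyMeasurable measurableSet_uIoc
  refine (intervalIntegral.hasDerivAt_integral_of_dominated_loc_of_deriv_le
    (bound := fun _ => B) (F := H) (F' := H') (s := Metric.closedBall z r)
    (Metric.closedBall_mem_nhds z hr) ?_ ?_ ?_ ?_ ?_ ?_).2
  · filter_upwards [hU.mem_nhds hz] with w hw
    exact hmeas _ (hslice H hH w hw)
  · apply ContinuousOn.intervalIntegrable
    rw [uIcc_of_le zero_le_one]
    exact hslice H hH z hz
  · exact hmeas _ (hslice H' hH' z hz)
  · exact .of_forall fun s hs w hw => hB (w, s) ⟨hw, hIoc hs⟩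
  · exact intervalIntegrable_const
  · exact .of_forall fun s hs w hw => hd w (hrU hw) s (hIoc hs)

/-- The convolution `∫ k (X - Y) • f Y dY`, taken over the segment from `c` to `X`. -/
noncomputable def segConv (k : ℂ → ℂ) (f : ℂ → E) (c X : ℂ) : E :=
  ∫ s in (0 : ℝ)..1, ((X - c) * k ((1 - s) * (X - c))) • f (c + s * (X - c))

/-- `S` contains all differences `X - Y` with `X ∈ D` and `Y` on the segment from `c` to `X`. -/
def SegDiffs (S D : Set ℂ) (c : ℂ) : Prop :=
  ∀ X ∈ D, ∀ s ∈ Icc (0 : ℝ) 1, (1 - s) * (X - c) ∈ S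

theorem StarConvex.seg_mem {D : Set ℂ} {c : ℂ} (hD : StarConvex ℝ c D) {X : ℂ} (hX : X ∈ D)
    {s : ℝ} (hs : s ∈ Icc (0 : ℝ) 1) : c + s * (X - c) ∈ D := by
  simpa using hD.add_smul_sub_mem hX hs.1 hs.2

variable {D S : Set ℂ} {c : ℂ} {k k' : ℂ → ℂ} {f g : ℂ → E}

theorem continuousOn_segConv_integrand (hD : StarConvex ℝ c D) (hS : SegDiffs S D c)
    (hk : ContinuousOn k S) (hf : ContinuousOn f D) :
    ContinuousOn (fun q : ℂ × ℝ => k ((1 - q.2) * (q.1 - c)) • f (c + q.2 * (q.1 - c)))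
      (D ×ˢ Icc (0 : ℝ) 1) := by
  apply ContinuousOn.smul
  · exact hk.comp (by fun_prop) fun q hq => hS q.1 hq.1 q.2 hq.2
  · exact hf.comp (by fun_prop) fun q hq => hD.seg_mem hq.1 hq.2

theorem intervalIntegrable_segConv (hD : StarConvex ℝ c D) (hS : SegDiffs S D c)
    (hk : ContinuousOn k S) (hf : ContinuousOn f D) {X : ℂ} (hX : X ∈ D) :
    IntervalIntegrable
      (fun s : ℝ => ((X - c) * k ((1 - s) * (X - c))) • f (c + s * (X - c)))
      MeasureTheory.volume 0 1 := by
  apply ContinuousOn.intervalIntegrable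
  rw [uIcc_of_le zero_le_one]
  have := (continuousOn_segConv_integrand hD hS hk hf).comp
    (f := fun s : ℝ => (X, s)) (s := Icc (0 : ℝ) 1) (by fun_prop) fun s hs => ⟨hX, hs⟩
  simpa only [mul_smul] using! this.const_smul (X - c)

theorem segConv_add (hD : StarConvex ℝ c D) (hS : SegDiffs S D c)
    (hk : ContinuousOn k S) (hf : ContinuousOn f D) (hg : ContinuousOn g D) {X : ℂ}
    (hX : X ∈ D) : segConv k (fun Y => f Y + g Y) c X = segConv k f c X + segConv k g c X := by
  unfold segConv
  rw [← integral_add (intervalIntegrable_segConv hD hS hk hf hX)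
    (intervalIntegrable_segConv hD hS hk hg hX)]
  simp only [smul_add]

theorem segConv_kernel_sub {k₂ : ℂ → ℂ} (hD : StarConvex ℝ c D) (hS : SegDiffs S D c)
    (hk : ContinuousOn k S) (hk₂ : ContinuousOn k₂ S) (hf : ContinuousOn f D) {X : ℂ}
    (hX : X ∈ D) :
    segConv (fun Z => k Z - k₂ Z) f c X = segConv k f c X - segConv k₂ f c X := by
  unfold segConv
  rw [← integral_sub (intervalIntegrable_segConv hD hS hk hf hX)
    (intervalIntegrable_segConv hD hS hk₂ hf hX)]
  simp only [mul_sub, sub_smul]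

theorem segConv_kernel_add {k₂ : ℂ → ℂ} (hD : StarConvex ℝ c D) (hS : SegDiffs S D c)
    (hk : ContinuousOn k S) (hk₂ : ContinuousOn k₂ S) (hf : ContinuousOn f D) {X : ℂ}
    (hX : X ∈ D) :
    segConv (fun Z => k Z + k₂ Z) f c X = segConv k f c X + segConv k₂ f c X := by
  unfold segConv
  rw [← integral_add (intervalIntegrable_segConv hD hS hk hf hX)
    (intervalIntegrable_segConv hD hS hk₂ hf hX)]
  simp only [mul_add, add_smul]

theorem segConv_const_smul (a : ℂ) (X : ℂ) :
    segConv k (fun Y => a • f Y) c X = a • segConv k f c X := by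
  unfold segConv
  rw [← integral_smul]
  simp only [smul_comm a]

theorem segConv_kernel_const_mul (a : ℂ) (X : ℂ) :
    segConv (fun Z => a * k Z) f c X = a • segConv k f c X := by
  unfold segConv
  rw [← integral_smul]
  simp only [mul_smul, smul_comm a]

theorem segConv_clm [CompleteSpace E] (L : E →L[ℂ] E) (hD : StarConvex ℝ c D)
    (hS : SegDiffs S D c) (hk : ContinuousOn k S) (hf : ContinuousOn f D) {X : ℂ}
    (hX : X ∈ D) : segConv k (fun Y => L (f Y)) c X = L (segConv k f c X) := by
  unfold segConv
  rw [← L.intervalIntegral_comp_comm (intervalIntegrable_segConv hD hS hk hf hX)]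
  simp only [map_smul]

theorem segConv_exp_mul (X : ℂ) :
    Complex.exp (-X) • segConv k f c X =
      segConv (fun Z => Complex.exp (-Z) * k Z) (fun Y => Complex.exp (-Y) • f Y) c X := by
  unfold segConv
  rw [← integral_smul]
  congr 1
  funext s
  rw [smul_smul, smul_smul]
  congr 1
  have : Complex.exp (-X) =
      Complex.exp (-((1 - s) * (X - c))) * Complex.exp (-(c + s * (X - c))) := by
    rw [← Complex.exp_add]; ring_nf
  rw [this]; ring

/-- Leibniz rule: `d/dX ∫ k (X - Y) f Y dY = k 0 f X + ∫ k' (X - Y) f Y dY`. -/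
theorem hasDerivAt_segConv [CompleteSpace E] (hDo : IsOpen D) (hD : StarConvex ℝ c D)
    (hS : SegDiffs S D c) (hk : ∀ Z ∈ S, HasDerivAt k (k' Z) Z) (hk' : ContinuousOn k' S)
    (hf : DifferentiableOn ℂ f D) {X : ℂ} (hX : X ∈ D) :
    HasDerivAt (segConv k f c) (k 0 • f X + segConv k' f c X) X := by
  have hkc : ContinuousOn k S := fun Z hZ => (hk Z hZ).continuousAt.continuousWithinAt
  have hfd : ∀ Y ∈ D, HasDerivAt f (deriv f Y) Y := fun Y hY =>
    (hf.differentiableAt (hDo.mem_nhds hY)).hasDerivAt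
  have hf'c : ContinuousOn (deriv f) D := (hf.deriv hDo).continuousOn
  have c1 := continuousOn_segConv_integrand hD hS hkc hf.continuousOn
  have c2 := continuousOn_segConv_integrand hD hS hk' hf.continuousOn
  have c3 := continuousOn_segConv_integrand hD hS hkc hf'c
  -- the derivative of the integrand, split as the new integrand plus an `s`-derivative
  set H' : ℂ → ℝ → E := fun z s =>
    ((z - c) * k' ((1 - s) * (z - c))) • f (c + s * (z - c)) +
      (k ((1 - s) * (z - c)) • f (c + s * (z - c)) +
        (s : ℂ) • (z - c) • (k ((1 - s) * (z - c)) • deriv f (c + s * (z - c)) -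
          k' ((1 - s) * (z - c)) • f (c + s * (z - c)))) with hH'
  have key := hasDerivAt_integral_of_continuousOn hDo
    (H := fun z s => ((z - c) * k ((1 - s) * (z - c))) • f (c + s * (z - c))) (H' := H')
    ?_ ?_ ?_ hX
  · have hsec : ∀ G : ℂ × ℝ → E, ContinuousOn G (D ×ˢ Icc (0 : ℝ) 1) →
        ContinuousOn (fun s : ℝ => G (X, s)) (Icc 0 1) := fun G hG =>
      hG.comp (f := fun s : ℝ => (X, s)) (by fun_prop) fun s hs => ⟨hX, hs⟩
    have hftc := integral_eq_sub_of_hasDerivAt (a := 0) (b := 1)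
      (f := fun s : ℝ => (s : ℂ) • k ((1 - s) * (X - c)) • f (c + s * (X - c)))
      (f' := fun s : ℝ => (k ((1 - s) * (X - c)) • f (c + s * (X - c)) +
        (s : ℂ) • (X - c) • (k ((1 - s) * (X - c)) • deriv f (c + s * (X - c)) -
          k' ((1 - s) * (X - c)) • f (c + s * (X - c))))) ?_ ?_
    · refine key.congr_deriv ?_
      rw [hH', integral_add (intervalIntegrable_segConv hD hS hk' hf.continuousOn hX), hftc]
      · rw [add_comm]; simp [segConv]
      · apply ContinuousOn.intervalIntegrable
        rw [uIcc_of_le zero_le_one]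
        exact (hsec _ c1).add ((Complex.continuous_ofReal.continuousOn).smul
          (((hsec _ c3).sub (hsec _ c2)).const_smul _))
    · intro s hs
      rw [uIcc_of_le zero_le_one] at hs
      have e1 : HasDerivAt (fun s : ℝ => (1 - (s : ℂ)) * (X - c)) (-(X - c)) s := by
        have := ((Complex.ofRealCLM.hasDerivAt (x := s)).const_sub 1).mul_const (X - c)
        simpa using this
      have e2 : HasDerivAt (fun s : ℝ => c + (s : ℂ) * (X - c)) (X - c) s := by
        have := ((Complex.ofRealCLM.hasDerivAt (x := s)).mul_const (X - c)).const_add c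
        simpa using this
      have d1 := (hk _ (hS X hX s hs)).scomp s e1
      have d2 := (hfd _ (hD.seg_mem hX hs)).scomp s e2
      have d3 := (Complex.ofRealCLM.hasDerivAt (x := s)).smul (d1.smul d2)
      refine d3.congr_deriv ?_
      simp only [Complex.ofRealCLM_apply, Complex.ofReal_one, Function.comp_apply, smul_eq_mul,
        Pi.smul_apply']
      module
    · apply ContinuousOn.intervalIntegrable
      rw [uIcc_of_le zero_le_one]
      exact (hsec _ c1).add ((Complex.continuous_ofReal.continuousOn).smul
        (((hsec _ c3).sub (hsec _ c2)).const_smul _))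
  · have h0 : ContinuousOn (fun q : ℂ × ℝ => q.1 - c) (D ×ˢ Icc (0 : ℝ) 1) := by fun_prop
    simpa only [Function.uncurry_def, mul_smul] using! h0.smul c1
  · have h0 : ContinuousOn (fun q : ℂ × ℝ => q.1 - c) (D ×ˢ Icc (0 : ℝ) 1) := by fun_prop
    have h1 : ContinuousOn (fun q : ℂ × ℝ => (q.2 : ℂ)) (D ×ˢ Icc (0 : ℝ) 1) := by fun_prop
    simpa only [Function.uncurry_def, mul_smul, hH'] using!
      (h0.smul c2).add (c1.add (h1.smul (h0.smul (c3.sub c2))))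
  · intro z hz s hs
    have e0 : HasDerivAt (fun w : ℂ => w - c) 1 z := (hasDerivAt_id z).sub_const c
    have e1 : HasDerivAt (fun w : ℂ => (1 - (s : ℂ)) * (w - c)) (1 - s) z := by
      simpa using e0.const_mul (1 - (s : ℂ))
    have e2 : HasDerivAt (fun w : ℂ => c + (s : ℂ) * (w - c)) s z := by
      simpa using (e0.const_mul (s : ℂ)).const_add c
    have d1 := e0.mul ((hk _ (hS z hz s hs)).comp z e1)
    have d2 := (hfd _ (hD.seg_mem hz hs)).scomp z e2
    refine (d1.smul d2).congr_deriv ?_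
    simp only [hH', Function.comp_apply, Pi.mul_apply]
    module

/-- Integration by parts for convolutions. -/
theorem segConv_deriv [CompleteSpace E] {f' : ℂ → E} (hD : StarConvex ℝ c D)
    (hS : SegDiffs S D c) (hk : ∀ Z ∈ S, HasDerivAt k (k' Z) Z) (hk' : ContinuousOn k' S)
    (hf : ∀ Y ∈ D, HasDerivAt f (f' Y) Y) (hf' : ContinuousOn f' D) {X : ℂ} (hX : X ∈ D) :
    segConv k f' c X = k 0 • f X - k (X - c) • f c + segConv k' f c X := by
  have hkc : ContinuousOn k S := fun Z hZ => (hk Z hZ).continuousAt.continuousWithinAt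
  have hfc : ContinuousOn f D := fun Z hZ => (hf Z hZ).continuousAt.continuousWithinAt
  have i1 := intervalIntegrable_segConv hD hS hkc hf' hX
  have i2 := intervalIntegrable_segConv hD hS hk' hfc hX
  have hftc := integral_eq_sub_of_hasDerivAt (a := 0) (b := 1)
      (f := fun s : ℝ => k ((1 - s) * (X - c)) • f (c + s * (X - c)))
      (f' := fun s : ℝ => ((X - c) * k ((1 - s) * (X - c))) • f' (c + s * (X - c)) -
        ((X - c) * k' ((1 - s) * (X - c))) • f (c + s * (X - c))) ?_ (i1.sub i2)
  · rw [integral_sub i1 i2] at hftc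
    rw [← sub_eq_iff_eq_add]
    simpa [segConv] using hftc
  · intro s hs
    rw [uIcc_of_le zero_le_one] at hs
    have e1 : HasDerivAt (fun s : ℝ => (1 - (s : ℂ)) * (X - c)) (-(X - c)) s := by
      have := ((Complex.ofRealCLM.hasDerivAt (x := s)).const_sub 1).mul_const (X - c)
      simpa using this
    have e2 : HasDerivAt (fun s : ℝ => c + (s : ℂ) * (X - c)) (X - c) s := by
      have := ((Complex.ofRealCLM.hasDerivAt (x := s)).mul_const (X - c)).const_add c
      simpa using this
    have d1 := (hk _ (hS X hX s hs)).scomp s e1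
    have d2 := (hf _ (hD.seg_mem hX hs)).scomp s e2
    refine (d1.smul d2).congr_deriv ?_
    simp only [Function.comp_apply, smul_eq_mul]
    module

/-- A holomorphic function on a star-shaped open set has a primitive. -/
theorem StarConvex.exists_primitive [CompleteSpace E] (hDo : IsOpen D) (hD : StarConvex ℝ c D)
    (hf : DifferentiableOn ℂ f D) :
    ∃ F : ℂ → E, F c = 0 ∧ (∀ X ∈ D, HasDerivAt F (f X) X) ∧
      ∀ X, F X = ∫ s in (0 : ℝ)..1, (X - c) • f (c + s * (X - c)) := by
  refine ⟨segConv (fun _ => 1) f c, by simp [segConv], fun X hX => ?_, fun X => by simp [segConv]⟩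
  have := hasDerivAt_segConv (k := fun _ => 1) (k' := fun _ => 0) (S := univ) hDo hD
    (fun _ _ _ _ => mem_univ _) (fun Z _ => hasDerivAt_const Z 1) continuousOn_const hf hX
  simpa [segConv] using this

end Convolution

/-! ### Linear differential equations on star-shaped domains -/

section LinearODE

open Set Filter

variable {E : Type*} [NormedAddCommGroup E] [NormedSpace ℂ E]

/-- Factorisation of `g` and of its Euler derivative by the order of vanishing. -/
theorem AnalyticAt.exists_order_factorization [CompleteSpace E] {g : ℂ → E} {b : ℂ}
    (hg : AnalyticAt ℂ g b) (h0 : g b = 0) (hne : ¬ ∀ᶠ x in 𝓝 b, g x = 0) :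
    ∃ (m : ℕ) (h : ℂ → E), AnalyticAt ℂ h b ∧ h b ≠ 0 ∧ 1 ≤ m ∧
      (∀ᶠ x in 𝓝 b, g x = (x - b) ^ m • h x) ∧
      ∀ᶠ x in 𝓝 b,
        (x - b) • deriv g x = (x - b) ^ m • ((m : ℂ) • h x + (x - b) • deriv h x) := by
  obtain ⟨m, h, hh, hb, he⟩ := hg.exists_eventuallyEq_pow_smul_nonzero_iff.2 hne
  have hm : m ≠ 0 := by
    rintro rfl
    have := he.self_of_nhds
    simp only [h0, pow_zero, one_smul] at this
    exact hb this.symm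
  refine ⟨m, h, hh, hb, Nat.one_le_iff_ne_zero.2 hm, he, ?_⟩
  filter_upwards [he.eventually_nhds, hh.eventually_analyticAt] with x hx hhx
  have d1 : HasDerivAt (fun z : ℂ => (z - b) ^ m) ((m : ℂ) * (x - b) ^ (m - 1)) x := by
    simpa using! ((hasDerivAt_id x).sub_const b).pow m
  have d2 := (d1.smul hhx.differentiableAt.hasDerivAt).congr_of_eventuallyEq hx
  rw [d2.deriv]
  obtain ⟨n, rfl⟩ := Nat.exists_eq_succ_of_ne_zero hm
  simp only [Nat.succ_eq_add_one, Nat.add_sub_cancel, pow_succ]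
  module

variable {D : Set ℂ} {M : ℂ → E →L[ℂ] E} {y z : ℂ → E}

theorem eventually_eq_zero_of_linear_ode [CompleteSpace E] {b : ℂ} (hM : ContinuousAt M b)
    (hy : AnalyticAt ℂ y b) (hode : ∀ᶠ x in 𝓝 b, HasDerivAt y (M x (y x)) x) (h0 : y b = 0) :
    ∀ᶠ x in 𝓝 b, y x = 0 := by
  by_contra hne
  obtain ⟨m, h, hh, hb, hm, e1, e2⟩ := hy.exists_order_factorization h0 hne
  have key : ∀ᶠ x in 𝓝[≠] b,
      (m : ℂ) • h x + (x - b) • deriv h x = (x - b) • M x (h x) := by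
    filter_upwards [hode.filter_mono nhdsWithin_le_nhds, e1.filter_mono nhdsWithin_le_nhds,
      e2.filter_mono nhdsWithin_le_nhds, self_mem_nhdsWithin] with x hx h1 h2 hxb
    rw [hx.deriv, h1, map_smul, smul_comm] at h2
    exact (smul_right_injective E (pow_ne_zero m (sub_ne_zero.2 hxb)) h2).symm
  have hsub : Tendsto (fun x : ℂ => x - b) (𝓝 b) (𝓝 0) := by
    have : ContinuousAt (fun x : ℂ => x - b) b := by fun_prop
    simpa [ContinuousAt] using this
  have l1 : Tendsto (fun x => (m : ℂ) • h x + (x - b) • deriv h x) (𝓝[≠] b)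
      (𝓝 ((m : ℂ) • h b + (0 : ℂ) • deriv h b)) :=
    ((hh.continuousAt.tendsto.const_smul _).add
      (hsub.smul hh.deriv.continuousAt.tendsto)).mono_left nhdsWithin_le_nhds
  have l2 : Tendsto (fun x => (x - b) • M x (h x)) (𝓝[≠] b) (𝓝 ((0 : ℂ) • M b (h b))) :=
    (hsub.smul (hM.clm_apply hh.continuousAt).tendsto).mono_left nhdsWithin_le_nhds
  have := tendsto_nhds_unique (l1.congr' key) l2
  simp only [zero_smul, add_zero, smul_eq_zero, Nat.cast_eq_zero] at this
  rcases this with h | h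
  · omega
  · exact hb h

theorem linear_ode_eqOn_zero [CompleteSpace E] (hDo : IsOpen D) (hD : IsPreconnected D)
    (hM : ContinuousOn M D) (hy : ∀ x ∈ D, HasDerivAt y (M x (y x)) x) {b : ℂ}
    (hb : b ∈ D) (h0 : y b = 0) : EqOn y 0 D := by
  have hyd : DifferentiableOn ℂ y D := fun x hx =>
    (hy x hx).differentiableAt.differentiableWithinAt
  have hya := hyd.analyticOnNhd hDo
  refine hya.eqOn_zero_of_preconnected_of_eventuallyEq_zero hD hb ?_
  exact eventually_eq_zero_of_linear_ode (hM.continuousAt (hDo.mem_nhds hb)) (hya b hb)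
    (eventually_of_mem (hDo.mem_nhds hb) hy) h0

theorem linear_ode_eqOn [CompleteSpace E] (hDo : IsOpen D) (hD : IsPreconnected D)
    (hM : ContinuousOn M D) (hy : ∀ x ∈ D, HasDerivAt y (M x (y x)) x)
    (hz : ∀ x ∈ D, HasDerivAt z (M x (z x)) x)
    {b : ℂ} (hb : b ∈ D) (h0 : y b = z b) : EqOn y z D := by
  have := linear_ode_eqOn_zero (y := fun x => y x - z x) hDo hD hM
    (fun x hx => by simpa using (hy x hx).fun_sub (hz x hx)) hb (sub_eq_zero.2 h0)
  exact fun x hx => sub_eq_zero.1 (this hx)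

/-- The initial value problem for a linear equation with holomorphic coefficients is solvable on
every open domain that is star-shaped with respect to the initial point. The solution is the
sum of the Picard iterates, whose convergence is uniform on neighbourhoods of segments. -/
theorem exists_linear_ode_solution [CompleteSpace E] {c : ℂ} (hDo : IsOpen D)
    (hD : StarConvex ℝ c D) (hM : DifferentiableOn ℂ M D) (v : E) :
    ∃ y : ℂ → E, y c = v ∧ ∀ x ∈ D, HasDerivAt y (M x (y x)) x := by
  have hstep : ∀ f : ℂ → E, DifferentiableOn ℂ f D → ∃ F : ℂ → E, DifferentiableOn ℂ F D ∧
      F c = 0 ∧ (∀ X ∈ D, HasDerivAt F (M X (f X)) X) ∧ ∀ X, F X =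
        ∫ s in (0 : ℝ)..1, (X - c) • M (c + s * (X - c)) (f (c + s * (X - c))) := by
    intro f hf
    obtain ⟨F, h1, h2, h3⟩ := hD.exists_primitive hDo (hM.clm_apply hf)
    exact ⟨F, fun X hX => (h2 X hX).differentiableAt.differentiableWithinAt, h1, h2, h3⟩
  choose! Φ hΦ1 hΦ2 hΦ3 hΦ4 using hstep
  set Y : ℕ → ℂ → E := fun n => Φ^[n] (fun _ => v) with hY
  have hYs : ∀ n, Y (n + 1) = Φ (Y n) := fun n => Function.iterate_succ_apply' _ _ _
  have hYd : ∀ n, DifferentiableOn ℂ (Y n) D := by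
    intro n
    induction n with
    | zero => exact differentiableOn_const v
    | succ n ih => rw [hYs]; exact hΦ1 _ ih
  have hY0 : ∀ n, Y (n + 1) c = 0 := fun n => by rw [hYs]; exact hΦ2 _ (hYd n)
  have hY' : ∀ n, ∀ X ∈ D, HasDerivAt (Y (n + 1)) (M X (Y n X)) X := fun n => by
    rw [hYs]; exact hΦ3 _ (hYd n)
  have hYe : ∀ n X, Y (n + 1) X =
      ∫ s in (0 : ℝ)..1, (X - c) • M (c + s * (X - c)) (Y n (c + s * (X - c))) := fun n X => by
    rw [hYs]; exact hΦ4 _ (hYd n) X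
  -- the factorial bound on the iterates along segments
  have hbound : ∀ (B R : ℝ), 0 ≤ B → ∀ X : ℂ, ‖X - c‖ ≤ R →
      (∀ s ∈ Icc (0 : ℝ) 1, ‖M (c + s * (X - c))‖ ≤ B) → ∀ n, ∀ s ∈ Icc (0 : ℝ) 1,
      ‖Y n (c + s * (X - c))‖ ≤ ‖v‖ * ((B * R) ^ n * s ^ n / n.factorial) := by
    intro B R hB X hXR hMB n
    have hR : 0 ≤ R := (norm_nonneg _).trans hXR
    induction n with
    | zero => intro s _; simp [hY]
    | succ n ih =>
      intro s hs
      rw [hYe]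
      have hle : ∀ t ∈ Icc (0 : ℝ) 1,
          ‖(c + s * (X - c) - c) • M (c + t * (c + s * (X - c) - c))
            (Y n (c + t * (c + s * (X - c) - c)))‖ ≤
          ‖v‖ * ((B * R) ^ (n + 1) * s ^ (n + 1) / n.factorial) * t ^ n := by
        intro t ht
        have hts : t * s ∈ Icc (0 : ℝ) 1 :=
          ⟨mul_nonneg ht.1 hs.1, mul_le_one₀ ht.2 hs.1 hs.2⟩
        have e : c + t * (c + s * (X - c) - c) = c + ((t * s : ℝ) : ℂ) * (X - c) := by
          push_cast; ring
        rw [e, norm_smul]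
        have h1 : ‖c + s * (X - c) - c‖ ≤ s * R := by
          rw [add_sub_cancel_left, norm_mul, Complex.norm_real, Real.norm_of_nonneg hs.1]
          exact mul_le_mul_of_nonneg_left hXR hs.1
        calc _ ≤ (s * R) * (B * (‖v‖ * ((B * R) ^ n * (t * s) ^ n / n.factorial))) := by
              apply mul_le_mul h1 _ (norm_nonneg _) (mul_nonneg hs.1 hR)
              exact (ContinuousLinearMap.le_opNorm _ _).trans
                (mul_le_mul (hMB _ hts) (ih _ hts) (norm_nonneg _) hB)
          _ = _ := by rw [mul_pow t s]; ring
      have h2 := intervalIntegral.norm_integral_le_of_norm_le (a := 0) (b := 1)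
        (μ := MeasureTheory.volume) zero_le_one
        (Eventually.of_forall fun t ht => hle t (Ioc_subset_Icc_self ht))
        (Continuous.intervalIntegrable (by fun_prop) _ _)
      refine h2.trans (le_of_eq ?_)
      rw [intervalIntegral.integral_const_mul, integral_pow]
      have hn : ((n : ℝ) + 1) ≠ 0 := by positivity
      have hf : (n.factorial : ℝ) ≠ 0 := by positivity
      rw [Nat.factorial_succ]
      push_cast
      field_simp
      simp
  refine ⟨fun X => ∑' n, Y n X, ?_, fun X hX => ?_⟩
  · change ∑' n, Y n c = v
    rw [tsum_eq_single 0]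
    · simp [hY]
    · intro n hn
      obtain ⟨m, rfl⟩ := Nat.exists_eq_succ_of_ne_zero hn
      exact hY0 m
  · obtain ⟨r, hr, hrD⟩ := Metric.nhds_basis_closedBall.mem_iff.1 (hDo.mem_nhds hX)
    have hcpt : IsCompact (Metric.closedBall X r ×ˢ Icc (0 : ℝ) 1) :=
      (isCompact_closedBall X r).prod isCompact_Icc
    have hcont : ContinuousOn (fun q : ℂ × ℝ => M (c + q.2 * (q.1 - c)))
        (Metric.closedBall X r ×ˢ Icc (0 : ℝ) 1) :=
      hM.continuousOn.comp (by fun_prop) fun q hq => hD.seg_mem (hrD hq.1) hq.2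
    obtain ⟨B, hB⟩ := hcpt.exists_bound_of_continuousOn hcont
    have hB0 : 0 ≤ B := (norm_nonneg _).trans
      (hB (X, 0) ⟨Metric.mem_closedBall_self hr.le, by simp⟩)
    set R := ‖X - c‖ + r
    set u : ℕ → ℝ := fun n => ‖v‖ * ((B * R) ^ n / n.factorial) with hu
    have hus : Summable u := (Real.summable_pow_div_factorial (B * R)).mul_left _
    have hle : ∀ n, ∀ w ∈ Metric.ball X r, ‖Y n w‖ ≤ u n := by
      intro n w hw
      have hwR : ‖w - c‖ ≤ R := by
        calc ‖w - c‖ = ‖(X - c) + (w - X)‖ := by ring_nf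
          _ ≤ ‖X - c‖ + ‖w - X‖ := norm_add_le _ _
          _ ≤ R := add_le_add le_rfl (mem_ball_iff_norm.1 hw).le
      simpa [hu] using hbound B R hB0 w hwR
        (fun s hs => hB (w, s) ⟨Metric.ball_subset_closedBall hw, hs⟩) n 1 (by simp)
    have hsub : Metric.ball X r ⊆ D := Metric.ball_subset_closedBall.trans hrD
    have hXb : X ∈ Metric.ball X r := Metric.mem_ball_self hr
    have hd := Complex.differentiableOn_tsum_of_summable_norm hus
      (fun n => (hYd n).mono hsub) Metric.isOpen_ball hle
    have hs := Complex.hasSum_deriv_of_summable_norm hus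
      (fun n => (hYd n).mono hsub) Metric.isOpen_ball hle hXb
    have hsum : HasSum (fun n => Y n X) (∑' n, Y n X) :=
      (Summable.of_norm_bounded hus fun n => hle n X hXb).hasSum
    have h2 : HasSum (fun n => deriv (Y (n + 1)) X) (M X (∑' n, Y n X)) := by
      simpa only [(hY' _ X hX).deriv] using (M X).hasSum hsum
    have h3 := hs.unique ((hasSum_nat_add_iff' 1).1
      (by simpa [hY] using h2))
    rw [← h3]
    exact (hd.differentiableAt (Metric.isOpen_ball.mem_nhds hXb)).hasDerivAt

end LinearODE

/-! ### Local theory of Okubo systems -/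

section OkuboLocal

open Set Filter

variable {ι : Type} [Fintype ι] {T : ι → ℂ} {A : Matrix ι ι ℂ}

/-- Multiplication by the matrix `A`, as a continuous linear map. -/
noncomputable def Matrix.mulVecCLM {κ : Type} (B : Matrix κ ι ℂ) [Fintype κ] :
    (ι → ℂ) →L[ℂ] (κ → ℂ) :=
  LinearMap.toContinuousLinearMap B.mulVecLin

@[simp]
theorem Matrix.mulVecCLM_apply {κ : Type} [Fintype κ] (B : Matrix κ ι ℂ) (v : ι → ℂ) :
    B.mulVecCLM v = B *ᵥ v := rfl

theorem analyticAt_mulVec {κ : Type} [Fintype κ] (B : Matrix κ ι ℂ) {g : ℂ → ι → ℂ} {b : ℂ}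
    (hg : AnalyticAt ℂ g b) : AnalyticAt ℂ (fun x => B *ᵥ g x) b :=
  (B.mulVecCLM.analyticAt _).comp hg

variable [DecidableEq ι]

theorem smul_one_sub_diagonal_mulVec (x : ℂ) (v : ι → ℂ) (i : ι) :
    ((x • (1 : Matrix ι ι ℂ) - Matrix.diagonal T) *ᵥ v) i = (x - T i) * v i := by
  simp [Matrix.sub_mulVec, Matrix.smul_mulVec, Matrix.mulVec_diagonal, sub_mul]

/-- The coefficient `v ↦ (x - T)⁻¹ A v` of the system `(x - T) u' = A u` solved for `u'`. -/
noncomputable def okuboField (T : ι → ℂ) (A : Matrix ι ι ℂ) (x : ℂ) : (ι → ℂ) →L[ℂ] (ι → ℂ) :=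
  ∑ i, (x - T i)⁻¹ • ((ContinuousLinearMap.single ℂ (fun _ : ι => ℂ) i).comp
    ((ContinuousLinearMap.proj i).comp A.mulVecCLM))

theorem okuboField_apply (x : ℂ) (v : ι → ℂ) (i : ι) :
    okuboField T A x v i = (x - T i)⁻¹ * (A *ᵥ v) i := by
  simp [okuboField, Pi.single_apply]

theorem differentiableOn_okuboField {D : Set ℂ} (hT : ∀ i, T i ∉ D) :
    DifferentiableOn ℂ (okuboField T A) D := by
  unfold okuboField
  apply DifferentiableOn.fun_sum
  intro i _
  apply DifferentiableOn.smul_const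
  exact (differentiableOn_id.sub_const _).inv fun x hx h => hT i (sub_eq_zero.1 h ▸ hx)

theorem isONFSolution_iff {D : Set ℂ} (hT : ∀ i, T i ∉ D) {u : ℂ → ι → ℂ} :
    IsONFSolution T A D u ↔ ∀ x ∈ D, HasDerivAt u (okuboField T A x (u x)) x := by
  refine forall₂_congr fun x hx => ?_
  have hne : ∀ i, x - T i ≠ 0 := fun i h => hT i (sub_eq_zero.1 h ▸ hx)
  constructor
  · rintro ⟨u', h1, h2⟩
    refine h1.congr_deriv ?_
    funext i
    rw [okuboField_apply, ← h2, smul_one_sub_diagonal_mulVec, inv_mul_cancel_left₀ (hne i)]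
  · intro h
    refine ⟨_, h, ?_⟩
    funext i
    rw [smul_one_sub_diagonal_mulVec, okuboField_apply, mul_inv_cancel_left₀ (hne i)]

/-- The diagonal block of `A` at the singular point `b` is diagonal with entries `lam`. -/
def DiagonalBlock (T : ι → ℂ) (A : Matrix ι ι ℂ) (b : ℂ) (lam : ι → ℂ) : Prop :=
  ∀ i j, T i = b → T j = b → A i j = if i = j then lam i else 0

theorem DiagonalBlock.mulVec_apply {b : ℂ} {lam : ι → ℂ} (h : DiagonalBlock T A b lam)
    (v : ι → ℂ) {i : ι} (hi : T i = b) :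
    (A *ᵥ v) i = lam i * v i + ∑ j, (if T j = b then 0 else A i j * v j) := by
  have h1 : lam i * v i = ∑ j, if j = i then lam j * v j else 0 := by simp
  rw [h1, ← Finset.sum_add_distrib]
  refine Finset.sum_congr rfl fun j _ => ?_
  by_cases hj : T j = b
  · have hA := h i j hi hj
    by_cases hij : i = j
    · subst hij; rw [if_pos rfl] at hA; simp [hj, hA]
    · rw [if_neg hij] at hA; simp [hj, hA, Ne.symm hij]
  · have hij : j ≠ i := by rintro rfl; exact hj hi
    simp [hj, hij]

/-- `g` solves the equation satisfied by the power series factor of a solution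
`(x - b) ^ s • g x` of the system `(x - T) u' = A u`, at the point `x`. -/
def OkuboFactorEq (T : ι → ℂ) (A : Matrix ι ι ℂ) (b s : ℂ) (g : ℂ → ι → ℂ) (x : ℂ) : Prop :=
  ∀ i, (x - T i) * (s * g x i + (x - b) * deriv g x i) = (x - b) * (A *ᵥ g x) i

/-- In the absence of resonances, a local solution with vanishing initial vector vanishes: its
leading coefficient would be an eigenvector of the residue at `b` for an excluded eigenvalue. -/
theorem eventually_eq_zero_of_okuboFactorEq {b s : ℂ} {lam : ι → ℂ} (hA : DiagonalBlock T A b lam)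
    (hs : ∀ m : ℕ, 1 ≤ m → s + m ≠ 0) (hl : ∀ i, T i = b → ∀ m : ℕ, 1 ≤ m → s + m ≠ lam i)
    {g : ℂ → ι → ℂ} (hg : AnalyticAt ℂ g b) (h0 : g b = 0)
    (heq : ∃ᶠ x in 𝓝[≠] b, OkuboFactorEq T A b s g x) : ∀ᶠ x in 𝓝 b, g x = 0 := by
  by_contra hne
  have hgi : ∀ i, AnalyticAt ℂ (fun x => g x i) b := analyticAt_pi_iff.1 hg
  have hgi' : ∀ i, AnalyticAt ℂ (fun x => deriv g x i) b := analyticAt_pi_iff.1 hg.deriv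
  have hAi : ∀ i, AnalyticAt ℂ (fun x => (A *ᵥ g x) i) b :=
    analyticAt_pi_iff.1 (analyticAt_mulVec A hg)
  have heq' : ∀ i, ∀ᶠ x in 𝓝 b,
      (x - T i) * (s * g x i + (x - b) * deriv g x i) = (x - b) * (A *ᵥ g x) i := fun i =>
    (AnalyticAt.frequently_eq_iff_eventually_eq (by have := hgi i; have := hgi' i; fun_prop)
      (by have := hAi i; fun_prop)).1 (heq.mono fun x hx => hx i)
  obtain ⟨m, h, hh, hb, hm, e1, e2⟩ := hg.exists_order_factorization h0 hne
  have hhi : ∀ i, ContinuousAt (fun x => h x i) b := fun i =>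
    (analyticAt_pi_iff.1 hh i).continuousAt
  have hhi' : ∀ i, ContinuousAt (fun x => deriv h x i) b := fun i =>
    (analyticAt_pi_iff.1 hh.deriv i).continuousAt
  have hAh : ∀ i, ContinuousAt (fun x => (A *ᵥ h x) i) b := fun i =>
    (analyticAt_pi_iff.1 (analyticAt_mulVec A hh) i).continuousAt
  have hfac : ∀ i, ∀ᶠ x in 𝓝[≠] b,
      (x - T i) * ((s + m) * h x i + (x - b) * deriv h x i) = (x - b) * (A *ᵥ h x) i := by
    intro i
    filter_upwards [(heq' i).filter_mono nhdsWithin_le_nhds, e1.filter_mono nhdsWithin_le_nhds,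
      e2.filter_mono nhdsWithin_le_nhds, self_mem_nhdsWithin] with x h1 h2 h3 hx
    have h3i := congrFun h3 i
    simp only [Pi.smul_apply, smul_eq_mul, Pi.add_apply] at h3i
    rw [h3i, h2, Matrix.mulVec_smul] at h1
    simp only [Pi.smul_apply, smul_eq_mul] at h1
    have hz : (x - b) ^ m ≠ 0 := pow_ne_zero m (sub_ne_zero.2 hx)
    apply mul_left_cancel₀ hz
    linear_combination h1
  have hnb : ∀ i, T i ≠ b → h b i = 0 := by
    intro i hi
    have l1 : ContinuousAt (fun x => (x - T i) * ((s + m) * h x i + (x - b) * deriv h x i)) b := by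
      have := hhi i; have := hhi' i; fun_prop
    have l2 : ContinuousAt (fun x => (x - b) * (A *ᵥ h x) i) b := by
      have := hAh i; fun_prop
    have := tendsto_nhds_unique
      ((l1.tendsto.mono_left nhdsWithin_le_nhds).congr' (hfac i))
      (l2.tendsto.mono_left nhdsWithin_le_nhds)
    simp only [sub_self, zero_mul, add_zero, mul_eq_zero, sub_eq_zero] at this
    rcases this with h | h | h
    · exact absurd h.symm hi
    · exact absurd h (hs m hm)
    · exact h
  have hblk : ∀ i, T i = b → h b i = 0 := by
    intro i hi
    have l1 : ContinuousAt (fun x => (s + m) * h x i + (x - b) * deriv h x i) b := by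
      have := hhi i; have := hhi' i; fun_prop
    have hev : ∀ᶠ x in 𝓝[≠] b,
        (s + m) * h x i + (x - b) * deriv h x i = (A *ᵥ h x) i := by
      filter_upwards [hfac i, self_mem_nhdsWithin] with x h1 hx
      rw [hi] at h1
      exact mul_left_cancel₀ (sub_ne_zero.2 hx) h1
    have := tendsto_nhds_unique
      ((l1.tendsto.mono_left nhdsWithin_le_nhds).congr' hev)
      ((hAh i).tendsto.mono_left nhdsWithin_le_nhds)
    rw [hA.mulVec_apply _ hi, Finset.sum_eq_zero, sub_self, zero_mul, add_zero, add_zero,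
      ← sub_eq_zero, ← sub_mul, mul_eq_zero, sub_eq_zero] at this
    · exact this.resolve_left (hl i hi m hm)
    · intro j _
      by_cases hj : T j = b
      · simp [hj]
      · simp [hj, hnb j hj]
  refine hb (funext fun i => ?_)
  by_cases hi : T i = b
  · exact hblk i hi
  · exact hnb i hi

theorem exists_bound_inv_add_nat (z : ℂ) : ∃ C : ℝ, ∀ m : ℕ, ‖(z + m)⁻¹‖ ≤ C := by
  have h1 : Tendsto (fun m : ℕ => z + (m : ℂ)) atTop (Bornology.cobounded ℂ) := by
    have h := tendsto_natCast_atTop_cobounded (α := ℂ)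
    rw [← tendsto_norm_atTop_iff_cobounded] at h ⊢
    have h2 : Tendsto (fun m : ℕ => ‖(m : ℂ)‖ - ‖z‖) atTop atTop :=
      tendsto_atTop_add_const_right _ _ h
    refine tendsto_atTop_mono (fun m => ?_) h2
    have := norm_sub_norm_le (m : ℂ) (-z)
    rw [norm_neg, sub_neg_eq_add, add_comm] at this
    exact this
  have h2 := (tendsto_inv₀_cobounded (α := ℂ)).comp h1
  obtain ⟨C, hC⟩ := (Metric.isBounded_range_of_tendsto _ h2).exists_norm_le
  exact ⟨C, fun m => hC _ ⟨m, rfl⟩⟩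

/-- Existence of the local solution `(x - b) ^ s • g x` with prescribed initial vector `g b = e`.
The coefficients of `g` satisfy a two-term recursion, so they grow at most geometrically. -/
theorem exists_okuboFactor {b s : ℂ} {lam : ι → ℂ} (hA : DiagonalBlock T A b lam)
    (hs : ∀ m : ℕ, 1 ≤ m → s + m ≠ 0) (hl : ∀ i, T i = b → ∀ m : ℕ, 1 ≤ m → s + m ≠ lam i)
    {e : ι → ℂ} (he : ∀ i, T i ≠ b → s * e i = 0) (he' : ∀ i, T i = b → s * e i = (A *ᵥ e) i) :
    ∃ (g : ℂ → ι → ℂ) (r : ℝ), 0 < r ∧ g b = e ∧ DifferentiableOn ℂ g (Metric.ball b r) ∧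
      ∀ x ∈ Metric.ball b r, OkuboFactorEq T A b s g x := by
  -- the entries outside the block, then those inside it
  set nb : ℕ → (ι → ℂ) → ι → ℂ := fun m v i =>
    if T i = b then 0 else (b - T i)⁻¹ * ((s + 1 + m)⁻¹ * (A *ᵥ v) i -
      (1 - (s + 1 + m)⁻¹) * v i) with hnb
  set nx : ℕ → (ι → ℂ) → ι → ℂ := fun m v i =>
    if T i = b then (s + 1 - lam i + m)⁻¹ * (A *ᵥ nb m v) i else nb m v i with hnx
  set G : ℕ → ι → ℂ := fun m => Nat.rec e (fun m v => nx m v) m with hG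
  have hGs : ∀ m, G (m + 1) = nx m (G m) := fun m => rfl
  have hs1 : ∀ m : ℕ, s + 1 + m ≠ 0 := fun m => by
    have := hs (m + 1) (by omega); push_cast at this; rwa [add_right_comm, add_assoc]
  have hl1 : ∀ i, T i = b → ∀ m : ℕ, s + 1 - lam i + m ≠ 0 := fun i hi m h => by
    apply hl i hi (m + 1) (by omega); push_cast; linear_combination h
  have hrec : ∀ m i, (s + m) * G m i + (b - T i) * ((s + 1 + m) * G (m + 1) i) =
      (A *ᵥ G m) i := by
    intro m i
    by_cases hi : T i = b
    · rw [hi, sub_self, zero_mul, add_zero]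
      cases m with
      | zero => simpa [hG] using he' i hi
      | succ m =>
        rw [hA.mulVec_apply _ hi]
        have e1 : ∀ j, (if T j = b then 0 else A i j * G (m + 1) j) = A i j * nb m (G m) j := by
          intro j
          by_cases hj : T j = b
          · simp [hj, hnb]
          · simp only [hj, hGs, hnx, if_false]
        simp only [e1]
        change _ = lam i * _ + (A *ᵥ nb m (G m)) i
        have e2 : (s + 1 - lam i + m) * G (m + 1) i = (A *ᵥ nb m (G m)) i := by
          rw [hGs]
          simp only [hnx, hi, if_true]
          rw [mul_inv_cancel_left₀ (hl1 i hi m)]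
        rw [← e2]; push_cast; ring
    · have hbi : b - T i ≠ 0 := sub_ne_zero.2 (Ne.symm hi)
      have := hs1 m
      rw [hGs]
      simp only [hnx, hnb, hi, if_false]
      field_simp
      ring
  -- uniform bound of one step of the recursion
  obtain ⟨C, hC0, hC⟩ : ∃ C : ℝ, 0 ≤ C ∧ ∀ m v, ‖nx m v‖ ≤ C * ‖v‖ := by
    obtain ⟨C1, hC1⟩ := exists_bound_inv_add_nat (s + 1)
    choose C2 hC2 using fun i => exists_bound_inv_add_nat (s + 1 - lam i)
    have hC10 : 0 ≤ C1 := (norm_nonneg _).trans (hC1 0)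
    have hC20 : ∀ i, 0 ≤ C2 i := fun i => (norm_nonneg _).trans (hC2 i 0)
    set a := ‖A.mulVecCLM‖
    have ha : ∀ v, ‖A *ᵥ v‖ ≤ a * ‖v‖ := fun v => A.mulVecCLM.le_opNorm v
    have ha0 : 0 ≤ a := norm_nonneg _
    set K := ∑ i, ‖(b - T i)⁻¹‖
    have hK0 : 0 ≤ K := Finset.sum_nonneg fun _ _ => norm_nonneg _
    have hK : ∀ i, ‖(b - T i)⁻¹‖ ≤ K := fun i =>
      Finset.single_le_sum (f := fun i => ‖(b - T i)⁻¹‖) (fun _ _ => norm_nonneg _)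
        (Finset.mem_univ i)
    set K2 := ∑ i, C2 i
    have hK20 : 0 ≤ K2 := Finset.sum_nonneg fun i _ => hC20 i
    have hK2 : ∀ i, C2 i ≤ K2 := fun i =>
      Finset.single_le_sum (f := C2) (fun i _ => hC20 i) (Finset.mem_univ i)
    set N := K * (C1 * a + (1 + C1)) with hN
    have hN0 : 0 ≤ N := by positivity
    have hnbb : ∀ m v, ‖nb m v‖ ≤ N * ‖v‖ := by
      intro m v
      rw [pi_norm_le_iff_of_nonneg (by positivity)]
      intro i
      simp only [hnb]
      split_ifs with hi
      · rw [norm_zero]; positivity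
      · rw [norm_mul, hN, mul_assoc]
        refine mul_le_mul (hK i) ?_ (norm_nonneg _) hK0
        refine (norm_sub_le _ _).trans ?_
        rw [norm_mul, norm_mul, add_mul]
        refine add_le_add ?_ ?_
        · rw [mul_assoc]
          exact mul_le_mul (hC1 m) ((norm_le_pi_norm _ i).trans (ha v)) (norm_nonneg _) hC10
        · refine mul_le_mul ?_ (norm_le_pi_norm v i) (norm_nonneg _) (by positivity)
          refine (norm_sub_le _ _).trans ?_
          rw [norm_one]; exact add_le_add le_rfl (hC1 m)
    refine ⟨K2 * (a * N) + N, by positivity, fun m v => ?_⟩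
    rw [pi_norm_le_iff_of_nonneg (by positivity)]
    intro i
    simp only [hnx]
    split_ifs with hi
    · rw [norm_mul, add_mul]
      refine le_trans ?_ (le_add_of_nonneg_right (by positivity))
      rw [mul_assoc, mul_assoc]
      refine mul_le_mul ((hC2 i m).trans (hK2 i)) ?_ (norm_nonneg _) hK20
      exact (norm_le_pi_norm _ i).trans ((ha _).trans (mul_le_mul_of_nonneg_left (hnbb m v) ha0))
    · rw [add_mul]
      refine le_trans ?_ (le_add_of_nonneg_left (by positivity))
      exact (norm_le_pi_norm _ i).trans (hnbb m v)
  have hGb : ∀ m, ‖G m‖ ≤ ‖e‖ * C ^ m := by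
    intro m
    induction m with
    | zero => simp [hG]
    | succ m ih =>
      rw [hGs]
      calc _ ≤ C * ‖G m‖ := hC _ _
        _ ≤ C * (‖e‖ * C ^ m) := mul_le_mul_of_nonneg_left ih hC0
        _ = _ := by ring
  set r : ℝ := (2 * (C + 1))⁻¹ with hr
  have hr0 : 0 < r := by positivity
  have hCr : C * r ≤ 2⁻¹ := by
    rw [hr, mul_inv, ← div_eq_mul_inv, ← mul_div_assoc]
    rw [div_le_iff₀ (by positivity)]
    linarith
  set u : ℕ → ℝ := fun m => ‖e‖ * (2⁻¹ : ℝ) ^ m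
  have hu : Summable u := (summable_geometric_of_lt_one (by norm_num) (by norm_num)).mul_left _
  set F : ℕ → ℂ → ι → ℂ := fun m x => (x - b) ^ m • G m with hF
  have hFd : ∀ m, Differentiable ℂ (F m) := fun m => by
    simp only [hF]; fun_prop
  have hFb : ∀ m, ∀ x ∈ Metric.ball b r, ‖F m x‖ ≤ u m := by
    intro m x hx
    simp only [hF, norm_smul, norm_pow]
    calc ‖x - b‖ ^ m * ‖G m‖ ≤ r ^ m * (‖e‖ * C ^ m) :=
          mul_le_mul (pow_le_pow_left₀ (norm_nonneg _) (mem_ball_iff_norm.1 hx).le m) (hGb m)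
            (norm_nonneg _) (by positivity)
      _ = ‖e‖ * (C * r) ^ m := by rw [mul_pow]; ring
      _ ≤ u m := by
        refine mul_le_mul_of_nonneg_left ?_ (norm_nonneg _)
        exact pow_le_pow_left₀ (by positivity) hCr m
  refine ⟨fun x => ∑' m, F m x, r, hr0, ?_, ?_, ?_⟩
  · change ∑' m, F m b = e
    rw [tsum_eq_single 0]
    · simp [hF, hG]
    · intro m hm
      simp [hF, hm]
  · exact Complex.differentiableOn_tsum_of_summable_norm hu
      (fun m => (hFd m).differentiableOn) Metric.isOpen_ball hFb
  · intro x hx i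
    have s1 : HasSum (fun m => F m x) (∑' m, F m x) :=
      (Summable.of_norm_bounded hu fun m => hFb m x hx).hasSum
    have s2 := Complex.hasSum_deriv_of_summable_norm hu
      (fun m => (hFd m).differentiableOn) Metric.isOpen_ball hFb hx
    set g := ∑' m, F m x
    set g' := deriv (fun x => ∑' m, F m x) x
    have s1i : HasSum (fun m => (x - b) ^ m * G m i) (g i) := by
      simpa [hF] using Pi.hasSum.1 s1 i
    have s2i : HasSum (fun m : ℕ => (m : ℂ) * ((x - b) ^ m * G m i)) ((x - b) * g' i) := by
      refine ((Pi.hasSum.1 s2 i).mul_left (x - b)).congr_fun ?_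
      intro m
      have hd : HasDerivAt (F m) (((m : ℂ) * (x - b) ^ (m - 1)) • G m) x := by
        have := (((hasDerivAt_id x).sub_const b).pow m).smul_const (G m)
        simpa using! this
      rw [hd.deriv]
      simp only [Pi.smul_apply, smul_eq_mul]
      cases m with
      | zero => simp
      | succ m => simp [pow_succ]; ring
    have s3i : HasSum (fun m => (x - b) ^ m * (A *ᵥ G m) i) ((A *ᵥ g) i) := by
      have := Pi.hasSum.1 (A.mulVecCLM.hasSum s1) i
      simpa [hF, Matrix.mulVec_smul] using this
    have s4 : HasSum (fun m : ℕ => (s + m) * ((x - b) ^ m * G m i))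
        (s * g i + (x - b) * g' i) := by
      simpa only [add_mul] using (s1i.mul_left s).add s2i
    have s5 := (hasSum_nat_add_iff' 1).2 (s4.mul_left (b - T i))
    have hz0 : (b - T i) * (s * G 0 i) = 0 := by
      by_cases hi : T i = b
      · rw [hi, sub_self, zero_mul]
      · rw [show G 0 = e from rfl, he i hi, mul_zero]
    simp only [Finset.range_one, Finset.sum_singleton, Nat.cast_zero, add_zero, pow_zero, one_mul,
      hz0, sub_zero] at s5
    have s6 := (s4.mul_left (x - b)).add s5
    have s7 := s3i.mul_left (x - b)
    have := s6.unique (s7.congr_fun fun m => ?_)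
    · linear_combination this
    · rw [← hrec m i]
      push_cast
      ring

end OkuboLocal

/-! ### Functions with a power singularity -/

section PowerSingularity

open Set Filter

theorem powNear_ne_zero (c : ℝ) (z s : ℂ) : powNear c z s ≠ 0 := Complex.exp_ne_zero _

@[simp]
theorem powNear_zero_right (c : ℝ) (z : ℂ) : powNear c z 0 = 1 := by simp [powNear]

/-- Near `b`, the set `D` avoids the cut of the branch of `(x - b) ^ s` centred at angle `c`. -/
def OffCut (D : Set ℂ) (b : ℂ) (c : ℝ) : Prop :=
  ∀ᶠ x in 𝓝[D] b, (x - b) * Complex.exp (-(c * Complex.I)) ∈ Complex.slitPlane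

theorem ne_of_mem_slitPlane {b x w : ℂ} (h : (x - b) * w ∈ Complex.slitPlane) : x - b ≠ 0 := by
  intro h0
  rw [h0, zero_mul] at h
  exact Complex.slitPlane_ne_zero h rfl

theorem hasDerivAt_powNear {c : ℝ} {b x : ℂ} (s : ℂ)
    (hx : (x - b) * Complex.exp (-(c * Complex.I)) ∈ Complex.slitPlane) :
    HasDerivAt (fun x => powNear c (x - b) s) (powNear c (x - b) s * (s / (x - b))) x := by
  have h0 := ne_of_mem_slitPlane hx
  have d1 : HasDerivAt (fun x : ℂ => (x - b) * Complex.exp (-(c * Complex.I)))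
      (Complex.exp (-(c * Complex.I))) x := by
    simpa using ((hasDerivAt_id x).sub_const b).mul_const (Complex.exp (-(c * Complex.I)))
  have d2 := (((d1.clog hx).add_const (c * Complex.I)).const_mul s).cexp
  refine d2.congr_deriv ?_
  have := Complex.exp_ne_zero (-(c * Complex.I))
  simp only [powNear]
  field_simp

/-- On its domain `(x - b) ^ s` has logarithmic derivative `s / (x - b)`. -/
theorem hasDerivAt_powNear_smul {E : Type*} [NormedAddCommGroup E] [NormedSpace ℂ E]
    {c : ℝ} {b x : ℂ} (s : ℂ)
    (hx : (x - b) * Complex.exp (-(c * Complex.I)) ∈ Complex.slitPlane) {g : ℂ → E} {g' : E}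
    (hg : HasDerivAt g g' x) :
    HasDerivAt (fun x => powNear c (x - b) s • g x)
      (powNear c (x - b) s • (x - b)⁻¹ • (s • g x + (x - b) • g')) x := by
  have h0 := ne_of_mem_slitPlane hx
  refine ((hasDerivAt_powNear s hx).smul hg).congr_deriv ?_
  simp only [smul_add, smul_smul, div_eq_mul_inv, inv_mul_cancel₀ h0, mul_one]
  rw [add_comm, mul_comm s]

variable {ι : Type} [Fintype ι]

theorem analyticAt_tsum_pow_smul {b : ℂ} {G : ℕ → ι → ℂ} {R : ℝ} (hR : 0 < R)
    (hG : ∀ z : ℂ, ‖z‖ < R → Summable fun m => z ^ m • G m) :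
    AnalyticAt ℂ (fun x => ∑' m, (x - b) ^ m • G m) b := by
  obtain ⟨K, hK⟩ : ∃ K, ∀ m, (R / 2) ^ m * ‖G m‖ ≤ K := by
    have h := (hG (R / 2 : ℝ) (by
      rw [Complex.norm_real, Real.norm_of_nonneg (by positivity)]; linarith)).tendsto_atTop_zero
    obtain ⟨K, hK⟩ := (Metric.isBounded_range_of_tendsto _ h).exists_norm_le
    refine ⟨K, fun m => ?_⟩
    have := hK _ ⟨m, rfl⟩
    rwa [norm_smul, norm_pow, Complex.norm_real, Real.norm_of_nonneg (by positivity)] at this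
  have hu : Summable fun m : ℕ => K * (2⁻¹ : ℝ) ^ m :=
    (summable_geometric_of_lt_one (by norm_num) (by norm_num)).mul_left _
  have hd := Complex.differentiableOn_tsum_of_summable_norm (U := Metric.ball b (R / 4))
    (F := fun m x => (x - b) ^ m • G m) hu
    (fun m => by fun_prop) Metric.isOpen_ball (fun m x hx => ?_)
  · exact hd.analyticAt (Metric.ball_mem_nhds b (by positivity))
  · rw [norm_smul, norm_pow]
    calc ‖x - b‖ ^ m * ‖G m‖ ≤ (R / 4) ^ m * ‖G m‖ := by
          gcongr; exact (mem_ball_iff_norm.1 hx).le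
      _ = ((R / 2) ^ m * ‖G m‖) * 2⁻¹ ^ m := by
          rw [show R / 4 = R / 2 * 2⁻¹ by ring, mul_pow]; ring
      _ ≤ K * 2⁻¹ ^ m := by gcongr; exact hK m

theorem hasLocalForm_iff {D : Set ℂ} {b : ℂ} {c : ℝ} {s : ℂ} {e : ι → ℂ} {u : ℂ → ι → ℂ} :
    HasLocalForm D b c s e u ↔ ∃ g : ℂ → ι → ℂ, AnalyticAt ℂ g b ∧ g b = e ∧
      ∀ᶠ x in 𝓝[D] b, u x = powNear c (x - b) s • g x := by
  constructor
  · rintro ⟨G, h0, ⟨R, hR, hG⟩, hu⟩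
    refine ⟨_, analyticAt_tsum_pow_smul hR hG, ?_, hu⟩
    simp only [sub_self]
    rw [tsum_eq_single 0 (fun m hm => by simp [hm])]
    simpa using h0
  · rintro ⟨g, ⟨p, r, hp⟩, h0, hu⟩
    have hs : ∀ z : ℂ, ‖z‖ₑ < r → HasSum (fun m => z ^ m • p.coeff m) (g (b + z)) := by
      intro z hz
      simpa only [FormalMultilinearSeries.apply_eq_pow_smul_coeff] using
        hp.hasSum (y := z) (by simpa [Metric.mem_eball, edist_zero_right] using hz)
    obtain ⟨R, hR, hRr⟩ := ENNReal.lt_iff_exists_real_btwn.1 hp.r_pos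
    have hR0 : 0 < R := by simpa using hRr.1
    have hlt : ∀ z : ℂ, ‖z‖ < R → ‖z‖ₑ < r := fun z hz => by
      refine lt_trans ?_ hRr.2
      rw [← ofReal_norm]
      exact (ENNReal.ofReal_lt_ofReal_iff hR0).2 hz
    refine ⟨p.coeff, ?_, ⟨R, hR0, fun z hz => (hs z (hlt z hz)).summable⟩, ?_⟩
    · have h1 := hs 0 (hlt 0 (by simpa using hR0))
      have h2 := hasSum_single (f := fun m => (0 : ℂ) ^ m • p.coeff m) 0
        (fun m hm => by simp [hm])
      rw [← h0]
      simpa using h2.unique h1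
    · filter_upwards [hu, mem_nhdsWithin_of_mem_nhds (Metric.ball_mem_nhds b hR0)] with x hx hxb
      rw [hx, (hs (x - b) (hlt _ (mem_ball_iff_norm.1 hxb))).tsum_eq, add_sub_cancel]

variable [DecidableEq ι] {T : ι → ℂ} {A : Matrix ι ι ℂ}

theorem okuboFactorEq_iff {c : ℝ} {b x s : ℂ}
    (hx : (x - b) * Complex.exp (-(c * Complex.I)) ∈ Complex.slitPlane) {u g : ℂ → ι → ℂ}
    (hg : DifferentiableAt ℂ g x) (hu : ∀ᶠ y in 𝓝 x, u y = powNear c (y - b) s • g y) :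
    (∃ u' : ι → ℂ, HasDerivAt u u' x ∧
      (x • (1 : Matrix ι ι ℂ) - Matrix.diagonal T) *ᵥ u' = A *ᵥ u x) ↔
      OkuboFactorEq T A b s g x := by
  have h0 := ne_of_mem_slitPlane hx
  have hd := (hasDerivAt_powNear_smul s hx hg.hasDerivAt).congr_of_eventuallyEq hu
  have key : (x • (1 : Matrix ι ι ℂ) - Matrix.diagonal T) *ᵥ (powNear c (x - b) s • (x - b)⁻¹ •
      (s • g x + (x - b) • deriv g x)) = A *ᵥ u x ↔ OkuboFactorEq T A b s g x := by
    rw [hu.self_of_nhds, funext_iff]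
    refine forall_congr' fun i => ?_
    rw [smul_one_sub_diagonal_mulVec, Matrix.mulVec_smul]
    simp only [Pi.smul_apply, Pi.add_apply, smul_eq_mul]
    have hp := powNear_ne_zero c (x - b) s
    constructor
    · intro h
      have h2 := mul_left_cancel₀ hp (a := powNear c (x - b) s)
        (b := (x - T i) * ((x - b)⁻¹ * (s * g x i + (x - b) * deriv g x i)))
        (c := (A *ᵥ g x) i) (by rw [← h]; ring)
      rw [← h2]; field_simp
    · intro h
      have h2 : (A *ᵥ g x) i = (x - b)⁻¹ * ((x - T i) * (s * g x i + (x - b) * deriv g x i)) := by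
        rw [h, inv_mul_cancel_left₀ h0]
      rw [h2]; ring
  constructor
  · rintro ⟨u', h1, h2⟩
    rw [h1.unique hd] at h2
    exact key.1 h2
  · exact fun h => ⟨_, hd, key.2 h⟩

theorem eventually_nhds_of_eventually_nhdsWithin {D : Set ℂ} (hD : IsOpen D) {b : ℂ}
    {p : ℂ → Prop} (h : ∀ᶠ x in 𝓝[D] b, p x) : ∀ᶠ x in 𝓝[D] b, x ∈ D ∧ ∀ᶠ y in 𝓝 x, p y := by
  filter_upwards [eventually_eventually_nhdsWithin.2 h, self_mem_nhdsWithin] with x h1 h2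
  exact ⟨h2, by rwa [hD.nhdsWithin_eq h2] at h1⟩

/-- A solution on a connected domain is determined by its local form at a singular point. -/
theorem localForm_eqOn {D : Set ℂ} (hDo : IsOpen D) (hD : IsPreconnected D) {b : ℂ}
    (hb : b ∈ closure D) (hbD : b ∉ D) (hT : ∀ i, T i ∉ D) {c : ℝ} (hcut : OffCut D b c)
    {s : ℂ} {lam : ι → ℂ} (hA : DiagonalBlock T A b lam)
    (hs : ∀ m : ℕ, 1 ≤ m → s + m ≠ 0) (hl : ∀ i, T i = b → ∀ m : ℕ, 1 ≤ m → s + m ≠ lam i)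
    {e : ι → ℂ} {u v : ℂ → ι → ℂ} (hu : IsONFSolution T A D u) (hv : IsONFSolution T A D v)
    (hue : HasLocalForm D b c s e u) (hve : HasLocalForm D b c s e v) : EqOn u v D := by
  obtain ⟨g, hg, hg0, hgu⟩ := hasLocalForm_iff.1 hue
  obtain ⟨h, hh, hh0, hhv⟩ := hasLocalForm_iff.1 hve
  have hne : (𝓝[D] b).NeBot := mem_closure_iff_nhdsWithin_neBot.1 hb
  have hf : ∀ᶠ x in 𝓝[D] b, OkuboFactorEq T A b s (fun x => g x - h x) x := by
    filter_upwards [eventually_nhds_of_eventually_nhdsWithin hDo hgu,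
      eventually_nhds_of_eventually_nhdsWithin hDo hhv, hcut,
      (hg.eventually_analyticAt.filter_mono nhdsWithin_le_nhds),
      (hh.eventually_analyticAt.filter_mono nhdsWithin_le_nhds)] with x h1 h2 h3 h4 h5
    have e1 := (okuboFactorEq_iff h3 h4.differentiableAt h1.2).1 (hu x h1.1)
    have e2 := (okuboFactorEq_iff h3 h5.differentiableAt h2.2).1 (hv x h1.1)
    intro i
    have e1 := e1 i
    have e2 := e2 i
    rw [Matrix.mulVec_sub, deriv_fun_sub h4.differentiableAt h5.differentiableAt]
    simp only [Pi.sub_apply]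
    linear_combination e1 - e2
  have hle : 𝓝[D] b ≤ 𝓝[≠] b := nhdsWithin_mono _ fun x hx h => hbD (h ▸ hx)
  have hz := eventually_eq_zero_of_okuboFactorEq hA hs hl (hg.sub hh)
    (by simp [hg0, hh0]) (hf.frequently.filter_mono hle)
  obtain ⟨x, ⟨h1, h2⟩, hx⟩ := (((hz.filter_mono nhdsWithin_le_nhds).and
    (hgu.and hhv)).and (self_mem_nhdsWithin : D ∈ 𝓝[D] b)).exists
  refine linear_ode_eqOn hDo hD (differentiableOn_okuboField hT).continuousOn
    ((isONFSolution_iff hT).1 hu) ((isONFSolution_iff hT).1 hv) hx ?_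
  rw [h2.1, h2.2, sub_eq_zero.1 (show g x - h x = 0 from h1)]

end PowerSingularity

section PowerIndependence

open Set Filter

variable {E : Type*} [NormedAddCommGroup E] [NormedSpace ℂ E] [CompleteSpace E]
  {κ : Type} [Fintype κ]

/-- Powers `(x - b) ^ μ k` whose exponents are pairwise distinct modulo integers are independent
over the functions holomorphic at `b`. In the coordinate `s = log (x - b)` the summands are
eigenvectors of the monodromy `s ↦ s + 2πi` for distinct eigenvalues. -/
theorem powNear_independent {D : Set ℂ} (hDo : IsOpen D) {b : ℂ} (hb : b ∈ closure D)
    {c : ℝ} (hcut : OffCut D b c) {μ : κ → ℂ} (hμ : ∀ k h, k ≠ h → NotInt (μ k - μ h))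
    {g : κ → ℂ → E} (hg : ∀ k, AnalyticAt ℂ (g k) b)
    (h : ∀ᶠ x in 𝓝[D] b, ∑ k, powNear c (x - b) (μ k) • g k x = 0) (k : κ) :
    ∀ᶠ x in 𝓝 b, g k x = 0 := by
  have hne : (𝓝[D] b).NeBot := mem_closure_iff_nhdsWithin_neBot.1 hb
  obtain ⟨r, hr, hgr⟩ : ∃ r > 0, ∀ x ∈ Metric.ball b r, ∀ k, AnalyticAt ℂ (g k) x :=
    Metric.eventually_nhds_iff_ball.1 (eventually_all.2 fun k => (hg k).eventually_analyticAt)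
  obtain ⟨x₀, ⟨hx₀, hx₀'⟩, hc₀, hr₀⟩ := ((eventually_nhds_of_eventually_nhdsWithin hDo h).and
    (hcut.and (mem_nhdsWithin_of_mem_nhds (Metric.ball_mem_nhds b hr)))).exists
  have hx₀b := ne_of_mem_slitPlane hc₀
  set H : Set ℂ := {s | s.re < Real.log r} with hH
  have hHo : IsOpen H := isOpen_lt Complex.continuous_re continuous_const
  have hHc : IsPreconnected H := (convex_halfSpace_re_lt _).isPreconnected
  have hexp : ∀ s ∈ H, b + Complex.exp s ∈ Metric.ball b r := by
    intro s hs
    rw [mem_ball_iff_norm, add_sub_cancel_left, Complex.norm_exp]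
    exact (Real.lt_log_iff_exp_lt hr).1 hs
  set Φ : κ → ℂ → E := fun k s => Complex.exp (μ k * s) • g k (b + Complex.exp s) with hΦ
  have hΦa : ∀ k, AnalyticOnNhd ℂ (Φ k) H := by
    intro k
    refine DifferentiableOn.analyticOnNhd (fun s hs => ?_) hHo
    have := (hgr _ (hexp s hs) k).differentiableAt
    refine DifferentiableAt.differentiableWithinAt (DifferentiableAt.smul (by fun_prop) ?_)
    exact this.comp (f := fun s => b + Complex.exp s) s (by fun_prop)
  set s₀ : ℂ := Complex.log ((x₀ - b) * Complex.exp (-(c * Complex.I))) + c * Complex.I with hs₀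
  have hes₀ : Complex.exp s₀ = x₀ - b := by
    rw [hs₀, Complex.exp_add, Complex.exp_log (Complex.slitPlane_ne_zero hc₀), mul_assoc,
      ← Complex.exp_add]
    simp
  have hs₀H : s₀ ∈ H := by
    change s₀.re < Real.log r
    rw [Real.lt_log_iff_exp_lt hr, ← Complex.norm_exp, hes₀]
    exact mem_ball_iff_norm.1 hr₀
  have hsum0 : ∀ᶠ s in 𝓝 s₀, ∑ k, Φ k s = 0 := by
    have hcont : ContinuousAt (fun s : ℂ => b + Complex.exp s) s₀ := by fun_prop
    have h1 : ∀ᶠ s in 𝓝 s₀,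
        ∑ k, powNear c (b + Complex.exp s - b) (μ k) • g k (b + Complex.exp s) = 0 := by
      refine hcont.tendsto.eventually (p := fun y =>
        ∑ k, powNear c (y - b) (μ k) • g k y = 0) ?_
      rwa [hes₀, add_sub_cancel]
    have him : (s₀ - c * Complex.I).im ∈ Ioo (-Real.pi) Real.pi := by
      rw [hs₀, add_sub_cancel_right, Complex.log_im]
      rw [Complex.mem_slitPlane_iff_arg] at hc₀
      exact ⟨Complex.neg_pi_lt_arg _, lt_of_le_of_ne (Complex.arg_le_pi _) hc₀.1⟩
    have h2 : ∀ᶠ s : ℂ in 𝓝 s₀, (s - c * Complex.I).im ∈ Ioo (-Real.pi) Real.pi :=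
      (by fun_prop : ContinuousAt (fun s : ℂ => (s - c * Complex.I).im) s₀).preimage_mem_nhds
        (isOpen_Ioo.mem_nhds him)
    filter_upwards [h1, h2] with s h1 h2
    rw [← h1]
    refine Finset.sum_congr rfl fun k _ => ?_
    simp only [hΦ]
    congr 1
    rw [powNear, add_sub_cancel_left, ← Complex.exp_add, ← sub_eq_add_neg,
      Complex.log_exp h2.1 h2.2.le, sub_add_cancel]
  have hsum : EqOn (fun s => ∑ k, Φ k s) 0 H :=
    AnalyticOnNhd.eqOn_zero_of_preconnected_of_eventuallyEq_zero
      (fun s hs => Finset.univ.analyticAt_fun_sum fun k _ => hΦa k s hs) hHc hs₀H hsum0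
  classical
  -- the monodromy operator, acting on functions extended by zero off the half-plane
  let S : Module.End ℂ (ℂ → E) :=
    { toFun := fun f s => f (s + 2 * Real.pi * Complex.I)
      map_add' := fun _ _ => rfl
      map_smul' := fun _ _ => rfl }
  let φ : κ → ℂ → E := fun k s => if s ∈ H then Φ k s else 0
  have hS : ∀ k, S (φ k) = Complex.exp (2 * Real.pi * Complex.I * μ k) • φ k := by
    intro k
    funext s
    have hiff : s + 2 * Real.pi * Complex.I ∈ H ↔ s ∈ H := by simp [hH]
    change φ k (s + 2 * Real.pi * Complex.I) =
      Complex.exp (2 * Real.pi * Complex.I * μ k) • φ k s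
    by_cases hs : s ∈ H
    · simp only [φ, hiff, hs, if_true, hΦ, Complex.exp_periodic s, smul_smul]
      rw [← Complex.exp_add]; ring_nf
    · simp only [φ, hiff, hs, if_false, smul_zero]
  have hφ0 : ∀ k, φ k = 0 := by
    by_contra! hex
    obtain ⟨k₁, hk₁⟩ := hex
    have hli := Module.End.eigenvectors_linearIndependent' S
      (fun k : {k // φ k ≠ 0} => Complex.exp (2 * Real.pi * Complex.I * μ k))
      (fun k h hkh => by
        by_contra hne
        obtain ⟨n, hn⟩ := Complex.exp_eq_exp_iff_exists_int.1 hkh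
        refine hμ k h (fun e => hne (Subtype.ext e)) n ?_
        have h2 : (2 * Real.pi * Complex.I : ℂ) ≠ 0 := Complex.two_pi_I_ne_zero
        apply mul_left_cancel₀ h2
        linear_combination hn)
      (fun k => φ k) (fun k => ⟨Module.End.mem_eigenspace_iff.2 (hS k), k.2⟩)
    have h1 := Fintype.linearIndependent_iff.1 hli (fun _ => 1) (by
      simp only [one_smul]
      rw [← Finset.sum_subtype (Finset.univ.filter fun k => φ k ≠ 0) (by simp) φ,
        Finset.sum_filter_ne_zero]
      funext s
      rw [Finset.sum_apply]
      by_cases hs : s ∈ H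
      · simpa only [φ, hs, if_true] using hsum hs
      · simp only [φ, hs, if_false, Finset.sum_const_zero, Pi.zero_apply]) ⟨k₁, hk₁⟩
    exact one_ne_zero h1
  have hgz : ∃ᶠ x in 𝓝[≠] b, g k x = 0 := by
    apply Eventually.frequently
    filter_upwards [mem_nhdsWithin_of_mem_nhds (Metric.ball_mem_nhds b hr),
      self_mem_nhdsWithin] with x hx hxb
    have hxb' : x - b ≠ 0 := sub_ne_zero.2 hxb
    have hmem : Complex.log (x - b) ∈ H := by
      change (Complex.log (x - b)).re < Real.log r
      rw [Complex.log_re]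
      exact Real.log_lt_log (norm_pos_iff.2 hxb') (mem_ball_iff_norm.1 hx)
    have := congrFun (hφ0 k) (Complex.log (x - b))
    simp only [φ, hmem, if_true, hΦ, Complex.exp_log hxb', add_sub_cancel, Pi.zero_apply,
      smul_eq_zero, Complex.exp_ne_zero, false_or] at this
    exact this
  exact (hg k).frequently_zero_iff_eventually_zero.1 hgz

/-- The case in which one of the summands is holomorphic. -/
theorem powNear_independent' {D : Set ℂ} (hDo : IsOpen D) {b : ℂ} (hb : b ∈ closure D)
    {c : ℝ} (hcut : OffCut D b c) {μ : κ → ℂ} (hμ : ∀ k h, k ≠ h → NotInt (μ k - μ h))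
    (hμ0 : ∀ k, NotInt (μ k)) {g : κ → ℂ → E} (hg : ∀ k, AnalyticAt ℂ (g k) b)
    {f : ℂ → E} (hf : AnalyticAt ℂ f b)
    (h : ∀ᶠ x in 𝓝[D] b, ∑ k, powNear c (x - b) (μ k) • g k x + f x = 0) :
    (∀ k, ∀ᶠ x in 𝓝 b, g k x = 0) ∧ ∀ᶠ x in 𝓝 b, f x = 0 := by
  have hneg : ∀ z : ℂ, NotInt z → NotInt (-z) := fun z hz N hN =>
    hz (-N) (by push_cast; rw [← hN, neg_neg])
  have key := powNear_independent (κ := Option κ) hDo hb hcut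
    (μ := fun o => o.elim 0 μ) (g := fun o => o.elim f g) ?_ ?_ ?_
  · exact ⟨fun k => key (some k), key none⟩
  · rintro (_ | k) (_ | h) hkh
    · exact absurd rfl hkh
    · simpa using hneg _ (hμ0 h)
    · simpa using hμ0 k
    · exact hμ k h fun e => hkh (congrArg some e)
  · rintro (_ | k)
    · exact hf
    · exact hg k
  · filter_upwards [h] with x hx
    rw [Fintype.sum_option, ← hx, add_comm]
    simp

end PowerIndependence

/-! ### Solution spaces and continuation of solutions -/

section Continuation

open Set Filter

variable {ι : Type} [Fintype ι] {D : Set ℂ} {M : ℂ → (ι → ℂ) →L[ℂ] (ι → ℂ)}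

theorem hasDerivAt_sum_smul_of_linear_ode {κ : Type} [Fintype κ] {E : Type*}
    [NormedAddCommGroup E] [NormedSpace ℂ E] {L : ℂ → E →L[ℂ] E} {Y : κ → ℂ → E}
    {x : ℂ} (hY : ∀ i, HasDerivAt (Y i) (L x (Y i x)) x) (c : κ → ℂ) :
    HasDerivAt (fun x => ∑ i, c i • Y i x) (L x (∑ i, c i • Y i x)) x := by
  rw [map_sum]
  simp only [map_smul]
  exact HasDerivAt.fun_sum fun i _ => (hY i).const_smul (c i)

theorem linear_ode_span (hDo : IsOpen D) (hD : IsPreconnected D) (hM : ContinuousOn M D)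
    {Y : ι → ℂ → ι → ℂ} (hY : ∀ i, ∀ x ∈ D, HasDerivAt (Y i) (M x (Y i x)) x) {z : ℂ}
    (hz : z ∈ D) (hli : LinearIndependent ℂ fun i => Y i z) {u : ℂ → ι → ℂ}
    (hu : ∀ x ∈ D, HasDerivAt u (M x (u x)) x) :
    ∃ c : ι → ℂ, EqOn u (fun x => ∑ i, c i • Y i x) D := by
  have htop := hli.span_eq_top_of_card_eq_finrank' (by simp)
  obtain ⟨c, hc⟩ := (Submodule.mem_span_range_iff_exists_fun ℂ).1
    (htop ▸ Submodule.mem_top : u z ∈ Submodule.span ℂ (range fun i => Y i z))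
  exact ⟨c, linear_ode_eqOn hDo hD hM hu
    (fun x hx => hasDerivAt_sum_smul_of_linear_ode (fun i => hY i x hx) c) hz hc.symm⟩

theorem linearIndependent_of_linear_ode (hDo : IsOpen D) (hD : IsPreconnected D)
    (hM : ContinuousOn M D) {Y : ι → ℂ → ι → ℂ}
    (hY : ∀ i, ∀ x ∈ D, HasDerivAt (Y i) (M x (Y i x)) x) {z : ℂ} (hz : z ∈ D)
    (h : ∀ c : ι → ℂ, EqOn (fun x => ∑ i, c i • Y i x) 0 D → c = 0) :
    LinearIndependent ℂ fun i => Y i z := by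
  rw [Fintype.linearIndependent_iff]
  intro c hc i
  exact congrFun (h c (linear_ode_eqOn_zero hDo hD hM
    (fun x hx => hasDerivAt_sum_smul_of_linear_ode (fun i => hY i x hx) c) hz hc)) i

/-- On a star-shaped domain a linear equation has a solution with a prescribed value at any
given point, not only at the centre: the resolvent from the centre to that point is invertible. -/
theorem exists_linear_ode_solution_at [DecidableEq ι] {c : ℂ} (hDo : IsOpen D)
    (hD : StarConvex ℝ c D) (hc : c ∈ D) (hM : DifferentiableOn ℂ M D) {z : ℂ} (hz : z ∈ D)
    (v : ι → ℂ) : ∃ y : ℂ → ι → ℂ, y z = v ∧ ∀ x ∈ D, HasDerivAt y (M x (y x)) x := by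
  have hDc : IsPreconnected D := (hD.isPathConnected hc).isConnected.isPreconnected
  choose Y hY0 hY using fun i : ι =>
    exists_linear_ode_solution hDo hD hM (Pi.single i (1 : ℂ) : ι → ℂ)
  have hli := linearIndependent_of_linear_ode hDo hDc hM.continuousOn hY hz fun a ha => by
    have := ha hc
    simp only [hY0] at this
    funext i
    have h2 := congrFun this i
    simpa [Finset.sum_apply, Pi.single_apply] using h2
  have htop := hli.span_eq_top_of_card_eq_finrank' (by simp)
  obtain ⟨a, ha⟩ := (Submodule.mem_span_range_iff_exists_fun ℂ).1
    (htop ▸ Submodule.mem_top : v ∈ Submodule.span ℂ (range fun i => Y i z))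
  exact ⟨_, ha, fun x hx => hasDerivAt_sum_smul_of_linear_ode (fun i => hY i x hx) a⟩

theorem starConvex_slit {a b : ℂ} (ha : a ≠ 0) :
    StarConvex ℝ (b + a) {z : ℂ | (z - b) * a⁻¹ ∈ Complex.slitPlane} := by
  intro z hz α β hα hβ hαβ
  have h := Complex.starConvex_one_slitPlane hz hα hβ hαβ
  have hαβ' : (α : ℂ) + β = 1 := by rw [← Complex.ofReal_add, hαβ, Complex.ofReal_one]
  have e : (α • (b + a) + β • z - b) * a⁻¹ = α • (1 : ℂ) + β • ((z - b) * a⁻¹) := by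
    simp only [Complex.real_smul]
    field_simp
    linear_combination b * hαβ'
  change (α • (b + a) + β • z - b) * a⁻¹ ∈ Complex.slitPlane
  rwa [e]

theorem isOpen_slit (a b : ℂ) : IsOpen {z : ℂ | (z - b) * a⁻¹ ∈ Complex.slitPlane} :=
  Complex.isOpen_slitPlane.preimage (by fun_prop)

variable {E : Type*} [NormedAddCommGroup E] [NormedSpace ℂ E] [CompleteSpace E]

/-- A solution holomorphic at a singular point of the coefficient extends holomorphically to any
convex domain in which that point is the only singularity. It is continued to the domain slit
along the positive and along the negative axis, and the two continuations agree. -/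
theorem exists_extension_of_local_solution {S : Set ℂ} (hSo : IsOpen S) (hS : Convex ℝ S)
    {L : ℂ → E →L[ℂ] E} (hL : DifferentiableOn ℂ L (S \ {0})) {y : ℂ → E} {r : ℝ} (hr : 0 < r)
    (hrS : Metric.ball 0 r ⊆ S) (hy : DifferentiableOn ℂ y (Metric.ball 0 r))
    (hode : ∀ x ∈ Metric.ball (0 : ℂ) r, x ≠ 0 → HasDerivAt y (L x (y x)) x) :
    ∃ Y : ℂ → E, DifferentiableOn ℂ Y S ∧ (∀ x ∈ Metric.ball (0 : ℂ) r, Y x = y x) ∧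
      ∀ x ∈ S, x ≠ 0 → HasDerivAt Y (L x (Y x)) x := by
  set Q : ℂ → Set ℂ := fun a => {z : ℂ | (z - 0) * a⁻¹ ∈ Complex.slitPlane} with hQ
  have hQ0 : ∀ a, ∀ z ∈ Q a, z ≠ 0 := by
    intro a z hz h0
    exact ne_of_mem_slitPlane hz (by rw [h0, sub_zero])
  have hext : ∀ a : ℂ, a ≠ 0 → a ∈ Metric.ball (0 : ℂ) r → ∃ Y : ℂ → E,
      (∀ x ∈ S ∩ Q a, HasDerivAt Y (L x (Y x)) x) ∧
      EqOn Y y (Metric.ball 0 r ∩ Q a) := by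
    intro a ha har
    have hstar : StarConvex ℝ a (Q a) := by simpa only [zero_add] using! starConvex_slit (b := 0) ha
    have haQ : a ∈ Q a := by simp [hQ, ha]
    have hsub : S ∩ Q a ⊆ S \ {0} := fun x hx => ⟨hx.1, hQ0 a x hx.2⟩
    have hop := hSo.inter (isOpen_slit a 0)
    obtain ⟨Y, hY0, hY⟩ := exists_linear_ode_solution hop
      ((hS.starConvex (hrS har)).inter hstar) (hL.mono hsub) (y a)
    refine ⟨Y, hY, ?_⟩
    have hsub' : Metric.ball (0 : ℂ) r ∩ Q a ⊆ S ∩ Q a := inter_subset_inter_left _ hrS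
    refine linear_ode_eqOn (Metric.isOpen_ball.inter (isOpen_slit a 0)) ?_
      ((hL.continuousOn.mono hsub).mono hsub') (fun x hx => hY x (hsub' hx))
      (fun x hx => hode x hx.1 (hQ0 a x hx.2)) ⟨har, haQ⟩ hY0
    exact ((((convex_ball (0 : ℂ) r).starConvex har).inter hstar).isPathConnected
      ⟨har, haQ⟩).isConnected.isPreconnected
  have hr2 : ‖((r / 2 : ℝ) : ℂ)‖ < r := by
    rw [Complex.norm_real, Real.norm_of_nonneg (by positivity)]; linarith
  have hr2' : ((r / 2 : ℝ) : ℂ) ≠ 0 := by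
    rw [Complex.ofReal_ne_zero]; positivity
  obtain ⟨Y₁, hY₁, hY₁y⟩ := hext (r / 2 : ℝ) hr2' (by rwa [mem_ball_zero_iff])
  obtain ⟨Y₂, hY₂, hY₂y⟩ := hext (-(r / 2 : ℝ)) (neg_ne_zero.2 hr2')
    (by rwa [mem_ball_zero_iff, norm_neg])
  have hQ1 : ∀ z, z ∈ Q (r / 2 : ℝ) ↔ 0 < z.re ∨ z.im ≠ 0 := by
    intro z
    simp only [hQ, mem_ofPred_eq, sub_zero, ← Complex.ofReal_inv, Complex.mem_slitPlane_iff,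
      Complex.re_mul_ofReal, Complex.im_mul_ofReal]
    have : 0 < (r / 2)⁻¹ := by positivity
    rw [mul_pos_iff_of_pos_right this, mul_ne_zero_iff_right this.ne']
  have hQ2 : ∀ z, z ∈ Q (-(r / 2 : ℝ)) ↔ z.re < 0 ∨ z.im ≠ 0 := by
    intro z
    simp only [hQ, mem_ofPred_eq, sub_zero, ← Complex.ofReal_neg, ← Complex.ofReal_inv,
      Complex.mem_slitPlane_iff, Complex.re_mul_ofReal, Complex.im_mul_ofReal]
    have : (-(r / 2))⁻¹ < 0 := by rw [inv_lt_zero]; linarith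
    rw [mul_pos_iff, mul_ne_zero_iff_right this.ne]
    simp only [this, this.le.not_gt, and_false, and_true, false_or]
  have hhalf : ∀ U : Set ℂ, IsOpen U → Convex ℝ U → (∀ z ∈ U, z.im ≠ 0) →
      (∃ z ∈ U, z ∈ Metric.ball (0 : ℂ) r) → EqOn Y₁ Y₂ (S ∩ U) := by
    rintro U hUo hU him ⟨z, hzU, hzr⟩
    have h1 : S ∩ U ⊆ S ∩ Q (r / 2 : ℝ) := fun x hx => ⟨hx.1, (hQ1 x).2 (.inr (him x hx.2))⟩
    have h2 : S ∩ U ⊆ S ∩ Q (-(r / 2 : ℝ)) := fun x hx =>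
      ⟨hx.1, (hQ2 x).2 (.inr (him x hx.2))⟩
    have hzS : z ∈ S ∩ U := ⟨hrS hzr, hzU⟩
    refine linear_ode_eqOn (hSo.inter hUo) (hS.inter hU).isPreconnected
      (hL.continuousOn.mono fun x hx => ⟨hx.1, hQ0 _ x (h1 hx).2⟩)
      (fun x hx => hY₁ x (h1 hx)) (fun x hx => hY₂ x (h2 hx)) hzS ?_
    rw [hY₁y ⟨hzr, (h1 hzS).2⟩, hY₂y ⟨hzr, (h2 hzS).2⟩]
  have h12 : ∀ z ∈ S, z.im ≠ 0 → Y₁ z = Y₂ z := by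
    intro z hz him
    rcases lt_or_gt_of_ne him with h | h
    · refine hhalf {z | z.im < 0} (isOpen_lt Complex.continuous_im continuous_const)
        (convex_halfSpace_im_lt 0) (fun z hz => hz.ne)
        ⟨-((r / 2 : ℝ) * Complex.I), ?_, ?_⟩ ⟨hz, h⟩
      · simp [hr]
      · rw [mem_ball_zero_iff, norm_neg, norm_mul, Complex.norm_I, mul_one]; exact hr2
    · refine hhalf {z | 0 < z.im} (isOpen_lt continuous_const Complex.continuous_im)
        (convex_halfSpace_im_gt 0) (fun z hz => hz.ne')
        ⟨(r / 2 : ℝ) * Complex.I, ?_, ?_⟩ ⟨hz, h⟩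
      · simp [hr]
      · rw [mem_ball_zero_iff, norm_mul, Complex.norm_I, mul_one]; exact hr2
  classical
  set Y : ℂ → E := fun x => if x ∈ Metric.ball (0 : ℂ) r then y x else
    if x ∈ Q (r / 2 : ℝ) then Y₁ x else Y₂ x with hYdef
  have hYb : ∀ x ∈ Metric.ball (0 : ℂ) r, Y x = y x := fun x hx => if_pos hx
  have hYa : ∀ x ∈ S ∩ Q (r / 2 : ℝ), Y x = Y₁ x := by
    intro x hx
    by_cases hb : x ∈ Metric.ball (0 : ℂ) r
    · rw [hYb x hb, hY₁y ⟨hb, hx.2⟩]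
    · simp only [hYdef, hb, hx.2, if_true, if_false]
  have hYc : ∀ x ∈ S ∩ Q (-(r / 2 : ℝ)), Y x = Y₂ x := by
    intro x hx
    by_cases hb : x ∈ Metric.ball (0 : ℂ) r
    · rw [hYb x hb, hY₂y ⟨hb, hx.2⟩]
    · by_cases hq : x ∈ Q (r / 2 : ℝ)
      · rw [hYa x ⟨hx.1, hq⟩]
        refine h12 x hx.1 fun him => ?_
        have h1 := (hQ1 x).1 hq
        have h2 := (hQ2 x).1 hx.2
        simp only [him, ne_eq, not_true, or_false] at h1 h2
        linarith
      · simp only [hYdef, hb, hq, if_false]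
  have hder : ∀ x ∈ S, x ≠ 0 → HasDerivAt Y (L x (Y x)) x := by
    intro x hx h0
    by_cases hq : x ∈ Q (r / 2 : ℝ)
    · have hm : x ∈ S ∩ Q (r / 2 : ℝ) := ⟨hx, hq⟩
      rw [hYa x hm]
      exact (hY₁ x hm).congr_of_eventuallyEq
        (eventually_of_mem ((hSo.inter (isOpen_slit _ 0)).mem_nhds hm) hYa)
    · have hm : x ∈ S ∩ Q (-(r / 2 : ℝ)) := by
        refine ⟨hx, (hQ2 x).2 ?_⟩
        rw [hQ1] at hq
        push Not at hq
        left
        refine lt_of_le_of_ne hq.1 fun h => h0 (Complex.ext h hq.2)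
      rw [hYc x hm]
      exact (hY₂ x hm).congr_of_eventuallyEq
        (eventually_of_mem ((hSo.inter (isOpen_slit _ 0)).mem_nhds hm) hYc)
  refine ⟨Y, fun x hx => ?_, hYb, hder⟩
  by_cases h0 : x = 0
  · have hxb : x ∈ Metric.ball (0 : ℂ) r := by rw [h0]; exact Metric.mem_ball_self hr
    have := hy.differentiableAt (Metric.isOpen_ball.mem_nhds hxb)
    exact (this.congr_of_eventuallyEq
      (eventually_of_mem (Metric.isOpen_ball.mem_nhds hxb) hYb)).differentiableWithinAt
  · exact (hder x hx h0).differentiableAt.differentiableWithinAt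

end Continuation

/-! ### The convolution kernel -/

section Kernel

open Set Filter

/-- The strip `|Im X| < 2π`, in which `X = 0` is the only zero of `e ^ X - 1`. -/
def wideStrip : Set ℂ := {X | |X.im| < 2 * Real.pi}

theorem isOpen_wideStrip : IsOpen wideStrip :=
  isOpen_lt (Complex.continuous_im.abs) continuous_const

theorem convex_wideStrip : Convex ℝ wideStrip := by
  have : wideStrip = {X : ℂ | -(2 * Real.pi) < X.im} ∩ {X : ℂ | X.im < 2 * Real.pi} := by
    ext X; simp [wideStrip, abs_lt]
  rw [this]
  exact (convex_halfSpace_im_gt _).inter (convex_halfSpace_im_lt _)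

theorem zero_mem_wideStrip : (0 : ℂ) ∈ wideStrip := by
  simp [wideStrip, Real.pi_pos]

theorem exp_ne_one_of_mem_wideStrip {X : ℂ} (hX : X ∈ wideStrip) (h0 : X ≠ 0) :
    Complex.exp X ≠ 1 := by
  intro h
  obtain ⟨n, hn⟩ := Complex.exp_eq_one_iff.1 h
  have him : X.im = n * (2 * Real.pi) := by rw [hn]; simp
  have hX' : |(n : ℝ) * (2 * Real.pi)| < 2 * Real.pi := him ▸ hX
  rw [abs_mul, abs_of_pos Real.two_pi_pos] at hX'
  have h1 : |(n : ℝ)| < 1 := by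
    by_contra hge
    have := mul_le_mul_of_nonneg_right (not_lt.1 hge) Real.two_pi_pos.le
    linarith
  have h2 : n = 0 := by
    rw [← Int.cast_abs] at h1
    exact Int.abs_lt_one_iff.1 (by exact_mod_cast h1)
  exact h0 (by rw [hn, h2]; simp)

/-- The kernel `κ` intertwining the two systems, with `σ = ρ₁ + ρ₂` and `p = ρ₁ ρ₂`. In the
variable `e ^ X` it is a solution, holomorphic at `1`, of a Gauss hypergeometric equation, which is
an Okubo system of rank two with the singular points `0` and `1`. -/
theorem exists_kernel (σ p k₀ : ℂ) : ∃ κ : ℂ → ℂ, DifferentiableOn ℂ κ wideStrip ∧ κ 0 = k₀ ∧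
    ∀ X ∈ wideStrip, (1 - Complex.exp (-X)) * deriv (deriv κ) X - σ * deriv κ X +
      (2 + σ) * (Complex.exp (-X) * deriv κ X) + p * κ X = 0 := by
  set T : Fin 2 → ℂ := ![0, 1] with hT
  set A : Matrix (Fin 2) (Fin 2) ℂ := !![2 + σ, 1; -2 * (2 + σ) - p, -2] with hA
  have hblock : DiagonalBlock T A 1 (fun _ => -2) := by
    intro i j hi hj
    fin_cases i <;> fin_cases j <;> simp_all
  obtain ⟨g, r, hr, hg1, hg, hgeq⟩ := exists_okuboFactor (s := 0) hblock
    (fun m hm h => by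
      rw [zero_add, Nat.cast_eq_zero] at h; omega)
    (fun i _ m hm h => by
      have h2 : (m : ℂ) + 2 = 0 := by linear_combination h
      norm_cast at h2)
    (e := ![k₀, (-2 * (2 + σ) - p) * k₀ / 2]) (fun i _ => zero_mul _)
    (fun i hi => by
      fin_cases i
      · simp [hT] at hi
      · simp [hA, Matrix.mulVec, dotProduct, Fin.sum_univ_two]
        ring)
  have hcont : ContinuousAt Complex.exp 0 := by fun_prop
  obtain ⟨r', hr', hr'S, hr'g⟩ : ∃ r' > 0, Metric.ball (0 : ℂ) r' ⊆ wideStrip ∧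
      ∀ X ∈ Metric.ball (0 : ℂ) r', Complex.exp X ∈ Metric.ball (1 : ℂ) r := by
    have h1 := isOpen_wideStrip.mem_nhds zero_mem_wideStrip
    have h2 : Complex.exp ⁻¹' Metric.ball (1 : ℂ) r ∈ 𝓝 0 :=
      hcont.preimage_mem_nhds (by rw [Complex.exp_zero]; exact Metric.ball_mem_nhds _ hr)
    obtain ⟨r', h0, h3⟩ := Metric.mem_nhds_iff.1 (inter_mem h1 h2)
    exact ⟨r', h0, fun X hX => (h3 hX).1, fun X hX => (h3 hX).2⟩
  have hgd : ∀ x ∈ Metric.ball (1 : ℂ) r, HasDerivAt g (deriv g x) x := fun x hx =>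
    (hg.differentiableAt (Metric.isOpen_ball.mem_nhds hx)).hasDerivAt
  have hTne : ∀ X ∈ wideStrip, X ≠ 0 → ∀ i, Complex.exp X - T i ≠ 0 := by
    intro X hX h0 i
    fin_cases i
    · simp [hT, Complex.exp_ne_zero]
    · simpa [hT, sub_eq_zero] using exp_ne_one_of_mem_wideStrip hX h0
  have hLd : DifferentiableOn ℂ (fun X => Complex.exp X • okuboField T A (Complex.exp X))
      (wideStrip \ {0}) := by
    intro X hX
    have h := hTne X hX.1 hX.2
    have hd : DifferentiableOn ℂ (okuboField T A) {x | ∀ i, x - T i ≠ 0} :=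
      differentiableOn_okuboField fun i hi => hi i (sub_self _)
    have hop : IsOpen {x : ℂ | ∀ i, x - T i ≠ 0} := by
      simp only [ofPred_forall]
      exact isOpen_iInter_of_finite fun i => isOpen_ne_fun (by fun_prop) (by fun_prop)
    have hd' := hd.differentiableAt (hop.mem_nhds h)
    have hd2 : DifferentiableAt ℂ (fun X => okuboField T A (Complex.exp X)) X :=
      hd'.comp (f := Complex.exp) X (by fun_prop)
    exact (Complex.differentiableAt_exp.smul hd2).differentiableWithinAt
  have hyode : ∀ X ∈ Metric.ball (0 : ℂ) r', X ≠ 0 → HasDerivAt (fun X => g (Complex.exp X))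
      ((Complex.exp X • okuboField T A (Complex.exp X)) (g (Complex.exp X))) X := by
    intro X hX h0
    have h1 := (hgd _ (hr'g X hX)).scomp X (Complex.hasDerivAt_exp X)
    refine h1.congr_deriv ?_
    rw [smul_apply]
    congr 1
    funext i
    have h2 := hgeq _ (hr'g X hX) i
    have h3 := exp_ne_one_of_mem_wideStrip (hr'S hX) h0
    rw [okuboField_apply, eq_inv_mul_iff_mul_eq₀ (hTne X (hr'S hX) h0 i)]
    apply mul_left_cancel₀ (sub_ne_zero.2 h3)
    linear_combination h2
  obtain ⟨Y, hYd, hYb, hYode⟩ := exists_extension_of_local_solution isOpen_wideStrip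
    convex_wideStrip hLd hr' hr'S
    (hg.comp Complex.differentiable_exp.differentiableOn hr'g) hyode
  have hYi : ∀ i, DifferentiableOn ℂ (fun X => Y X i) wideStrip := differentiableOn_pi.1 hYd
  have hder : ∀ X ∈ wideStrip, X ≠ 0 → ∀ i, HasDerivAt (fun X => Y X i)
      (Complex.exp X * ((Complex.exp X - T i)⁻¹ * (A *ᵥ Y X) i)) X := by
    intro X hX h0 i
    have := hasDerivAt_pi.1 (hYode X hX h0) i
    simpa [okuboField_apply] using this
  have hd0 : ∀ X ∈ wideStrip, X ≠ 0 →
      deriv (fun X => Y X 0) X = (2 + σ) * Y X 0 + Y X 1 := by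
    intro X hX h0
    rw [(hder X hX h0 0).deriv]
    have := Complex.exp_ne_zero X
    simp [hT, hA, Matrix.mulVec, dotProduct, Fin.sum_univ_two]
  have hκ' := (hYi 0).deriv isOpen_wideStrip
  have hκ'' := hκ'.deriv isOpen_wideStrip
  refine ⟨fun X => Y X 0, hYi 0, ?_, ?_⟩
  · change Y 0 0 = k₀
    rw [hYb 0 (Metric.mem_ball_self hr'), Function.comp_apply, Complex.exp_zero, hg1]
    simp
  have hne : ∀ X ∈ wideStrip, X ≠ 0 →
      (1 - Complex.exp (-X)) * deriv (deriv fun X => Y X 0) X - σ * deriv (fun X => Y X 0) X +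
      (2 + σ) * (Complex.exp (-X) * deriv (fun X => Y X 0) X) + p * Y X 0 = 0 := by
    intro X hX h0
    have hev : deriv (fun X => Y X 0) =ᶠ[𝓝 X] fun X => (2 + σ) * Y X 0 + Y X 1 := by
      filter_upwards [isOpen_wideStrip.mem_nhds hX, isOpen_ne.mem_nhds h0] with x hx hx0
        using hd0 x hx hx0
    have h2 := ((((hYi 0).differentiableAt (isOpen_wideStrip.mem_nhds hX)).hasDerivAt.const_mul
      (2 + σ)).add (hder X hX h0 1)).congr_of_eventuallyEq hev
    rw [h2.deriv, hd0 X hX h0]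
    have h3 := sub_ne_zero.2 (exp_ne_one_of_mem_wideStrip hX h0)
    have h4 := Complex.exp_ne_zero X
    rw [Complex.exp_neg]
    simp [hT, hA, Matrix.mulVec, dotProduct, Fin.sum_univ_two]
    field_simp
    ring
  intro X hX
  by_cases h0 : X = 0
  · subst h0
    have c0 := ((hYi 0).differentiableAt (isOpen_wideStrip.mem_nhds hX)).continuousAt
    have c1 := (hκ'.differentiableAt (isOpen_wideStrip.mem_nhds hX)).continuousAt
    have c2 := (hκ''.differentiableAt (isOpen_wideStrip.mem_nhds hX)).continuousAt
    have hc : ContinuousAt (fun X => (1 - Complex.exp (-X)) * deriv (deriv fun X => Y X 0) X -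
        σ * deriv (fun X => Y X 0) X +
        (2 + σ) * (Complex.exp (-X) * deriv (fun X => Y X 0) X) + p * Y X 0) 0 := by
      fun_prop
    refine tendsto_nhds_unique (hc.tendsto.mono_left (nhdsWithin_le_nhds (s := {0}ᶜ)))
      (tendsto_const_nhds.congr' ?_)
    filter_upwards [mem_nhdsWithin_of_mem_nhds (isOpen_wideStrip.mem_nhds hX),
      self_mem_nhdsWithin] with x hx hx0 using (hne x hx hx0).symm
  · exact hne X hX h0

end Kernel

/-! ### Regularised convolution with a power singularity -/

section Regularization

open Set Filter

variable {E : Type*} [NormedAddCommGroup E] [NormedSpace ℂ E]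

/-- A kernel integrated against a fixed path is holomorphic in the free variable. -/
theorem differentiableOn_kernel_integral {W S : Set ℂ} (hWo : IsOpen W) (hSo : IsOpen S)
    (hWS : ∀ X ∈ W, ∀ Y ∈ W, X - Y ∈ S) {k : ℂ → ℂ} (hk : DifferentiableOn ℂ k S) {η : ℝ → ℂ}
    (hη : ContinuousOn η (Icc 0 1)) (hηW : ∀ s ∈ Icc (0 : ℝ) 1, η s ∈ W) {v : ℝ → E}
    (hv : ContinuousOn v (Icc 0 1)) :
    DifferentiableOn ℂ (fun X => ∫ s in (0 : ℝ)..1, k (X - η s) • v s) W := by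
  have hη' : ContinuousOn (fun q : ℂ × ℝ => q.1 - η q.2) (W ×ˢ Icc (0 : ℝ) 1) :=
    continuousOn_fst.sub (hη.comp continuousOn_snd fun q hq => hq.2)
  have hv' : ContinuousOn (fun q : ℂ × ℝ => v q.2) (W ×ˢ Icc (0 : ℝ) 1) :=
    hv.comp continuousOn_snd fun q hq => hq.2
  have hm : MapsTo (fun q : ℂ × ℝ => q.1 - η q.2) (W ×ˢ Icc (0 : ℝ) 1) S :=
    fun q hq => hWS _ hq.1 _ (hηW _ hq.2)
  intro X hX
  refine (hasDerivAt_integral_of_continuousOn hWo (H := fun X s => k (X - η s) • v s)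
    (H' := fun X s => deriv k (X - η s) • v s) ((hk.continuousOn.comp hη' hm).smul hv')
    (((hk.deriv hSo).continuousOn.comp hη' hm).smul hv') (fun x hx s hs => ?_)
    hX).differentiableAt.differentiableWithinAt
  have h1 := (hk.differentiableAt (hSo.mem_nhds (hWS _ hx _ (hηW s hs)))).hasDerivAt
  have h2 := h1.comp x ((hasDerivAt_id x).sub_const (η s))
  simpa using! h2.smul_const (v s)

/-- The geometric setting for convolutions: `W₀` is a convex domain with base point `c`, `τ` is a
boundary point of `W₀` from which `W₀` lies on one side, and `W` is a larger domain containing `τ`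
whose differences lie in the domain `S` of the kernels. -/
structure ConvSetting (W₀ W S : Set ℂ) (c τ : ℂ) : Prop where
  isOpen_inner : IsOpen W₀
  convex_inner : Convex ℝ W₀
  isOpen_outer : IsOpen W
  isOpen_kernel : IsOpen S
  subset : W₀ ⊆ W
  sub_mem : ∀ X ∈ W, ∀ Y ∈ W, X - Y ∈ S
  base_mem : c ∈ W₀
  mem_outer : τ ∈ W
  mem_closure : τ ∈ closure W₀
  slit : ∀ X ∈ W₀, (X - τ) * Complex.exp (-((0 : ℝ) * Complex.I)) ∈ Complex.slitPlane

namespace ConvSetting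

variable {W₀ W S : Set ℂ} {c τ : ℂ}

theorem segDiffs (hW : ConvSetting W₀ W S c τ) : SegDiffs S W₀ c := by
  intro X hX s hs
  have h := hW.sub_mem X (hW.subset hX) _
    (hW.subset ((hW.convex_inner.starConvex hW.base_mem).seg_mem hX hs))
  convert h using 1
  ring

theorem starConvex (hW : ConvSetting W₀ W S c τ) : StarConvex ℝ c W₀ :=
  hW.convex_inner.starConvex hW.base_mem

theorem exists_mem_ball (hW : ConvSetting W₀ W S c τ) {r : ℝ} (hr : 0 < r) :
    ∃ Y, Y ∈ W₀ ∩ Metric.ball τ r := by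
  obtain ⟨Y, hY, hd⟩ := Metric.mem_closure_iff.1 hW.mem_closure r hr
  exact ⟨Y, hY, by rwa [Metric.mem_ball, dist_comm]⟩

theorem isPreconnected_inter_ball (hW : ConvSetting W₀ W S c τ) (r : ℝ) :
    IsPreconnected (W₀ ∩ Metric.ball τ r) :=
  (hW.convex_inner.inter (convex_ball τ r)).isPreconnected

theorem offCut (hW : ConvSetting W₀ W S c τ) : OffCut W₀ τ 0 := by
  filter_upwards [self_mem_nhdsWithin] with X hX using hW.slit X hX

/-- `(X - τ) ^ (lam + 1) P` is a primitive of `(X - τ) ^ lam k` if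
`(X - τ) P' + (lam + 1) P = k`. -/
theorem hasDerivAt_euler (hW : ConvSetting W₀ W S c τ) {lam : ℂ} {P : ℂ → E} {X : ℂ} (hX : X ∈ W₀)
    (hP : DifferentiableAt ℂ P X) {k : E} (hk : (X - τ) • deriv P X + (lam + 1) • P X = k) :
    HasDerivAt (fun X => powNear 0 (X - τ) (lam + 1) • P X) (powNear 0 (X - τ) lam • k) X := by
  refine (hasDerivAt_powNear_smul (lam + 1) (hW.slit X hX) hP.hasDerivAt).congr_deriv ?_
  have h0 := ne_of_mem_slitPlane (hW.slit X hX)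
  have h1 : powNear 0 (X - τ) (lam + 1) = powNear 0 (X - τ) lam * (X - τ) := by
    simp only [powNear, add_mul, one_mul, Complex.exp_add]
    simp [Complex.exp_log h0]
  rw [← hk, h1, smul_smul, mul_assoc, mul_inv_cancel₀ h0, mul_one, add_comm]

end ConvSetting

variable [CompleteSpace E]

theorem segment_mem_ball {b y : ℂ} {r s : ℝ} (hy : y ∈ Metric.ball b r) (hs : s ∈ Icc (0 : ℝ) 1) :
    b + s * (y - b) ∈ Metric.ball b r :=
  ((convex_ball b r).starConvex
    (Metric.mem_ball_self ((dist_nonneg).trans_lt hy))).seg_mem hy hs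

theorem continuousOn_seg_comp {F : Type*} [TopologicalSpace F] {b : ℂ} {r : ℝ} {g : ℂ → F}
    (hg : ContinuousOn g (Metric.ball b r)) :
    ContinuousOn (fun q : ℂ × ℝ => g (b + q.2 * (q.1 - b)))
      (Metric.ball b r ×ˢ Icc (0 : ℝ) 1) :=
  hg.comp (by fun_prop) fun _ hq => segment_mem_ball hq.1 hq.2

theorem continuous_ofReal_cpow {lam : ℂ} (h : 0 < lam.re) :
    Continuous fun s : ℝ => (s : ℂ) ^ lam :=
  Complex.continuous_ofReal_cpow_const h

/-- For `Re lam > 0`, the integral `P Y = ∫ s ^ lam • k (b + s (Y - b)) ds` over `[0, 1]` solves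
`(Y - b) P' + (lam + 1) P = k`, so that `(Y - b) ^ (lam + 1) P` is a primitive of
`(Y - b) ^ lam k`. -/
theorem hasDerivAt_cpow_integral {lam : ℂ} (hlam : 0 < lam.re) {b : ℂ} {r : ℝ} {k : ℂ → E}
    (hk : DifferentiableOn ℂ k (Metric.ball b r)) {Y : ℂ} (hY : Y ∈ Metric.ball b r) :
    DifferentiableAt ℂ (fun Y => ∫ s in (0 : ℝ)..1, (s : ℂ) ^ lam • k (b + s * (Y - b))) Y ∧
    (Y - b) • deriv (fun Y => ∫ s in (0 : ℝ)..1, (s : ℂ) ^ lam • k (b + s * (Y - b))) Y +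
      (lam + 1) • (∫ s in (0 : ℝ)..1, (s : ℂ) ^ lam • k (b + s * (Y - b))) = k Y := by
  have hkd : ∀ y ∈ Metric.ball b r, HasDerivAt k (deriv k y) y := fun y hy =>
    (hk.differentiableAt (Metric.isOpen_ball.mem_nhds hy)).hasDerivAt
  have hk' : ContinuousOn (deriv k) (Metric.ball b r) := (hk.deriv Metric.isOpen_ball).continuousOn
  have c0 := continuous_ofReal_cpow hlam
  have c1 := continuousOn_seg_comp hk.continuousOn
  have c2 := continuousOn_seg_comp hk'
  have c3 : ContinuousOn (fun q : ℂ × ℝ => (q.2 : ℂ) ^ lam) (Metric.ball b r ×ˢ Icc (0 : ℝ) 1) :=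
    (c0.comp continuous_snd).continuousOn
  have c4 : ContinuousOn (fun q : ℂ × ℝ => (q.2 : ℂ)) (Metric.ball b r ×ˢ Icc (0 : ℝ) 1) := by
    fun_prop
  have hsec : ∀ G : ℂ × ℝ → E, ContinuousOn G (Metric.ball b r ×ˢ Icc (0 : ℝ) 1) →
      IntervalIntegrable (fun s : ℝ => G (Y, s)) MeasureTheory.volume 0 1 := fun G hG => by
    apply ContinuousOn.intervalIntegrable
    rw [uIcc_of_le zero_le_one]
    exact hG.comp (f := fun s : ℝ => (Y, s)) (by fun_prop) fun s hs => ⟨hY, hs⟩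
  have hD := hasDerivAt_integral_of_continuousOn Metric.isOpen_ball
    (H := fun Y s => (s : ℂ) ^ lam • k (b + s * (Y - b)))
    (H' := fun Y s => (s : ℂ) ^ lam • (s : ℂ) • deriv k (b + s * (Y - b)))
    (c3.smul c1) (c3.smul (c4.smul c2)) (fun y hy s hs => by
      have e2 : HasDerivAt (fun w : ℂ => b + (s : ℂ) * (w - b)) s y := by
        simpa using (((hasDerivAt_id y).sub_const b).const_mul (s : ℂ)).const_add b
      exact ((hkd _ (segment_mem_ball hy hs)).scomp y e2).const_smul _) hY
  refine ⟨hD.differentiableAt, ?_⟩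
  rw [hD.deriv, ← intervalIntegral.integral_smul, ← intervalIntegral.integral_smul,
    ← intervalIntegral.integral_add]
  · have hne : lam + 1 ≠ 0 := by
      intro h
      have := congrArg Complex.re h
      simp at this
      linarith
    have hftc := intervalIntegral.integral_eq_sub_of_hasDerivAt_of_le (a := 0) (b := 1) zero_le_one
      (f := fun s : ℝ => (s : ℂ) ^ (lam + 1) • k (b + s * (Y - b)))
      (f' := fun s : ℝ => (Y - b) • (s : ℂ) ^ lam • (s : ℂ) • deriv k (b + s * (Y - b)) +
        (lam + 1) • (s : ℂ) ^ lam • k (b + s * (Y - b))) ?_ ?_ ?_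
    · rw [hftc]
      simp [Complex.zero_cpow hne]
    · have h1 : 0 < (lam + 1).re := by simp; linarith
      exact (continuous_ofReal_cpow h1).continuousOn.smul
        (c1.comp (f := fun s : ℝ => (Y, s)) (by fun_prop) fun s hs => ⟨hY, hs⟩)
    · intro s hs
      have hs' : s ∈ Icc (0 : ℝ) 1 := Ioo_subset_Icc_self hs
      have hs0 : (s : ℂ) ≠ 0 := by exact_mod_cast hs.1.ne'
      have e1 : HasDerivAt (fun s : ℝ => (s : ℂ) ^ (lam + 1)) ((lam + 1) * (s : ℂ) ^ lam) s := by
        have h := ((hasDerivAt_id (s : ℂ)).cpow_const (c := lam + 1)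
          (Or.inl (by simpa using hs.1))).comp_ofReal
        simpa using! h
      have e2 : HasDerivAt (fun s : ℝ => b + (s : ℂ) * (Y - b)) (Y - b) s := by
        have := ((Complex.ofRealCLM.hasDerivAt (x := s)).mul_const (Y - b)).const_add b
        simpa using this
      refine (e1.smul ((hkd _ (segment_mem_ball hY hs')).scomp s e2)).congr_deriv ?_
      rw [Complex.cpow_add _ _ hs0, Complex.cpow_one]
      simp only [Function.comp_apply]
      module
    · exact ((hsec _ (c3.smul (c4.smul c2))).smul (Y - b)).add
        ((hsec _ (c3.smul c1)).smul (lam + 1))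
  · exact (hsec _ (c3.smul (c4.smul c2))).smul (Y - b)
  · exact (hsec _ (c3.smul c1)).smul (lam + 1)

/-- Local solvability of `(Y - b) P' + (lam + 1) P = g` for non-integral `lam`, by shifting
`lam` into the half-plane `Re lam > 0`. -/
theorem exists_euler_primitive {lam : ℂ} (hlam : NotInt lam) {b : ℂ} {g : ℂ → E}
    (hg : AnalyticAt ℂ g b) : ∃ P : ℂ → E, AnalyticAt ℂ P b ∧
      ∀ᶠ Y in 𝓝 b, (Y - b) • deriv P Y + (lam + 1) • P Y = g Y := by
  obtain ⟨N, hN⟩ := exists_nat_gt (-lam.re)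
  have hN' : 0 < lam.re + N := by linarith
  clear hN
  induction N generalizing lam g with
  | zero =>
    obtain ⟨r, hr, hgr⟩ := Metric.eventually_nhds_iff_ball.1 hg.eventually_analyticAt
    have hk : DifferentiableOn ℂ g (Metric.ball b r) := fun y hy =>
      (hgr y hy).differentiableAt.differentiableWithinAt
    have key := fun Y hY => hasDerivAt_cpow_integral (lam := lam)
      (by simpa using hN') hk (Y := Y) hY
    refine ⟨_, DifferentiableOn.analyticAt (fun Y hY => (key Y hY).1.differentiableWithinAt)
      (Metric.ball_mem_nhds b hr), ?_⟩
    filter_upwards [Metric.ball_mem_nhds b hr] with Y hY using (key Y hY).2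
  | succ N ih =>
    obtain ⟨P, hP, hPe⟩ := ih (lam := lam + 1) (g := deriv g)
      (fun n hn => hlam (n - 1) (by push_cast; rw [← hn]; ring)) hg.deriv
      (by simp only [Complex.add_re, Complex.one_re]; push_cast at hN'; linarith)
    have hne : lam + 1 ≠ 0 := fun h => hlam (-1) (by push_cast; linear_combination h)
    refine ⟨fun Y => (lam + 1)⁻¹ • (g Y - (Y - b) • P Y), ?_, ?_⟩
    · have h1 : AnalyticAt ℂ (fun Y : ℂ => Y - b) b := by fun_prop
      exact (hg.sub (h1.smul hP)).fun_const_smul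
    · filter_upwards [hPe, hg.eventually_analyticAt, hP.eventually_analyticAt] with Y h1 h2 h3
      have hd := (h2.differentiableAt.hasDerivAt.sub
        (((hasDerivAt_id Y).sub_const b).smul h3.differentiableAt.hasDerivAt)).const_smul
        (lam + 1)⁻¹
      have hd' : deriv (fun Y => (lam + 1)⁻¹ • (g Y - (Y - b) • P Y)) Y =
        (lam + 1)⁻¹ • (deriv g Y - ((Y - b) • deriv P Y + (1 : ℂ) • P Y)) := hd.deriv
      rw [hd', ← h1, smul_inv_smul₀ hne]
      match_scalars <;> field_simp
      all_goals ring

/-- Two primitives on a connected set differ by a constant. -/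
theorem eqOn_of_hasDerivAt_eq {U : Set ℂ} (hUo : IsOpen U) (hU : IsPreconnected U)
    {F G f : ℂ → E} (hF : ∀ x ∈ U, HasDerivAt F (f x) x) (hG : ∀ x ∈ U, HasDerivAt G (f x) x)
    {a : ℂ} (ha : a ∈ U) : ∀ x ∈ U, F x - F a = G x - G a := by
  have h := linear_ode_eqOn_zero (M := fun _ => (0 : E →L[ℂ] E))
    (y := fun x => F x - F a - (G x - G a)) hUo hU continuousOn_const
    (fun x hx => by simpa using ((hF x hx).sub_const (F a)).fun_sub ((hG x hx).sub_const (G a)))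
    ha (by simp)
  exact fun x hx => sub_eq_zero.1 (h hx)

namespace ConvSetting

variable {W₀ W S : Set ℂ} {c τ : ℂ}

/-- The regularised convolution for `Re lam > 0`, where the integral from `τ` converges. -/
theorem exists_regularization_of_re_pos (hW : ConvSetting W₀ W S c τ) {lam : ℂ}
    (hlam : 0 < lam.re) {k : ℂ → ℂ} (hk : DifferentiableOn ℂ k S) {f : ℂ → E}
    (hf : DifferentiableOn ℂ f W₀) {g : ℂ → E} (hg : AnalyticAt ℂ g τ)
    (hfg : ∀ᶠ X in 𝓝[W₀] τ, f X = powNear 0 (X - τ) lam • g X) :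
    ∃ R G : ℂ → E, DifferentiableOn ℂ R W ∧ AnalyticAt ℂ G τ ∧
      ∀ᶠ X in 𝓝[W₀] τ, segConv k f c X + R X = powNear 0 (X - τ) (lam + 1) • G X := by
  obtain ⟨r, hr, hrW, hrg, hrf⟩ : ∃ r > 0, Metric.ball τ r ⊆ W ∧
      (∀ X ∈ Metric.ball τ r, AnalyticAt ℂ g X) ∧
      ∀ X ∈ W₀ ∩ Metric.ball τ r, f X = powNear 0 (X - τ) lam • g X := by
    rw [eventually_nhdsWithin_iff] at hfg
    obtain ⟨r, hr, h⟩ := Metric.eventually_nhds_iff_ball.1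
      ((hW.isOpen_outer.eventually_mem hW.mem_outer).and (hg.eventually_analyticAt.and hfg))
    exact ⟨r, hr, fun X hX => (h X hX).1, fun X hX => (h X hX).2.1,
      fun X hX => (h X hX.2).2.2 hX.1⟩
  obtain ⟨Y₁, hY₁, hY₁r⟩ := hW.exists_mem_ball hr
  have hgd : DifferentiableOn ℂ g (Metric.ball τ r) := fun y hy =>
    (hrg y hy).differentiableAt.differentiableWithinAt
  set R₀ : ℂ → E := fun X => ∫ s in (0 : ℝ)..1,
    k (X - (c + s * (Y₁ - c))) • (Y₁ - c) • f (c + s * (Y₁ - c)) with hR₀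
  have hseg : ContinuousOn (fun s : ℝ => c + s * (Y₁ - c)) (Icc 0 1) := by fun_prop
  have hR₀d : DifferentiableOn ℂ R₀ W := differentiableOn_kernel_integral hW.isOpen_outer
    hW.isOpen_kernel hW.sub_mem hk hseg
    (fun s hs => hW.subset (hW.starConvex.seg_mem hY₁ hs))
    ((hf.continuousOn.comp hseg fun s hs => hW.starConvex.seg_mem hY₁ hs).const_smul _)
  set P : ℂ → ℂ → E := fun X Y => ∫ s in (0 : ℝ)..1,
    (s : ℂ) ^ lam • k (X - (τ + s * (Y - τ))) • g (τ + s * (Y - τ)) with hP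
  have hP₁ : DifferentiableOn ℂ (fun X => P X Y₁) W := by
    have hseg' : ContinuousOn (fun s : ℝ => τ + s * (Y₁ - τ)) (Icc 0 1) := by fun_prop
    have := differentiableOn_kernel_integral hW.isOpen_outer
      hW.isOpen_kernel hW.sub_mem hk hseg' (fun s hs => hrW (segment_mem_ball hY₁r hs))
      (v := fun s : ℝ => (s : ℂ) ^ lam • g (τ + s * (Y₁ - τ)))
      ((continuous_ofReal_cpow hlam).continuousOn.smul
        (hgd.continuousOn.comp hseg' fun s hs => segment_mem_ball hY₁r hs))
    refine this.congr fun X _ => ?_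
    simp only [hP]
    congr 1
    funext s
    rw [smul_comm]
  have hPX : DifferentiableOn ℂ (fun X => P X X) (Metric.ball τ r) := by
    have hkm : MapsTo (fun q : ℂ × ℝ => q.1 - (τ + q.2 * (q.1 - τ)))
        (Metric.ball τ r ×ˢ Icc (0 : ℝ) 1) S := fun q hq =>
      hW.sub_mem _ (hrW hq.1) _ (hrW (segment_mem_ball hq.1 hq.2))
    have hkc : ContinuousOn (fun q : ℂ × ℝ => q.1 - (τ + q.2 * (q.1 - τ)))
        (Metric.ball τ r ×ˢ Icc (0 : ℝ) 1) := by fun_prop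
    have c1 := continuousOn_seg_comp hgd.continuousOn
    have c2 := continuousOn_seg_comp (hgd.deriv Metric.isOpen_ball).continuousOn
    have c3 : ContinuousOn (fun q : ℂ × ℝ => (q.2 : ℂ) ^ lam)
        (Metric.ball τ r ×ˢ Icc (0 : ℝ) 1) :=
      ((continuous_ofReal_cpow hlam).comp continuous_snd).continuousOn
    have c4 : ContinuousOn (fun q : ℂ × ℝ => (q.2 : ℂ)) (Metric.ball τ r ×ˢ Icc (0 : ℝ) 1) := by
      fun_prop
    have c5 := hk.continuousOn.comp hkc hkm
    have c6 := (hk.deriv hW.isOpen_kernel).continuousOn.comp hkc hkm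
    intro X hX
    refine (hasDerivAt_integral_of_continuousOn Metric.isOpen_ball
      (H := fun X s => (s : ℂ) ^ lam • k (X - (τ + s * (X - τ))) • g (τ + s * (X - τ)))
      (H' := fun X s => (s : ℂ) ^ lam • (k (X - (τ + s * (X - τ))) • (s : ℂ) •
        deriv g (τ + s * (X - τ)) +
        ((1 - (s : ℂ)) * deriv k (X - (τ + s * (X - τ)))) • g (τ + s * (X - τ))))
      (c3.smul (c5.smul c1)) (c3.smul ((c5.smul (c4.smul c2)).add
        (((continuousOn_const.sub c4).mul c6).smul c1))) (fun x hx s hs => ?_)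
      hX).differentiableAt.differentiableWithinAt
    have e2 : HasDerivAt (fun w : ℂ => τ + (s : ℂ) * (w - τ)) s x := by
      simpa using (((hasDerivAt_id x).sub_const τ).const_mul (s : ℂ)).const_add τ
    have e3 : HasDerivAt (fun w : ℂ => w - (τ + (s : ℂ) * (w - τ))) (1 - s) x :=
      (hasDerivAt_id x).sub e2
    have d1 := (hk.differentiableAt (hW.isOpen_kernel.mem_nhds
      (hkm (x := (x, s)) ⟨hx, hs⟩))).hasDerivAt.comp x e3
    have d2 := ((hgd.differentiableAt (Metric.isOpen_ball.mem_nhds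
      (segment_mem_ball hx hs))).hasDerivAt).scomp x e2
    refine ((d1.smul d2).const_smul ((s : ℂ) ^ lam)).congr_deriv ?_
    simp only [Function.comp_apply, mul_comm]
  -- the integral from `c` to `X` is that from `c` to `Y₁`, minus that from `τ` to `Y₁`, plus that
  -- from `τ` to `X`; the first two are holomorphic in `X` near `τ`
  refine ⟨fun X => powNear 0 (Y₁ - τ) (lam + 1) • P X Y₁ - R₀ X, fun X => P X X,
    (hP₁.const_smul _).sub hR₀d, hPX.analyticAt (Metric.ball_mem_nhds τ hr), ?_⟩
  filter_upwards [self_mem_nhdsWithin,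
    mem_nhdsWithin_of_mem_nhds (Metric.ball_mem_nhds τ hr)] with X hX hXr
  have hkX : DifferentiableOn ℂ (fun Y => k (X - Y)) W := fun Y hY =>
    ((hk.differentiableAt (hW.isOpen_kernel.mem_nhds
      (hW.sub_mem X (hW.subset hX) Y hY))).comp (f := fun Y => X - Y) Y
        (by fun_prop)).differentiableWithinAt
  obtain ⟨Ψ, -, hΨ, hΨe⟩ := hW.starConvex.exists_primitive hW.isOpen_inner
    (f := fun Y => k (X - Y) • f Y) ((hkX.mono hW.subset).smul hf)
  have hΨX : Ψ X = segConv k f c X := by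
    rw [hΨe, segConv]
    congr 1
    funext s
    rw [show X - (c + s * (X - c)) = (1 - s) * (X - c) by ring, smul_smul]
  have hΨY : Ψ Y₁ = R₀ X := by
    rw [hΨe, hR₀]
    simp only [smul_comm (Y₁ - c)]
  have hder : ∀ Y ∈ W₀ ∩ Metric.ball τ r,
      HasDerivAt (fun Y => powNear 0 (Y - τ) (lam + 1) • P X Y) (k (X - Y) • f Y) Y := by
    intro Y hY
    have h1 := hasDerivAt_cpow_integral hlam (k := fun Y => k (X - Y) • g Y)
      ((hkX.mono hrW).smul hgd) hY.2
    refine (hW.hasDerivAt_euler hY.1 h1.1 h1.2).congr_deriv ?_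
    rw [hrf Y hY, smul_comm]
  have := eqOn_of_hasDerivAt_eq (hW.isOpen_inner.inter Metric.isOpen_ball)
    (hW.isPreconnected_inter_ball r) (fun Y hY => hΨ Y hY.1) hder ⟨hY₁, hY₁r⟩ X ⟨hX, hXr⟩
  rw [hΨX, hΨY] at this
  rw [← sub_add_cancel (segConv k f c X) (R₀ X), this]
  abel

/-- The regularised convolution: after adding a function holomorphic across `τ`, the convolution of
`(X - τ) ^ lam • g` is `(X - τ) ^ (lam + 1)` times a holomorphic function. Integration by parts
raises `lam` until the integral from `τ` converges. -/
theorem exists_regularization (hW : ConvSetting W₀ W S c τ) {lam : ℂ} (hlam : NotInt lam)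
    {k : ℂ → ℂ} (hk : DifferentiableOn ℂ k S) {f : ℂ → E} (hf : DifferentiableOn ℂ f W₀) {g : ℂ → E}
    (hg : AnalyticAt ℂ g τ) (hfg : ∀ᶠ X in 𝓝[W₀] τ, f X = powNear 0 (X - τ) lam • g X) :
    ∃ R G : ℂ → E, DifferentiableOn ℂ R W ∧ AnalyticAt ℂ G τ ∧
      ∀ᶠ X in 𝓝[W₀] τ, segConv k f c X + R X = powNear 0 (X - τ) (lam + 1) • G X := by
  obtain ⟨N, hN⟩ := exists_nat_gt (-lam.re)
  have hN' : 0 < lam.re + N := by linarith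
  clear hN
  induction N generalizing lam k f g with
  | zero => exact hW.exists_regularization_of_re_pos (by simpa using hN') hk hf hg hfg
  | succ N ih =>
    obtain ⟨P, hP, hPe⟩ := exists_euler_primitive hlam hg
    obtain ⟨r, hr, hr'⟩ : ∃ r > 0, ∀ X ∈ Metric.ball τ r, (X ∈ W₀ → f X =
        powNear 0 (X - τ) lam • g X) ∧ AnalyticAt ℂ P X ∧
        (X - τ) • deriv P X + (lam + 1) • P X = g X := by
      rw [eventually_nhdsWithin_iff] at hfg
      exact Metric.eventually_nhds_iff_ball.1 (hfg.and (hP.eventually_analyticAt.and hPe))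
    obtain ⟨Y₁, hY₁, hY₁r⟩ := hW.exists_mem_ball hr
    obtain ⟨F, -, hF, -⟩ := hW.starConvex.exists_primitive hW.isOpen_inner hf
    have hder : ∀ X ∈ W₀ ∩ Metric.ball τ r,
        HasDerivAt (fun X => powNear 0 (X - τ) (lam + 1) • P X) (f X) X := fun X hX =>
      (hW.hasDerivAt_euler hX.1 (hr' X hX.2).2.1.differentiableAt (hr' X hX.2).2.2).congr_deriv
        ((hr' X hX.2).1 hX.1).symm
    set f₁ : ℂ → E := fun X => F X - (F Y₁ - powNear 0 (Y₁ - τ) (lam + 1) • P Y₁) with hf₁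
    have hf₁' : ∀ X ∈ W₀, HasDerivAt f₁ (f X) X := fun X hX => (hF X hX).sub_const _
    have hf₁d : DifferentiableOn ℂ f₁ W₀ := fun X hX =>
      (hf₁' X hX).differentiableAt.differentiableWithinAt
    have hf₁e : ∀ᶠ X in 𝓝[W₀] τ, f₁ X = powNear 0 (X - τ) (lam + 1) • P X := by
      filter_upwards [self_mem_nhdsWithin,
        mem_nhdsWithin_of_mem_nhds (Metric.ball_mem_nhds τ hr)] with X hX hXr
      have := eqOn_of_hasDerivAt_eq (hW.isOpen_inner.inter Metric.isOpen_ball)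
        (hW.isPreconnected_inter_ball r) (fun Y hY => hF Y hY.1) hder ⟨hY₁, hY₁r⟩ X ⟨hX, hXr⟩
      simp only [hf₁]
      rw [← sub_add_cancel (F X) (F Y₁), this]
      abel
    have hk' : ∀ Z ∈ S, HasDerivAt k (deriv k Z) Z := fun Z hZ =>
      (hk.differentiableAt (hW.isOpen_kernel.mem_nhds hZ)).hasDerivAt
    have hlam' : NotInt (lam + 1) := fun n hn =>
      hlam (n - 1) (by push_cast; rw [← hn]; ring)
    obtain ⟨R, G, hR, hG, hRG⟩ := ih hlam' (hk.deriv hW.isOpen_kernel) hf₁d hP hf₁e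
      (by simp only [Complex.add_re, Complex.one_re]; push_cast at hN'; linarith)
    refine ⟨fun X => R X + k (X - c) • f₁ c, fun X => k 0 • P X + (X - τ) • G X,
      hR.add (DifferentiableOn.smul_const ?_ _), ?_, ?_⟩
    · exact hk.comp (by fun_prop) fun X hX => hW.sub_mem X hX c (hW.subset hW.base_mem)
    · have h1 : AnalyticAt ℂ (fun X : ℂ => X - τ) τ := by fun_prop
      exact hP.fun_const_smul.add (h1.smul hG)
    · filter_upwards [self_mem_nhdsWithin, hf₁e, hRG] with X hX h1 h2
      rw [segConv_deriv hW.starConvex hW.segDiffs hk' (hk.deriv hW.isOpen_kernel).continuousOn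
        hf₁' hf.continuousOn hX]
      have h0 := ne_of_mem_slitPlane (hW.slit X hX)
      have h3 : powNear 0 (X - τ) (lam + 1 + 1) = powNear 0 (X - τ) (lam + 1) * (X - τ) := by
        simp only [powNear, add_mul, one_mul, Complex.exp_add]
        simp [Complex.exp_log h0]
      rw [h3, mul_smul] at h2
      rw [smul_add, ← h2, smul_comm _ (k 0), ← h1]
      abel

end ConvSetting

end Regularization

/-! ### The intertwining transform -/

section Transform

open Set Filter

variable {E : Type*} [NormedAddCommGroup E] [NormedSpace ℂ E]

theorem segConv_congr {D : Set ℂ} {c : ℂ} {k k₂ : ℂ → ℂ} {f f₂ : ℂ → E} {S : Set ℂ}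
    (hD : StarConvex ℝ c D) (hS : SegDiffs S D c) (hk : EqOn k k₂ S) (hf : EqOn f f₂ D) {X : ℂ}
    (hX : X ∈ D) : segConv k f c X = segConv k₂ f₂ c X := by
  unfold segConv
  apply intervalIntegral.integral_congr
  intro s hs
  rw [uIcc_of_le zero_le_one] at hs
  simp only [hk (hS X hX s hs), hf (hD.seg_mem hX hs)]

/-- The properties of the convolution kernel: it is holomorphic on `S`, it satisfies the
differential equation adjoint to the two systems, and it has the right value at `0`. -/
structure IsKernel (S : Set ℂ) (σ p : ℂ) (κ : ℂ → ℂ) : Prop where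
  differentiableOn : DifferentiableOn ℂ κ S
  map_zero : κ 0 = -(1 + σ + p)
  ode : ∀ Z ∈ S, (1 - Complex.exp (-Z)) * deriv (deriv κ) Z - σ * deriv κ Z +
    (2 + σ) * (Complex.exp (-Z) * deriv κ Z) + p * κ Z = 0

/-- The underlying system in the variable `X = log x` for the function
`f = e ^ ((1 + σ) X) T⁻¹ w (e ^ (-X))`. -/
def UnderlyingEq (T A : E →L[ℂ] E) (σ : ℂ) (f : ℂ → E) (X : ℂ) : Prop :=
  deriv f X - (1 + σ) • f X =
    Complex.exp (-X) • (T (deriv f X) - (1 + σ) • T (f X) + A (T (f X)))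

/-- The operator in the variable `X = log x` which annihilates the upper half `u` of a solution
of the rank `2n` system, once the lower half has been eliminated; `σ = ρ₁ + ρ₂`, `p = ρ₁ ρ₂`. -/
noncomputable def extOp (T A : E →L[ℂ] E) (σ p : ℂ) (u : ℂ → E) (X : ℂ) : E :=
  deriv (deriv u) X - σ • deriv u X + p • u X -
    Complex.exp (-X) • (T (deriv (deriv u) X - deriv u X) - σ • T (deriv u X) + A (T (deriv u X)))

theorem extOp_add {T A : E →L[ℂ] E} {σ p : ℂ} {u v : ℂ → E} {D : Set ℂ} (hD : IsOpen D) {X : ℂ}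
    (hX : X ∈ D) (hu : DifferentiableOn ℂ u D) (hv : DifferentiableOn ℂ v D)
    (hu' : DifferentiableOn ℂ (deriv u) D) (hv' : DifferentiableOn ℂ (deriv v) D) :
    extOp T A σ p (fun X => u X + v X) X = extOp T A σ p u X + extOp T A σ p v X := by
  have h1 : ∀ x ∈ D, deriv (fun X => u X + v X) x = deriv u x + deriv v x := fun x hx =>
    deriv_fun_add (hu.differentiableAt (hD.mem_nhds hx)) (hv.differentiableAt (hD.mem_nhds hx))
  have h2 : deriv (deriv fun X => u X + v X) X = deriv (deriv u) X + deriv (deriv v) X := by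
    have : deriv (fun X => u X + v X) =ᶠ[𝓝 X] fun x => deriv u x + deriv v x :=
      eventually_of_mem (hD.mem_nhds hX) h1
    rw [this.deriv_eq]
    exact deriv_fun_add (hu'.differentiableAt (hD.mem_nhds hX))
      (hv'.differentiableAt (hD.mem_nhds hX))
  simp only [extOp, h1 X hX, h2, map_add, map_sub]
  module

variable [CompleteSpace E]

/-- The transform `f ↦ f + κ * f`, with the convolution taken from a base point `c`, carries
solutions of the underlying system to solutions of the extended one up to a boundary term, which
is holomorphic across the boundary of the domain. -/
theorem extOp_add_segConv {D S : Set ℂ} {c : ℂ} (hDo : IsOpen D) (hD : StarConvex ℝ c D)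
    (hSo : IsOpen S) (hS : SegDiffs S D c) {σ p : ℂ} {κ : ℂ → ℂ} (hκ : IsKernel S σ p κ)
    {T A : E →L[ℂ] E} {f : ℂ → E} (hf : DifferentiableOn ℂ f D)
    (hfe : ∀ X ∈ D, UnderlyingEq T A σ f X) {X : ℂ} (hX : X ∈ D) :
    extOp T A σ p (fun X => f X + segConv κ f c X) X =
      (Complex.exp (-(X - c)) * deriv κ (X - c)) • (f c - Complex.exp (-c) • T (f c)) := by
  have hd0 := hκ.differentiableOn
  have hd1 := hd0.deriv hSo
  have hd2 := hd1.deriv hSo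
  have e0 : ∀ Z ∈ S, HasDerivAt κ (deriv κ Z) Z := fun Z hZ =>
    (hd0.differentiableAt (hSo.mem_nhds hZ)).hasDerivAt
  have e1 : ∀ Z ∈ S, HasDerivAt (deriv κ) (deriv (deriv κ) Z) Z := fun Z hZ =>
    (hd1.differentiableAt (hSo.mem_nhds hZ)).hasDerivAt
  have hf1 := hf.deriv hDo
  have hf2 := hf1.deriv hDo
  have g0 : ∀ Y ∈ D, HasDerivAt f (deriv f Y) Y := fun Y hY =>
    (hf.differentiableAt (hDo.mem_nhds hY)).hasDerivAt
  have g1 : ∀ Y ∈ D, HasDerivAt (deriv f) (deriv (deriv f) Y) Y := fun Y hY =>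
    (hf1.differentiableAt (hDo.mem_nhds hY)).hasDerivAt
  -- first and second derivatives of the transform
  have du : ∀ Y ∈ D, HasDerivAt (fun X => f X + segConv κ f c X)
      (deriv f Y + (κ 0 • f Y + segConv (deriv κ) f c Y)) Y := fun Y hY =>
    (g0 Y hY).fun_add (hasDerivAt_segConv hDo hD hS e0 hd1.continuousOn hf hY)
  have du' : deriv (fun X => f X + segConv κ f c X) =ᶠ[𝓝 X]
      fun Y => deriv f Y + (κ 0 • f Y + segConv (deriv κ) f c Y) :=
    eventually_of_mem (hDo.mem_nhds hX) fun Y hY => (du Y hY).deriv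
  have ddu : deriv (deriv fun X => f X + segConv κ f c X) X = deriv (deriv f) X +
      (κ 0 • deriv f X + (deriv κ 0 • f X + segConv (deriv (deriv κ)) f c X)) := by
    rw [du'.deriv_eq]
    exact ((g1 X hX).fun_add (((g0 X hX).fun_const_smul (κ 0)).fun_add
      (hasDerivAt_segConv hDo hD hS e1 hd2.continuousOn hf hX))).deriv
  -- the kernels `e ^ (-Z) κ'`, `e ^ (-Z) κ''` and the function `e ^ (-Y) T f`
  set m1 : ℂ → ℂ := fun Z => Complex.exp (-Z) * deriv κ Z with hm1
  set m2 : ℂ → ℂ := fun Z => Complex.exp (-Z) * deriv (deriv κ) Z with hm2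
  set g : ℂ → E := fun Y => Complex.exp (-Y) • T (f Y) with hg
  set g' : ℂ → E := fun Y => Complex.exp (-Y) • (T (deriv f Y) - T (f Y)) with hg'
  have hexp : ∀ Z : ℂ, HasDerivAt (fun Z => Complex.exp (-Z)) (-Complex.exp (-Z)) Z := fun Z => by
    simpa using (hasDerivAt_neg Z).cexp
  have cexp : Continuous fun Z : ℂ => Complex.exp (-Z) := by fun_prop
  have hm1' : ∀ Z ∈ S, HasDerivAt m1 (m2 Z - m1 Z) Z := fun Z hZ => by
    refine ((hexp Z).fun_mul (e1 Z hZ)).congr_deriv ?_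
    simp only [hm1, hm2]; ring
  have hm1c : ContinuousOn m1 S := cexp.continuousOn.mul hd1.continuousOn
  have hm2c : ContinuousOn m2 S := cexp.continuousOn.mul hd2.continuousOn
  have hgd : ∀ Y ∈ D, HasDerivAt g (g' Y) Y := fun Y hY => by
    refine ((hexp Y).fun_smul (T.hasFDerivAt.comp_hasDerivAt Y (g0 Y hY))).congr_deriv ?_
    simp only [hg', Function.comp_apply]; module
  have hTf : ContinuousOn (fun Y => T (f Y)) D := T.continuous.comp_continuousOn hf.continuousOn
  have hTf' : ContinuousOn (fun Y => T (deriv f Y)) D :=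
    T.continuous.comp_continuousOn hf1.continuousOn
  have hgc : ContinuousOn g D := cexp.continuousOn.smul hTf
  have hgc' : ContinuousOn g' D := cexp.continuousOn.smul (hTf'.sub hTf)
  have hfc := hf.continuousOn
  have hf1c := hf1.continuousOn
  -- every convolution is reduced to those with the kernels `κ`, `κ'`, `κ''`, `m1`, `m2` against
  -- `f` and `g`: derivatives of `f` and `g` are removed by parts, `A` by the equation of `f`, and
  -- what remains cancels by the equation of the kernel
  have r1 : Complex.exp (-X) • T (segConv (deriv (deriv κ)) f c X) = segConv m2 g c X := by
    rw [← segConv_clm T hD hS hd2.continuousOn hfc hX, segConv_exp_mul]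
  have r2 : Complex.exp (-X) • T (segConv (deriv κ) f c X) = segConv m1 g c X := by
    rw [← segConv_clm T hD hS hd1.continuousOn hfc hX, segConv_exp_mul]
  have r4 : segConv m1 (deriv f) c X = m1 0 • f X - m1 (X - c) • f c +
      (segConv m2 f c X - segConv m1 f c X) := by
    rw [segConv_deriv hD hS hm1' (hm2c.sub hm1c) g0 hf1c hX,
      segConv_kernel_sub hD hS hm2c hm1c hfc hX]
  have r5 : segConv m1 g' c X = m1 0 • g X - m1 (X - c) • g c +
      (segConv m2 g c X - segConv m1 g c X) := by
    rw [segConv_deriv hD hS hm1' (hm2c.sub hm1c) hgd hgc' hX,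
      segConv_kernel_sub hD hS hm2c hm1c hgc hX]
  have r3 : Complex.exp (-X) • A (T (segConv (deriv κ) f c X)) =
      segConv m1 (deriv f) c X + (-(1 + σ) • segConv m1 f c X +
        ((-1 : ℂ) • segConv m1 g' c X + σ • segConv m1 g c X)) := by
    have q1 : ContinuousOn (fun Y => (-1 : ℂ) • g' Y) D := hgc'.const_smul _
    have q2 : ContinuousOn (fun Y => σ • g Y) D := hgc.const_smul _
    have q3 : ContinuousOn (fun Y => -(1 + σ) • f Y) D := hfc.const_smul _
    rw [← segConv_clm T hD hS hd1.continuousOn hfc hX,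
      ← segConv_clm A hD hS hd1.continuousOn hTf hX, segConv_exp_mul,
      ← segConv_const_smul, ← segConv_const_smul, ← segConv_const_smul,
      ← segConv_add hD hS hm1c q1 q2 hX, ← segConv_add hD hS hm1c q3 (q1.fun_add q2) hX,
      ← segConv_add hD hS hm1c hf1c (q3.fun_add (q1.fun_add q2)) hX]
    refine segConv_congr hD hS (fun Z _ => rfl) (fun Y hY => ?_) hX
    have h := hfe Y hY
    simp only [UnderlyingEq] at h
    simp only [hg, hg']
    linear_combination (norm := module) -h
  have r6 : segConv (deriv (deriv κ)) f c X + ((-1 : ℂ) • segConv m2 f c X +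
      (-σ • segConv (deriv κ) f c X + ((2 + σ) • segConv m1 f c X +
        p • segConv κ f c X))) = 0 := by
    have q1 : ContinuousOn (fun Z => (2 + σ) * m1 Z) S := continuousOn_const.mul hm1c
    have q2 : ContinuousOn (fun Z => p * κ Z) S := continuousOn_const.mul hd0.continuousOn
    have q3 : ContinuousOn (fun Z => -σ * deriv κ Z) S := continuousOn_const.mul hd1.continuousOn
    have q4 : ContinuousOn (fun Z => -1 * m2 Z) S := continuousOn_const.mul hm2c
    rw [← segConv_kernel_const_mul, ← segConv_kernel_const_mul, ← segConv_kernel_const_mul,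
      ← segConv_kernel_const_mul,
      ← segConv_kernel_add hD hS q1 q2 hfc hX,
      ← segConv_kernel_add hD hS q3 (q1.fun_add q2) hfc hX,
      ← segConv_kernel_add hD hS q4 (q3.fun_add (q1.fun_add q2)) hfc hX,
      ← segConv_kernel_add hD hS hd2.continuousOn (q4.fun_add (q3.fun_add (q1.fun_add q2)))
        hfc hX]
    rw [segConv_congr (k₂ := fun _ => 0) hD hS (fun Z hZ => ?_) (fun Y _ => rfl) hX]
    · simp [segConv]
    · have := hκ.ode Z hZ
      simp only [hm1, hm2]
      linear_combination this
  have r7 : deriv f X - (1 + σ) • f X =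
    Complex.exp (-X) • (T (deriv f X) - (1 + σ) • T (f X) + A (T (f X))) := hfe X hX
  have r8 : deriv (deriv f) X - (1 + σ) • deriv f X =
      Complex.exp (-X) • (T (deriv (deriv f) X) - (1 + σ) • T (deriv f X) + A (T (deriv f X))) +
      -Complex.exp (-X) • (T (deriv f X) - (1 + σ) • T (f X) + A (T (f X))) := by
    have l1 := (g1 X hX).fun_sub ((g0 X hX).fun_const_smul (1 + σ))
    have t1 := T.hasFDerivAt.comp_hasDerivAt X (g1 X hX)
    have t0 := T.hasFDerivAt.comp_hasDerivAt X (g0 X hX)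
    have a0 := A.hasFDerivAt.comp_hasDerivAt X t0
    have l2 := (hexp X).fun_smul ((t1.fun_sub (t0.fun_const_smul (1 + σ))).fun_add a0)
    refine l1.unique (l2.congr_of_eventuallyEq ?_)
    exact eventually_of_mem (hDo.mem_nhds hX) fun Y hY => hfe Y hY
  have hm10 : m1 0 = deriv κ 0 := by simp [hm1]
  have hgX : g X = Complex.exp (-X) • T (f X) := rfl
  rw [extOp, ddu, du'.self_of_nhds, show Complex.exp (-(X - c)) * deriv κ (X - c) = m1 (X - c)
    from rfl, show Complex.exp (-c) • T (f c) = g c from rfl]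
  rw [r4, r5] at r3
  rw [hm10, hgX] at r3
  rw [hκ.map_zero]
  simp only [map_add, map_sub, map_smul]
  linear_combination (norm := module) r8 + (1 - (1 + σ + p)) • r7 + r6 - r1 + (1 + σ) • r2 - r3

end Transform

/-! ### The transform of a solution with a power singularity -/

section Transform

open Set Filter

variable {E : Type*} [NormedAddCommGroup E] [NormedSpace ℂ E] [CompleteSpace E]

theorem powNear_add_one {c : ℝ} {z : ℂ} (hz : z ≠ 0) (s : ℂ) :
    powNear c z (s + 1) = powNear c z s * z := by
  have h : Complex.exp (Complex.log (z * Complex.exp (-(c * Complex.I))) + c * Complex.I) = z := by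
    rw [Complex.exp_add, Complex.exp_log (mul_ne_zero hz (Complex.exp_ne_zero _)), mul_assoc,
      ← Complex.exp_add]
    simp
  rw [powNear, powNear, add_mul, one_mul, Complex.exp_add, h]

theorem eventually_deriv_powNear_smul {D : Set ℂ} (hDo : IsOpen D) {b : ℂ} {c : ℝ}
    (hcut : OffCut D b c) {s : ℂ} {u g : ℂ → E} (hg : AnalyticAt ℂ g b)
    (hu : ∀ᶠ x in 𝓝[D] b, u x = powNear c (x - b) s • g x) :
    ∀ᶠ x in 𝓝[D] b,
      deriv u x = powNear c (x - b) (s - 1) • (s • g x + (x - b) • deriv g x) := by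
  filter_upwards [eventually_nhds_of_eventually_nhdsWithin hDo hu, hcut,
    nhdsWithin_le_nhds hg.eventually_analyticAt] with x h1 h2 h3
  have h0 := ne_of_mem_slitPlane h2
  rw [EventuallyEq.deriv_eq h1.2,
    (hasDerivAt_powNear_smul s h2 h3.differentiableAt.hasDerivAt).deriv, smul_smul]
  congr 1
  rw [← sub_add_cancel s 1, powNear_add_one h0, add_sub_cancel_right, mul_assoc,
    mul_inv_cancel₀ h0, mul_one]

theorem eqOn_zero_of_eventually_nhdsWithin {D : Set ℂ} (hDo : IsOpen D) (hD : IsPreconnected D)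
    {b : ℂ} (hb : b ∈ closure D) {f : ℂ → E} (hf : DifferentiableOn ℂ f D)
    (h : ∀ᶠ x in 𝓝[D] b, f x = 0) : EqOn f 0 D := by
  have := mem_closure_iff_nhdsWithin_neBot.1 hb
  obtain ⟨x, hx, hx'⟩ := (eventually_nhds_of_eventually_nhdsWithin hDo h).exists
  exact (hf.analyticOnNhd hDo).eqOn_zero_of_preconnected_of_eventuallyEq_zero hD hx hx'

namespace ConvSetting

variable {W₀ W S : Set ℂ} {c τ : ℂ}

/-- If `u` is a power times a holomorphic function at `τ` and `extOp u` extends holomorphically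
across `τ`, then `extOp u = 0`, as a non-integral power times a holomorphic function is
holomorphic only if it vanishes. -/
theorem extOp_eq_zero (hW : ConvSetting W₀ W S c τ) {T A : E →L[ℂ] E} {σ p lam : ℂ}
    (hlam : NotInt lam) {u G h : ℂ → E} (hG : AnalyticAt ℂ G τ)
    (hu : ∀ᶠ X in 𝓝[W₀] τ, u X = powNear 0 (X - τ) lam • G X) (hh : DifferentiableOn ℂ h W)
    (huh : ∀ X ∈ W₀, extOp T A σ p u X = h X) : ∀ X ∈ W₀, extOp T A σ p u X = 0 := by
  have hz : AnalyticAt ℂ (fun X : ℂ => X - τ) τ := by fun_prop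
  set G₁ : ℂ → E := fun X => lam • G X + (X - τ) • deriv G X with hG₁
  set G₂ : ℂ → E := fun X => (lam - 1) • G₁ X + (X - τ) • deriv G₁ X with hG₂
  have aG₁ : AnalyticAt ℂ G₁ τ := hG.fun_const_smul.fun_add (hz.fun_smul hG.deriv)
  have aG₂ : AnalyticAt ℂ G₂ τ := aG₁.fun_const_smul.fun_add (hz.fun_smul aG₁.deriv)
  have hu₁ : ∀ᶠ X in 𝓝[W₀] τ, deriv u X = powNear 0 (X - τ) (lam - 1) • G₁ X :=
    eventually_deriv_powNear_smul hW.isOpen_inner hW.offCut hG hu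
  have hu₂ : ∀ᶠ X in 𝓝[W₀] τ, deriv (deriv u) X = powNear 0 (X - τ) (lam - 1 - 1) • G₂ X :=
    eventually_deriv_powNear_smul hW.isOpen_inner hW.offCut aG₁ hu₁
  have hT : ∀ (L : E →L[ℂ] E) {g : ℂ → E}, AnalyticAt ℂ g τ → AnalyticAt ℂ (fun X => L (g X)) τ :=
    fun L g hg => (L.analyticAt _).comp hg
  set K : ℂ → E := fun X => G₂ X - σ • (X - τ) • G₁ X + p • (X - τ) • (X - τ) • G X -
    Complex.exp (-X) • (T (G₂ X - (X - τ) • G₁ X) - σ • T ((X - τ) • G₁ X) +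
      A (T ((X - τ) • G₁ X))) with hK
  have aexp : AnalyticAt ℂ (fun X : ℂ => Complex.exp (-X)) τ := by fun_prop
  have aK : AnalyticAt ℂ K τ := by
    have b1 := hz.fun_smul aG₁
    have b2 := hT T b1
    have b0 := (hz.fun_smul (hz.fun_smul hG)).fun_const_smul (c := p)
    exact ((aG₂.fun_sub b1.fun_const_smul).fun_add b0).fun_sub
      (aexp.fun_smul (((hT T (aG₂.fun_sub b1)).fun_sub b2.fun_const_smul).fun_add (hT A b2)))
  have key : ∀ᶠ X in 𝓝[W₀] τ, powNear 0 (X - τ) (lam - 1 - 1) • K X = h X := by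
    filter_upwards [hu, hu₁, hu₂, self_mem_nhdsWithin] with X e0 e1 e2 hX
    have h0 := ne_of_mem_slitPlane (hW.slit X hX)
    rw [← huh X hX, extOp, e0, e1, e2]
    have p1 : powNear 0 (X - τ) (lam - 1) = powNear 0 (X - τ) (lam - 1 - 1) * (X - τ) := by
      rw [← powNear_add_one h0, sub_add_cancel]
    have p0 : powNear 0 (X - τ) lam = powNear 0 (X - τ) (lam - 1) * (X - τ) := by
      rw [← powNear_add_one h0, sub_add_cancel]
    rw [p0, p1]
    simp only [hK, map_smul, map_sub]
    module
  have hlam2 : NotInt (lam - 1 - 1) := fun n hn =>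
    hlam (n + 2) (by push_cast; rw [← hn]; ring)
  have ind := (powNear_independent' (κ := Unit) hW.isOpen_inner hW.mem_closure hW.offCut
    (μ := fun _ => lam - 1 - 1) (fun k h hkh => absurd (Subsingleton.elim k h) hkh)
    (fun _ => hlam2) (g := fun _ => K) (fun _ => aK) (f := fun X => -h X)
    ((hh.analyticAt (hW.isOpen_outer.mem_nhds hW.mem_outer)).fun_neg) (by
      filter_upwards [key] with X hX
      simp [hX])).2
  have hz := eqOn_zero_of_eventually_nhdsWithin hW.isOpen_inner hW.convex_inner.isPreconnected
    hW.mem_closure (hh.mono hW.subset) (nhdsWithin_le_nhds (ind.mono fun X hX => neg_eq_zero.1 hX))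
  exact fun X hX => (huh X hX).trans (hz hX)

/-- The regularised transform of a solution of the underlying system with a power singularity
at `τ` is a solution of the extended system with the same exponent and leading coefficient. -/
theorem exists_transform (hW : ConvSetting W₀ W S c τ) {σ p : ℂ} {κ : ℂ → ℂ}
    (hκ : IsKernel S σ p κ) {T A : E →L[ℂ] E} {lam : ℂ} (hlam : NotInt lam) {f : ℂ → E}
    (hf : DifferentiableOn ℂ f W₀) (hfe : ∀ X ∈ W₀, UnderlyingEq T A σ f X) {g : ℂ → E}
    (hg : AnalyticAt ℂ g τ) (hfg : ∀ᶠ X in 𝓝[W₀] τ, f X = powNear 0 (X - τ) lam • g X) :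
    ∃ R G : ℂ → E, DifferentiableOn ℂ R W ∧ AnalyticAt ℂ G τ ∧ G τ = g τ ∧
      (∀ᶠ X in 𝓝[W₀] τ, f X + segConv κ f c X + R X = powNear 0 (X - τ) lam • G X) ∧
      ∀ X ∈ W₀, extOp T A σ p (fun X => f X + segConv κ f c X + R X) X = 0 := by
  obtain ⟨R, G₁, hR, hG₁, hRG⟩ := hW.exists_regularization hlam hκ.differentiableOn hf hg hfg
  have hz : AnalyticAt ℂ (fun X : ℂ => X - τ) τ := by fun_prop
  have hG : AnalyticAt ℂ (fun X => g X + (X - τ) • G₁ X) τ := hg.fun_add (hz.fun_smul hG₁)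
  have hu : ∀ᶠ X in 𝓝[W₀] τ, f X + segConv κ f c X + R X =
      powNear 0 (X - τ) lam • (g X + (X - τ) • G₁ X) := by
    filter_upwards [hfg, hRG, self_mem_nhdsWithin] with X h1 h2 hX
    have h0 := ne_of_mem_slitPlane (hW.slit X hX)
    rw [add_assoc, h2, h1, powNear_add_one h0, smul_add, smul_smul]
  refine ⟨R, _, hR, hG, by simp, hu, ?_⟩
  have hκ0 := hκ.differentiableOn
  have hκ1 := hκ0.deriv hW.isOpen_kernel
  have hR1 := hR.deriv hW.isOpen_outer
  have hR2 := hR1.deriv hW.isOpen_outer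
  have hT : ∀ (L : E →L[ℂ] E) {v : ℂ → E}, DifferentiableOn ℂ v W →
      DifferentiableOn ℂ (fun X => L (v X)) W := fun L v hv =>
    L.differentiable.comp_differentiableOn hv
  have dexp : DifferentiableOn ℂ (fun X : ℂ => Complex.exp (-X)) W := by fun_prop
  have hu0 : DifferentiableOn ℂ (fun X => f X + segConv κ f c X) W₀ := by
    refine hf.fun_add fun X hX => ?_
    exact (hasDerivAt_segConv hW.isOpen_inner hW.starConvex hW.segDiffs
      (fun Z hZ => (hκ0.differentiableAt (hW.isOpen_kernel.mem_nhds hZ)).hasDerivAt)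
      hκ1.continuousOn hf hX).differentiableAt.differentiableWithinAt
  refine hW.extOp_eq_zero hlam (h := fun X => (Complex.exp (-(X - c)) * deriv κ (X - c)) •
    (f c - Complex.exp (-c) • T (f c)) + extOp T A σ p R X) hG hu ?_ fun X hX => ?_
  · refine DifferentiableOn.fun_add (DifferentiableOn.smul_const (DifferentiableOn.fun_mul
      (by fun_prop) (hκ1.comp (by fun_prop)
        fun X hX => hW.sub_mem X hX c (hW.subset hW.base_mem))) _) ?_
    have b1 := hT T hR1
    exact ((hR2.fun_sub (hR1.fun_const_smul σ)).fun_add (hR.fun_const_smul p)).fun_sub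
      (dexp.fun_smul (((hT T (hR2.fun_sub hR1)).fun_sub (b1.fun_const_smul σ)).fun_add (hT A b1)))
  · rw [extOp_add hW.isOpen_inner hX hu0 (hR.mono hW.subset) (hu0.deriv hW.isOpen_inner)
      (hR1.mono hW.subset), extOp_add_segConv hW.isOpen_inner hW.starConvex hW.isOpen_kernel
      hW.segDiffs hκ hf hfe hX]

/-- The convolution with a function holomorphic across `τ` is holomorphic across `τ`. -/
theorem exists_analyticAt_segConv (hW : ConvSetting W₀ W S c τ) {k : ℂ → ℂ}
    (hk : DifferentiableOn ℂ k S) {f h : ℂ → E} (hf : DifferentiableOn ℂ f W₀)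
    (hh : AnalyticAt ℂ h τ) (hfh : ∀ᶠ X in 𝓝[W₀] τ, f X = h X) :
    ∃ H : ℂ → E, AnalyticAt ℂ H τ ∧ ∀ᶠ X in 𝓝[W₀] τ, segConv k f c X = H X := by
  obtain ⟨r, hr, hrW, hrh, hrf⟩ : ∃ r > 0, Metric.ball τ r ⊆ W ∧
      (∀ X ∈ Metric.ball τ r, AnalyticAt ℂ h X) ∧
      ∀ X ∈ W₀ ∩ Metric.ball τ r, f X = h X := by
    rw [eventually_nhdsWithin_iff] at hfh
    obtain ⟨r, hr, h⟩ := Metric.eventually_nhds_iff_ball.1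
      ((hW.isOpen_outer.eventually_mem hW.mem_outer).and (hh.eventually_analyticAt.and hfh))
    exact ⟨r, hr, fun X hX => (h X hX).1, fun X hX => (h X hX).2.1,
      fun X hX => (h X hX.2).2.2 hX.1⟩
  obtain ⟨Y₁, hY₁, hY₁r⟩ := hW.exists_mem_ball hr
  have hhd : DifferentiableOn ℂ h (Metric.ball τ r) := fun y hy =>
    (hrh y hy).differentiableAt.differentiableWithinAt
  have hseg : ContinuousOn (fun s : ℝ => c + s * (Y₁ - c)) (Icc 0 1) := by fun_prop
  have hR₀d := differentiableOn_kernel_integral hW.isOpen_outer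
    hW.isOpen_kernel hW.sub_mem hk hseg
    (fun s hs => hW.subset (hW.starConvex.seg_mem hY₁ hs))
    (((hf.continuousOn.comp hseg fun s hs => hW.starConvex.seg_mem hY₁ hs)).const_smul (Y₁ - c))
  have hstar : StarConvex ℝ Y₁ (Metric.ball τ r) := (convex_ball τ r).starConvex hY₁r
  have hsd : SegDiffs S (Metric.ball τ r) Y₁ := by
    intro X hX s hs
    have h := hW.sub_mem X (hrW hX) _ (hrW (hstar.seg_mem hX hs))
    convert h using 1
    ring
  have hk' : ∀ Z ∈ S, HasDerivAt k (deriv k Z) Z := fun Z hZ =>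
    (hk.differentiableAt (hW.isOpen_kernel.mem_nhds hZ)).hasDerivAt
  have hloc : DifferentiableOn ℂ (segConv k h Y₁) (Metric.ball τ r) := fun X hX =>
    (hasDerivAt_segConv Metric.isOpen_ball hstar hsd hk'
      (hk.deriv hW.isOpen_kernel).continuousOn hhd hX).differentiableAt.differentiableWithinAt
  refine ⟨_, (hR₀d.analyticAt (hW.isOpen_outer.mem_nhds hW.mem_outer)).fun_add
    (hloc.analyticAt (Metric.ball_mem_nhds τ hr)), ?_⟩
  filter_upwards [self_mem_nhdsWithin,
    mem_nhdsWithin_of_mem_nhds (Metric.ball_mem_nhds τ hr)] with X hX hXr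
  have hkX : DifferentiableOn ℂ (fun Y => k (X - Y)) W := fun Y hY =>
    ((hk.differentiableAt (hW.isOpen_kernel.mem_nhds
      (hW.sub_mem X (hW.subset hX) Y hY))).comp (f := fun Y => X - Y) Y
        (by fun_prop)).differentiableWithinAt
  obtain ⟨Ψ, -, hΨ, hΨe⟩ := hW.starConvex.exists_primitive hW.isOpen_inner
    (f := fun Y => k (X - Y) • f Y) ((hkX.mono hW.subset).smul hf)
  obtain ⟨Φ, hΦ0, hΦ, hΦe⟩ := hstar.exists_primitive Metric.isOpen_ball
    (f := fun Y => k (X - Y) • h Y) ((hkX.mono hrW).smul hhd)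
  have hΨX : Ψ X = segConv k f c X := by
    rw [hΨe, segConv]
    congr 1
    funext s
    rw [show X - (c + s * (X - c)) = (1 - s) * (X - c) by ring, smul_smul]
  have hΦX : Φ X = segConv k h Y₁ X := by
    rw [hΦe, segConv]
    congr 1
    funext s
    rw [show X - (Y₁ + s * (X - Y₁)) = (1 - s) * (X - Y₁) by ring, smul_smul]
  have := eqOn_of_hasDerivAt_eq (hW.isOpen_inner.inter Metric.isOpen_ball)
    (hW.isPreconnected_inter_ball r) (fun Y hY => hΨ Y hY.1)
    (fun Y hY => (hΦ Y hY.2).congr_deriv (by rw [hrf Y hY])) ⟨hY₁, hY₁r⟩ X ⟨hX, hXr⟩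
  rw [hΨX, hΦX, hΦ0, sub_zero, hΨe Y₁] at this
  rw [← this, ← sub_eq_iff_eq_add']
  simp only [smul_comm (Y₁ - c), Pi.smul_apply, Function.comp_apply]

/-- A connection formula for solutions of the underlying system carries over to the regularised
transforms. -/
theorem exists_analyticAt_transform_sub (hW : ConvSetting W₀ W S c τ) {k : ℂ → ℂ}
    (hk : DifferentiableOn ℂ k S) {κ : Type*} [Fintype κ] {C : κ → ℂ} {f R : ℂ → E}
    {fb Rb : κ → ℂ → E} (hf : DifferentiableOn ℂ f W₀) (hfb : ∀ b, DifferentiableOn ℂ (fb b) W₀)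
    (hR : DifferentiableOn ℂ R W) (hRb : ∀ b, DifferentiableOn ℂ (Rb b) W) {h : ℂ → E}
    (hh : AnalyticAt ℂ h τ) (hfh : ∀ᶠ X in 𝓝[W₀] τ, f X = (∑ b, C b • fb b X) + h X) :
    ∃ H : ℂ → E, AnalyticAt ℂ H τ ∧ ∀ᶠ X in 𝓝[W₀] τ, f X + segConv k f c X + R X =
      (∑ b, C b • (fb b X + segConv k (fb b) c X + Rb b X)) + H X := by
  obtain ⟨H, hH, hH'⟩ := hW.exists_analyticAt_segConv hk
    (f := fun X => f X - ∑ b, C b • fb b X) (h := h)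
    (hf.fun_sub (DifferentiableOn.fun_sum fun b _ => (hfb b).fun_const_smul (C b))) hh (by
      filter_upwards [hfh] with X hX
      rw [hX]; abel)
  have hR' : DifferentiableOn ℂ (fun X => R X - ∑ b, C b • Rb b X) W :=
    hR.fun_sub (DifferentiableOn.fun_sum fun b _ => (hRb b).fun_const_smul (C b))
  refine ⟨fun X => h X + H X + (R X - ∑ b, C b • Rb b X), (hh.fun_add hH).fun_add
    (hR'.analyticAt (hW.isOpen_outer.mem_nhds hW.mem_outer)), ?_⟩
  filter_upwards [hfh, hH', self_mem_nhdsWithin] with X h1 h2 hX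
  have hs := hW.starConvex
  have hd := hW.segDiffs
  have e1 : segConv k f c X = segConv k (fun X => f X - ∑ b, C b • fb b X) c X +
      ∑ b, C b • segConv k (fb b) c X := by
    have hsum : segConv k (fun X => ∑ b, C b • fb b X) c X = ∑ b, C b • segConv k (fb b) c X := by
      simp only [← segConv_const_smul]
      unfold segConv
      rw [← intervalIntegral.integral_finsetSum fun b _ =>
        intervalIntegrable_segConv hs hd hk.continuousOn
          ((hfb b).fun_const_smul (C b)).continuousOn hX]
      simp only [Finset.smul_sum]
    rw [← hsum, ← segConv_add hs hd hk.continuousOn (hf.fun_sub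
      (DifferentiableOn.fun_sum fun b _ => (hfb b).fun_const_smul (C b))).continuousOn
      (DifferentiableOn.fun_sum fun b _ => (hfb b).fun_const_smul (C b)).continuousOn hX]
    simp
  rw [e1, h2, h1]
  simp only [smul_add, Finset.sum_add_distrib]
  abel

end ConvSetting

end Transform

/-! ### The lower half of a solution -/

section LowerPart

open Set Filter

variable {E : Type*} [NormedAddCommGroup E] [NormedSpace ℂ E]

/-- The lower half of the solution of the rank `2n` system with upper half `u`, in the variable
`X = log x` and up to the change of basis `P`. -/
noncomputable def lowerPart (T A : E →L[ℂ] E) (u : ℂ → E) (X : ℂ) : E :=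
  deriv u X - Complex.exp (-X) • T (deriv u X) - A (u X)

/-- The lower half of the system: `lowerPart' = (σ - A) lowerPart - (A - ρ₁) (A - ρ₂) u` when `u` is
annihilated by `extOp`. -/
theorem hasDerivAt_lowerPart [CompleteSpace E] {T A : E →L[ℂ] E} {σ p : ℂ} {u : ℂ → E} {D : Set ℂ}
    (hD : IsOpen D) (hu : DifferentiableOn ℂ u D) {X : ℂ} (hX : X ∈ D)
    (h : extOp T A σ p u X = 0) :
    HasDerivAt (lowerPart T A u) (σ • (lowerPart T A u X + A (u X)) -
      A (lowerPart T A u X + A (u X)) - p • u X) X := by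
  have g0 := (hu.differentiableAt (hD.mem_nhds hX)).hasDerivAt
  have g1 := ((hu.deriv hD).differentiableAt (hD.mem_nhds hX)).hasDerivAt
  have hexp : HasDerivAt (fun Z => Complex.exp (-Z)) (-Complex.exp (-X)) X := by
    simpa using (hasDerivAt_neg X).cexp
  refine ((g1.fun_sub (hexp.fun_smul (T.hasFDerivAt.comp_hasDerivAt X g1))).fun_sub
    (A.hasFDerivAt.comp_hasDerivAt X g0)).congr_deriv ?_
  simp only [extOp, map_sub] at h
  simp only [lowerPart, map_sub, map_add, map_smul, Function.comp_apply]
  linear_combination (norm := module) h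

/-- The lower half has the same exponent as `u` and leading coefficient `0`. From `u` one only
gets the exponent `lam - 1`; the differential equation of the lower half makes the first two
coefficients vanish. -/
theorem exists_lowerPart_localForm [CompleteSpace E] {T A : E →L[ℂ] E} {σ p lam : ℂ}
    (hlam : NotInt lam) {u G : ℂ → E} {D : Set ℂ} (hD : IsOpen D) {b : ℂ} (hb : b ∈ closure D)
    (hcut : OffCut D b 0) (hu : DifferentiableOn ℂ u D) (hG : AnalyticAt ℂ G b)
    (huG : ∀ᶠ X in 𝓝[D] b, u X = powNear 0 (X - b) lam • G X)
    (h : ∀ X ∈ D, extOp T A σ p u X = 0) :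
    ∃ N : ℂ → E, AnalyticAt ℂ N b ∧ N b = 0 ∧
      ∀ᶠ X in 𝓝[D] b, lowerPart T A u X = powNear 0 (X - b) lam • N X := by
  have hz : AnalyticAt ℂ (fun X : ℂ => X - b) b := by fun_prop
  have aexp : AnalyticAt ℂ (fun X : ℂ => Complex.exp (-X)) b := by fun_prop
  have hT : ∀ (L : E →L[ℂ] E) {g : ℂ → E}, AnalyticAt ℂ g b → AnalyticAt ℂ (fun X => L (g X)) b :=
    fun L g hg => (L.analyticAt _).comp hg
  set G₁ : ℂ → E := fun X => lam • G X + (X - b) • deriv G X with hG₁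
  have aG₁ : AnalyticAt ℂ G₁ b := hG.fun_const_smul.fun_add (hz.fun_smul hG.deriv)
  have hu₁ : ∀ᶠ X in 𝓝[D] b, deriv u X = powNear 0 (X - b) (lam - 1) • G₁ X :=
    eventually_deriv_powNear_smul hD hcut hG huG
  set ν : ℂ → E := fun X => G₁ X - Complex.exp (-X) • T (G₁ X) - (X - b) • A (G X) with hν
  have aν : AnalyticAt ℂ ν b :=
    (aG₁.fun_sub (aexp.fun_smul (hT T aG₁))).fun_sub (hz.fun_smul (hT A hG))
  have hV : ∀ᶠ X in 𝓝[D] b, lowerPart T A u X = powNear 0 (X - b) (lam - 1) • ν X := by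
    filter_upwards [huG, hu₁, hcut] with X e0 e1 hX
    have h0 := ne_of_mem_slitPlane hX
    have p0 : powNear 0 (X - b) lam = powNear 0 (X - b) (lam - 1) * (X - b) := by
      rw [← powNear_add_one h0, sub_add_cancel]
    rw [lowerPart, e0, e1, p0]
    simp only [hν, map_smul]
    module
  have hV₁ := eventually_deriv_powNear_smul hD hcut aν hV
  set M : ℂ → E := fun X => σ • (ν X + (X - b) • A (G X)) -
    A (ν X + (X - b) • A (G X)) - p • (X - b) • G X with hM
  have aM : AnalyticAt ℂ M b := by
    have b1 := aν.fun_add (hz.fun_smul (hT A hG))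
    exact (b1.fun_const_smul.fun_sub (hT A b1)).fun_sub (hz.fun_smul hG).fun_const_smul
  have ind := (powNear_independent' (κ := Unit) hD hb hcut
    (μ := fun _ => lam - 1 - 1) (fun k h hkh => absurd (Subsingleton.elim k h) hkh)
    (fun _ n hn => hlam (n + 2) (by push_cast; rw [← hn]; ring))
    (g := fun _ X => (lam - 1) • ν X + (X - b) • deriv ν X - (X - b) • M X)
    (fun _ => (aν.fun_const_smul.fun_add (hz.fun_smul aν.deriv)).fun_sub (hz.fun_smul aM))
    (f := fun _ => 0) analyticAt_const (by
      filter_upwards [huG, hV, hV₁, hcut, self_mem_nhdsWithin] with X e0 e1 e2 hX hXD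
      have h0 := ne_of_mem_slitPlane hX
      have p1 : powNear 0 (X - b) (lam - 1) = powNear 0 (X - b) (lam - 1 - 1) * (X - b) := by
        rw [← powNear_add_one h0, sub_add_cancel]
      have p0 : powNear 0 (X - b) lam = powNear 0 (X - b) (lam - 1) * (X - b) := by
        rw [← powNear_add_one h0, sub_add_cancel]
      rw [(hasDerivAt_lowerPart hD hu hXD (h X hXD)).deriv, e1, e0, p0, p1] at e2
      simp only [map_smul, map_add] at e2
      simp only [Finset.univ_unique, Finset.sum_singleton, hM, map_smul, map_add]
      linear_combination (norm := module) -e2)).1 ()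
  have hlam1 : lam - 1 ≠ 0 := fun h => hlam 1 (by push_cast; linear_combination h)
  have hlam0 : lam ≠ 0 := fun h => hlam 0 (by simpa using h)
  -- `ind` at `b`, and then its derivative at `b`
  have hν0 : ν b = 0 := by
    have := ind.self_of_nhds
    simpa [hlam1] using this
  have hν1 : deriv ν b = 0 := by
    have e1 := (aν.differentiableAt.hasDerivAt.fun_const_smul (lam - 1)).fun_add
      (((hasDerivAt_id b).sub_const b).fun_smul aν.deriv.differentiableAt.hasDerivAt)
    have e2 := e1.fun_sub
      (((hasDerivAt_id b).sub_const b).fun_smul aM.differentiableAt.hasDerivAt)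
    have e3 := e2.unique ((hasDerivAt_const b (0 : E)).congr_of_eventuallyEq ind)
    have hM0 : M b = 0 := by simp [hM, hν0]
    simp only [id, sub_self, zero_smul, zero_add, one_smul, hM0, add_zero, sub_zero] at e3
    have : lam • deriv ν b = 0 := by linear_combination (norm := module) e3
    exact (smul_eq_zero.1 this).resolve_left hlam0
  refine ⟨dslope ν b, ?_, by rw [dslope_same, hν1], ?_⟩
  · obtain ⟨q, hq⟩ := aν
    exact ⟨_, hq.has_fpower_series_dslope_fslope⟩
  · filter_upwards [hV, hcut] with X e1 hX
    have h0 := ne_of_mem_slitPlane hX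
    rw [e1, ← sub_add_cancel lam 1, powNear_add_one h0, add_sub_cancel_right, mul_smul,
      sub_smul_dslope, hν0, sub_zero]

theorem lowerPart_congr {T A : E →L[ℂ] E} {u v : ℂ → E} {X : ℂ} (h : u =ᶠ[𝓝 X] v) :
    lowerPart T A u X = lowerPart T A v X := by
  simp only [lowerPart, h.self_of_nhds, h.deriv_eq]

theorem AnalyticAt.lowerPart [CompleteSpace E] {T A : E →L[ℂ] E} {u : ℂ → E} {X : ℂ}
    (hu : AnalyticAt ℂ u X) : AnalyticAt ℂ (lowerPart T A u) X := by
  have aexp : AnalyticAt ℂ (fun X : ℂ => Complex.exp (-X)) X := by fun_prop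
  exact (hu.deriv.fun_sub (aexp.fun_smul ((T.analyticAt _).comp hu.deriv))).fun_sub
    ((A.analyticAt _).comp hu)

theorem lowerPart_sum_add {κ : Type*} [Fintype κ] {T A : E →L[ℂ] E} {C : κ → ℂ} {u : κ → ℂ → E}
    {H : ℂ → E} {X : ℂ} (hu : ∀ b, DifferentiableAt ℂ (u b) X) (hH : DifferentiableAt ℂ H X) :
    lowerPart T A (fun X => (∑ b, C b • u b X) + H X) X =
      (∑ b, C b • lowerPart T A (u b) X) + lowerPart T A H X := by
  have h : deriv (fun X => (∑ b, C b • u b X) + H X) X = (∑ b, C b • deriv (u b) X) + deriv H X :=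
    ((HasDerivAt.fun_sum fun b _ => (hu b).hasDerivAt.fun_const_smul (C b)).fun_add
      hH.hasDerivAt).deriv
  simp only [lowerPart, h, map_add, map_sum, map_smul, smul_add, Finset.smul_sum, smul_sub,
    Finset.sum_sub_distrib]
  simp only [smul_comm (Complex.exp (-X))]
  abel

end LowerPart

/-! ### Change of coordinates for powers -/

section Coordinates

open Set Filter

/-- The logarithm is additive if multiplication by `φ` keeps `z` in its open half plane: the
arguments of `z` and `z φ` then differ by less than `π`. -/
theorem log_mul_of_im_mul_im_pos {z φ : ℂ} (h : 0 < z.im * (z * φ).im) :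
    Complex.log (z * φ) = Complex.log z + Complex.log φ := by
  have hzφ : z * φ ≠ 0 := fun h0 => by simp [h0] at h
  have hz : z ≠ 0 := left_ne_zero_of_mul hzφ
  have hφ : φ ≠ 0 := right_ne_zero_of_mul hzφ
  have hb : |(z * φ).arg - z.arg| < Real.pi := by
    rcases mul_pos_iff.1 h with ⟨h1, h2⟩ | ⟨h1, h2⟩
    · have a1 := Complex.arg_nonneg_iff.2 h1.le
      have a2 := Complex.arg_nonneg_iff.2 h2.le
      have a3 := Complex.arg_lt_pi_iff.2 (Or.inr h1.ne')
      have a4 := Complex.arg_lt_pi_iff.2 (Or.inr h2.ne')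
      rw [abs_lt]; constructor <;> linarith
    · have a1 := Complex.arg_neg_iff.2 h1
      have a2 := Complex.arg_neg_iff.2 h2
      have a3 := Complex.neg_pi_lt_arg z
      have a4 := Complex.neg_pi_lt_arg (z * φ)
      rw [abs_lt]; constructor <;> linarith
  have he : Complex.exp (Complex.log (z * φ) - Complex.log z - Complex.log φ) = 1 := by
    rw [Complex.exp_sub, Complex.exp_sub, Complex.exp_log hzφ, Complex.exp_log hz,
      Complex.exp_log hφ]
    field_simp
  obtain ⟨n, hn⟩ := Complex.exp_eq_one_iff.1 he
  have him := congrArg Complex.im hn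
  simp only [Complex.sub_im, Complex.log_im, Complex.mul_im, Complex.intCast_re,
    Complex.intCast_im, Complex.I_im, Complex.re_ofNat, Complex.ofReal_re, Complex.im_ofNat,
    Complex.ofReal_im, Complex.I_re, Complex.mul_re, mul_zero, zero_mul, mul_one, sub_zero,
    add_zero] at him
  have h1 := abs_lt.1 hb
  have h2 := Complex.neg_pi_lt_arg φ
  have h3 := Complex.arg_le_pi φ
  have hpi := Real.pi_pos
  have hn0 : n = 0 := by
    have u1 : (n : ℝ) < 1 := by
      by_contra hc
      push Not at hc
      nlinarith
    have u2 : (-1 : ℝ) < n := by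
      by_contra hc
      push Not at hc
      nlinarith
    have u3 : n < 1 := by exact_mod_cast u1
    have u4 : -1 < n := by exact_mod_cast u2
    omega
  rw [hn0, Int.cast_zero, zero_mul, sub_sub, sub_eq_zero] at hn
  exact hn

/-- In a coordinate `X` with `e X - t = r e ^ (θ i) (X - τ) φ X`, `φ τ = 1`, the power
`(e X - t) ^ lam` is `(X - τ) ^ lam` times a nonvanishing holomorphic function, provided that the
branches agree: both `X - τ` and its multiple lie in the same half plane. -/
theorem exists_powNear_comp {F : Filter ℂ} {e φ : ℂ → ℂ} {t τ : ℂ} {θ r : ℝ} (hr : 0 < r)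
    (hφ : AnalyticAt ℂ φ τ) (hφ1 : φ τ = 1)
    (he : ∀ X, (e X - t) * Complex.exp (-(θ * Complex.I)) = r * ((X - τ) * φ X))
    (him : ∀ᶠ X in F, 0 < (X - τ).im * ((X - τ) * φ X).im) (lam : ℂ) :
    ∃ ψ : ℂ → ℂ, AnalyticAt ℂ ψ τ ∧ (∀ X, ψ X ≠ 0) ∧
      ψ τ = Complex.exp (lam * (Real.log r + θ * Complex.I)) ∧
      ∀ᶠ X in F, powNear θ (e X - t) lam = powNear 0 (X - τ) lam * ψ X := by
  refine ⟨fun X => Complex.exp (lam * (Real.log r + Complex.log (φ X) + θ * Complex.I)), ?_,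
    fun X => Complex.exp_ne_zero _, by simp [hφ1], ?_⟩
  · have h1 : AnalyticAt ℂ (fun X => Complex.log (φ X)) τ := hφ.clog (by simp [hφ1])
    fun_prop
  · filter_upwards [him] with X hX
    have h0 : (X - τ) * φ X ≠ 0 := fun h0 => by simp [h0] at hX
    rw [powNear, powNear, he, Complex.log_ofReal_mul hr h0, log_mul_of_im_mul_im_pos hX,
      ← Complex.exp_add]
    congr 1
    simp only [Complex.ofReal_zero, zero_mul, neg_zero, Complex.exp_zero, mul_one, add_zero]
    ring

theorem sub_mul_dslope_exp (z : ℂ) : z * dslope Complex.exp 0 z = Complex.exp z - 1 := by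
  have := sub_smul_dslope Complex.exp 0 z
  simpa using this

theorem analyticAt_dslope_exp (z : ℂ) : AnalyticAt ℂ (dslope Complex.exp 0) z := by
  have h : DifferentiableOn ℂ (dslope Complex.exp 0) univ :=
    (Complex.differentiableOn_dslope univ_mem).2 Complex.differentiable_exp.differentiableOn
  exact h.analyticAt univ_mem

/-- Near `0`, away from the real axis, `exp z - 1` lies in the same half plane as `z`. -/
theorem im_mul_im_exp_sub_one_pos {z : ℂ} (h0 : z.im ≠ 0) (h : |z.im| < Real.pi) :
    0 < z.im * (Complex.exp z - 1).im := by
  rw [Complex.sub_im, Complex.exp_im, Complex.one_im, sub_zero, mul_left_comm]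
  refine mul_pos (Real.exp_pos _) ?_
  rw [abs_lt] at h
  rcases lt_or_gt_of_ne h0 with h1 | h1
  · exact mul_pos_of_neg_of_neg h1 (Real.sin_neg_of_neg_of_neg_pi_lt h1 h.1)
  · exact mul_pos h1 (Real.sin_pos_of_pos_of_lt_pi h1 h.2)

/-- The coordinate `x = b + e ^ X` at the point `t = b + e ^ τ`. -/
theorem exists_powNear_add_exp {F : Filter ℂ} {b τ : ℂ} (hF : F ≤ 𝓝 τ)
    (him : ∀ᶠ X in F, (X - τ).im ≠ 0) (lam : ℂ) :
    ∃ ψ : ℂ → ℂ, AnalyticAt ℂ ψ τ ∧ (∀ X, ψ X ≠ 0) ∧ ψ τ = Complex.exp (lam * τ) ∧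
      ∀ᶠ X in F, powNear τ.im (b + Complex.exp X - (b + Complex.exp τ)) lam =
        powNear 0 (X - τ) lam * ψ X := by
  have hpi : ∀ᶠ X in F, |(X - τ).im| < Real.pi := by
    have : Tendsto (fun X : ℂ => |(X - τ).im|) (𝓝 τ) (𝓝 |(τ - τ).im|) :=
      (Continuous.tendsto (by fun_prop) τ)
    exact hF (this.eventually_lt_const (by simp [Real.pi_pos]))
  obtain ⟨ψ, h1, h2, h3, h4⟩ := exists_powNear_comp (F := F) (e := fun X => b + Complex.exp X)
    (φ := fun X => dslope Complex.exp 0 (X - τ)) (t := b + Complex.exp τ) (τ := τ) (θ := τ.im)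
    (r := Real.exp τ.re) (Real.exp_pos _)
    ((analyticAt_dslope_exp _).comp (by fun_prop)) (by simp) (fun X => by
      rw [sub_mul_dslope_exp]
      have : Complex.exp τ * Complex.exp (-(τ.im * Complex.I)) = Real.exp τ.re := by
        rw [← Complex.exp_add, Complex.ofReal_exp]
        congr 1
        linear_combination -(Complex.re_add_im τ)
      rw [← this, Complex.exp_sub]
      field_simp
      ring) (by
      filter_upwards [him, hpi] with X ha hb
      rw [sub_mul_dslope_exp]
      exact im_mul_im_exp_sub_one_pos ha hb) lam
  refine ⟨ψ, h1, h2, ?_, h4⟩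
  rw [h3, Real.log_exp, Complex.re_add_im]

/-- The coordinate `ζ = b + e ^ (-X)` at the point `b + e ^ (-τ)`. -/
theorem exists_powNear_add_exp_neg {F : Filter ℂ} {b τ : ℂ} (hF : F ≤ 𝓝 τ)
    (him : ∀ᶠ X in F, (X - τ).im ≠ 0) (lam : ℂ) :
    ∃ ψ : ℂ → ℂ, AnalyticAt ℂ ψ τ ∧ (∀ X, ψ X ≠ 0) ∧
      ψ τ = Complex.exp (-(lam * τ) - Real.pi * Complex.I * lam) ∧
      ∀ᶠ X in F, powNear (-τ.im - Real.pi) (b + Complex.exp (-X) - (b + Complex.exp (-τ))) lam =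
        powNear 0 (X - τ) lam * ψ X := by
  have hpi : ∀ᶠ X in F, |(X - τ).im| < Real.pi := by
    have : Tendsto (fun X : ℂ => |(X - τ).im|) (𝓝 τ) (𝓝 |(τ - τ).im|) :=
      (Continuous.tendsto (by fun_prop) τ)
    exact hF (this.eventually_lt_const (by simp [Real.pi_pos]))
  have hφ : ∀ X, (X - τ) * dslope Complex.exp 0 (-(X - τ)) = 1 - Complex.exp (-(X - τ)) :=
    fun X => by linear_combination -sub_mul_dslope_exp (-(X - τ))
  obtain ⟨ψ, h1, h2, h3, h4⟩ := exists_powNear_comp (F := F)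
    (e := fun X => b + Complex.exp (-X)) (φ := fun X => dslope Complex.exp 0 (-(X - τ)))
    (t := b + Complex.exp (-τ)) (τ := τ) (θ := -τ.im - Real.pi)
    (r := Real.exp (-τ.re)) (Real.exp_pos _)
    ((analyticAt_dslope_exp _).comp (by fun_prop)) (by simp) (fun X => by
      rw [hφ]
      have : -(Complex.exp (-τ) * Complex.exp (-((-τ.im - Real.pi : ℝ) * Complex.I))) =
          Real.exp (-τ.re) := by
        rw [← Complex.exp_add, Complex.ofReal_exp]
        have e : -τ + -(((-τ.im - Real.pi : ℝ) : ℂ) * Complex.I) =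
            ((-τ.re : ℝ) : ℂ) + Real.pi * Complex.I := by
          push_cast
          linear_combination (Complex.re_add_im τ)
        rw [e, Complex.exp_add, Complex.exp_pi_mul_I]
        ring
      rw [← this, neg_sub, Complex.exp_sub, Complex.exp_neg X, Complex.exp_neg τ]
      field_simp
      ring) (by
      filter_upwards [him, hpi] with X ha hb
      rw [hφ]
      have := im_mul_im_exp_sub_one_pos (z := -(X - τ)) (by rwa [Complex.neg_im, neg_ne_zero])
        (by rwa [Complex.neg_im, abs_neg])
      simp only [Complex.neg_im, Complex.sub_im, Complex.one_im] at this ⊢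
      linarith) lam
  refine ⟨ψ, h1, h2, ?_, h4⟩
  rw [h3, Real.log_exp]
  congr 1
  push_cast
  linear_combination (-lam) * (Complex.re_add_im τ)

end Coordinates

/-! ### From the logarithmic variable back to the rank `2n` system -/

/-- `l` is a branch of `log (x - b)` on `D` with values in `W₀`. -/
structure IsLogBranch (b : ℂ) (D W₀ : Set ℂ) (l : ℂ → ℂ) : Prop where
  mapsTo : Set.MapsTo l D W₀
  add_exp : ∀ x ∈ D, b + Complex.exp (l x) = x
  hasDerivAt : ∀ x ∈ D, HasDerivAt l (Complex.exp (-l x)) x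

namespace ExtendedOkuboSystem

open Set Filter

variable (S : ExtendedOkuboSystem)

/-- The differences `T_a = t_i - t_{p+1}`, `a = (i, k, h)`. -/
noncomputable def diffT (a : S.Idx) : ℂ := S.pt a.1 - S.tLast

theorem pt_ne_tLast (i : Fin S.p) : S.pt i ≠ S.tLast := fun h =>
  (Fin.castSucc_lt_last i).ne (S.t_injective h)

theorem pt_injective : Function.Injective S.pt := fun _ _ h =>
  Fin.castSucc_injective _ (S.t_injective h)

theorem diffT_ne_zero (a : S.Idx) : S.diffT a ≠ 0 := sub_ne_zero.2 (S.pt_ne_tLast a.1)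

/-- Multiplication by `diag (t_i - t_{p+1})`. -/
noncomputable def opT : (S.Idx → ℂ) →L[ℂ] (S.Idx → ℂ) := (Matrix.diagonal S.diffT).mulVecCLM

/-- Multiplication by `A`. -/
noncomputable def opA : (S.Idx → ℂ) →L[ℂ] (S.Idx → ℂ) := S.A.mulVecCLM

theorem opT_apply (v : S.Idx → ℂ) (a : S.Idx) : S.opT v a = S.diffT a * v a := by
  simp [opT, Matrix.mulVec_diagonal]

theorem opA_apply (v : S.Idx → ℂ) : S.opA v = S.A *ᵥ v := rfl

/-- The function on `D` with upper half `u` in the variable `log (x - t_{p+1})`. -/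
noncomputable def extendedSolution (u : ℂ → S.Idx → ℂ) (l : ℂ → ℂ) (x : ℂ) :
    S.Idx ⊕ S.Idx' → ℂ :=
  Sum.elim (u (l x)) (S.Pinv *ᵥ lowerPart S.opT S.opA u (l x))

/-- As `A' P⁻¹ = P⁻¹ A`, this is `P⁻¹ (A - ρ₁) (A - ρ₂)`. -/
theorem extOp_matrix_identity :
    (S.Pinv * S.A * S.P - S.rho₁ • 1) * (S.Pinv * S.A * S.P - S.rho₂ • 1) * S.Pinv =
      S.Pinv * S.A * S.A - (S.rho₁ + S.rho₂) • (S.Pinv * S.A) + (S.rho₁ * S.rho₂) • S.Pinv := by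
  have h : S.Pinv * S.A * S.P * S.Pinv = S.Pinv * S.A := by
    rw [Matrix.mul_assoc, S.P_mul_Pinv, Matrix.mul_one]
  have h2 : (S.Pinv * S.A * S.P - S.rho₂ • 1) * S.Pinv = S.Pinv * S.A - S.rho₂ • S.Pinv := by
    rw [Matrix.sub_mul, h, Matrix.smul_mul, Matrix.one_mul]
  rw [Matrix.mul_assoc _ _ S.Pinv, h2, Matrix.sub_mul, Matrix.mul_sub, Matrix.mul_smul,
    Matrix.smul_mul, Matrix.one_mul, h, ← Matrix.mul_assoc, h, smul_sub,
    smul_smul, add_smul]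
  abel

/-- A solution `u` of `extOp u = 0` is the upper half of a solution of the rank `2n` system. -/
theorem isONFSolution_extendedSolution {D W₀ : Set ℂ} (hW₀ : IsOpen W₀) {l : ℂ → ℂ}
    (hl : IsLogBranch S.tLast D W₀ l) {u : ℂ → S.Idx → ℂ} (hu : DifferentiableOn ℂ u W₀)
    (h : ∀ X ∈ W₀, extOp S.opT S.opA (S.rho₁ + S.rho₂) (S.rho₁ * S.rho₂) u X = 0) :
    IsONFSolution S.bigT S.bigA D (S.extendedSolution u l) := by
  intro x hx
  have hX := hl.mapsTo hx
  have hl' := hl.hasDerivAt x hx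
  have du := ((hu.differentiableAt (hW₀.mem_nhds hX)).hasDerivAt).scomp x hl'
  have dV := (S.Pinv.mulVecCLM.hasFDerivAt.comp_hasDerivAt _
    (hasDerivAt_lowerPart hW₀ hu hX (h _ hX))).scomp x hl'
  set V := lowerPart S.opT S.opA u (l x) with hV
  refine ⟨Sum.elim (Complex.exp (-l x) • deriv u (l x)) (Complex.exp (-l x) • (S.Pinv *ᵥ
    ((S.rho₁ + S.rho₂) • (V + S.opA (u (l x))) - S.opA (V + S.opA (u (l x))) -
      (S.rho₁ * S.rho₂) • u (l x)))), ?_, ?_⟩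
  · rw [hasDerivAt_pi] at du dV ⊢
    rintro (a | b)
    · exact du a
    · exact dV b
  · have hxe : x - S.tLast = Complex.exp (l x) := by
      nth_rewrite 1 [← hl.add_exp x hx]; ring
    have hexp : Complex.exp (l x) * Complex.exp (-l x) = 1 := by
      rw [← Complex.exp_add, add_neg_cancel, Complex.exp_zero]
    have hv1 : (S.extendedSolution u l x) ∘ Sum.inl = u (l x) := by
      funext a; simp [extendedSolution]
    have hv2 : (S.extendedSolution u l x) ∘ Sum.inr = S.Pinv *ᵥ V := by
      funext a; simp [extendedSolution, hV]
    funext s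
    rw [smul_one_sub_diagonal_mulVec]
    simp only [bigA, Matrix.fromBlocks_mulVec, hv1, hv2]
    rcases s with a | b
    · simp only [bigT, Sum.elim_inl, Pi.smul_apply, smul_eq_mul, Pi.add_apply,
        Matrix.mulVec_mulVec, S.P_mul_Pinv, Matrix.one_mulVec]
      have e : V a = deriv u (l x) a - Complex.exp (-l x) * (S.diffT a * deriv u (l x) a) -
          (S.A *ᵥ u (l x)) a := by
        simp [hV, lowerPart, opT_apply, opA_apply]
      rw [e]
      have : x - S.pt a.1 = Complex.exp (l x) - S.diffT a := by rw [← hxe, diffT]; ring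
      rw [this]
      linear_combination (deriv u (l x) a) * hexp
    · simp only [bigT, Sum.elim_inr, Pi.smul_apply, smul_eq_mul, hxe]
      rw [← mul_assoc, hexp, one_mul]
      have e : -((S.Pinv * S.A * S.P - S.rho₁ • 1) * (S.Pinv * S.A * S.P - S.rho₂ • 1) *
          S.Pinv) *ᵥ u (l x) + ((S.rho₁ + S.rho₂) • 1 - S.Pinv * S.A * S.P) *ᵥ (S.Pinv *ᵥ V) =
          S.Pinv *ᵥ ((S.rho₁ + S.rho₂) • (V + S.opA (u (l x))) - S.opA (V + S.opA (u (l x))) -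
            (S.rho₁ * S.rho₂) • u (l x)) := by
        rw [S.extOp_matrix_identity]
        have h3 : S.Pinv * S.A * S.P * S.Pinv = S.Pinv * S.A := by
          rw [Matrix.mul_assoc, S.P_mul_Pinv, Matrix.mul_one]
        simp only [opA_apply, Matrix.neg_mulVec, Matrix.add_mulVec, Matrix.sub_mulVec,
          Matrix.smul_mulVec, Matrix.mulVec_mulVec, Matrix.mulVec_add, Matrix.mulVec_sub,
          Matrix.mulVec_smul, Matrix.sub_mul, Matrix.smul_mul, Matrix.one_mul, h3, smul_add,
          ← Matrix.mul_assoc]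
        abel
      exact (congrFun e b).symm

theorem analyticAt_sum_elim {ι κ : Type} [Fintype ι] [Fintype κ] {f : ℂ → ι → ℂ} {g : ℂ → κ → ℂ}
    {x : ℂ} (hf : AnalyticAt ℂ f x) (hg : AnalyticAt ℂ g x) :
    AnalyticAt ℂ (fun x => (Sum.elim (f x) (g x) : ι ⊕ κ → ℂ)) x := by
  rw [analyticAt_pi_iff] at hf hg ⊢
  rintro (a | b)
  · exact hf a
  · exact hg b

theorem tendsto_logBranch {b t : ℂ} {D W₀ : Set ℂ} {l : ℂ → ℂ} (hl : IsLogBranch b D W₀ l)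
    (hlt : AnalyticAt ℂ l t) : Tendsto l (𝓝[D] t) (𝓝[W₀] (l t)) :=
  tendsto_nhdsWithin_iff.2 ⟨hlt.continuousAt.continuousWithinAt,
    eventually_mem_nhdsWithin.mono fun _ hx => hl.mapsTo hx⟩

/-- The local form of the solution with upper half `u` at `t = t_{p+1} + e ^ τ`. -/
theorem exists_extendedSolution_localForm {D W₀ : Set ℂ} (hW₀ : IsOpen W₀) {l : ℂ → ℂ} {t : ℂ}
    (hl : IsLogBranch S.tLast D W₀ l) (hlt : AnalyticAt ℂ l t)
    (ht : S.tLast + Complex.exp (l t) = t)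
    (hb : l t ∈ closure W₀) (hcut : OffCut W₀ (l t) 0) (him : ∀ X ∈ W₀, (X - l t).im ≠ 0)
    {lam : ℂ} (hlam : NotInt lam) {u : ℂ → S.Idx → ℂ} (hu : DifferentiableOn ℂ u W₀)
    (h : ∀ X ∈ W₀, extOp S.opT S.opA (S.rho₁ + S.rho₂) (S.rho₁ * S.rho₂) u X = 0)
    {G : ℂ → S.Idx → ℂ} (hG : AnalyticAt ℂ G (l t))
    (huG : ∀ᶠ X in 𝓝[W₀] (l t), u X = powNear 0 (X - l t) lam • G X) :
    HasLocalForm D t (l t).im lam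
      (Sum.elim (Complex.exp (-(lam * l t)) • G (l t)) 0) (S.extendedSolution u l) := by
  obtain ⟨N, hN, hN0, hVN⟩ := exists_lowerPart_localForm (T := S.opT) (A := S.opA) hlam hW₀ hb hcut
    hu hG huG h
  obtain ⟨ψ, hψ, hψ0, hψτ, hψe⟩ := exists_powNear_add_exp (F := 𝓝[W₀] (l t)) (b := S.tLast)
    nhdsWithin_le_nhds (eventually_mem_nhdsWithin.mono him) lam
  rw [hasLocalForm_iff]
  refine ⟨fun x => Sum.elim ((ψ (l x))⁻¹ • G (l x)) ((ψ (l x))⁻¹ • (S.Pinv *ᵥ N (l x))),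
    ?_, ?_, ?_⟩
  · have h1 : AnalyticAt ℂ (fun X => (ψ X)⁻¹) (l t) := hψ.inv (hψ0 _)
    have h2 := analyticAt_mulVec S.Pinv hN
    exact analyticAt_sum_elim ((h1.fun_smul hG).comp hlt) ((h1.fun_smul h2).comp hlt)
  · simp [hψτ, hN0, ← Complex.exp_neg]
  · have key := (hψe.and (huG.and hVN))
    filter_upwards [(tendsto_logBranch hl hlt).eventually key, self_mem_nhdsWithin] with x hx hxD
    obtain ⟨e1, e2, e3⟩ := hx
    rw [hl.add_exp x hxD, ht] at e1
    funext s
    rcases s with a | b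
    · simp only [extendedSolution, Sum.elim_inl, e2, Pi.smul_apply, e1, smul_eq_mul]
      field_simp [hψ0]
    · simp only [extendedSolution, Sum.elim_inr, e3, Pi.smul_apply, e1, smul_eq_mul,
        Matrix.mulVec_smul]
      field_simp [hψ0]

end ExtendedOkuboSystem

/-! ### The underlying system in the logarithmic variable -/

namespace ExtendedOkuboSystem

open Set Filter

variable (S : ExtendedOkuboSystem)

/-- `f = e ^ ((1 + ρ₁ + ρ₂) X) T⁻¹ w (η₀ + e ^ (-X))`. -/
noncomputable def underlyingLog (η₀ : ℂ) (w : ℂ → S.Idx → ℂ) (X : ℂ) : S.Idx → ℂ := fun a =>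
  Complex.exp ((1 + (S.rho₁ + S.rho₂)) * X) * ((S.diffT a)⁻¹ * w (η₀ + Complex.exp (-X)) a)

theorem hasDerivAt_underlyingLog {η₀ : ℂ} {w : ℂ → S.Idx → ℂ} {w' : S.Idx → ℂ} {X : ℂ}
    (hw : HasDerivAt w w' (η₀ + Complex.exp (-X))) :
    HasDerivAt (S.underlyingLog η₀ w) (fun a =>
      (1 + (S.rho₁ + S.rho₂)) * S.underlyingLog η₀ w X a -
      Complex.exp ((1 + (S.rho₁ + S.rho₂)) * X) * Complex.exp (-X) * ((S.diffT a)⁻¹ * w' a)) X := by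
  have e1 : HasDerivAt (fun X => Complex.exp ((1 + (S.rho₁ + S.rho₂)) * X))
      (Complex.exp ((1 + (S.rho₁ + S.rho₂)) * X) * (1 + (S.rho₁ + S.rho₂))) X := by
    simpa using ((hasDerivAt_id X).const_mul (1 + (S.rho₁ + S.rho₂))).cexp
  have e2 : HasDerivAt (fun X => η₀ + Complex.exp (-X)) (-Complex.exp (-X)) X := by
    simpa using ((hasDerivAt_neg X).cexp).const_add η₀
  have e3 := hw.scomp X e2
  rw [hasDerivAt_pi] at e3 ⊢
  intro a
  refine (e1.fun_mul ((e3 a).const_mul (S.diffT a)⁻¹)).congr_deriv ?_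
  simp only [underlyingLog, Function.comp_apply, Pi.smul_apply, smul_eq_mul]
  ring

variable {S}

theorem pt'_sub (η₀ : ℂ) (a : S.Idx) : S.pt' η₀ a.1 = η₀ + (S.diffT a)⁻¹ := by
  simp [pt', diffT]

theorem underlyingEq_underlyingLog {η₀ : ℂ} {w : ℂ → S.Idx → ℂ}
    (hw : IsONFSolution (fun b : S.Idx => S.pt' η₀ b.1)
      ((0 : ℂ) • (1 : Matrix S.Idx S.Idx ℂ) + S.A) (S.cutPlane η₀) w) {X : ℂ}
    (hX : η₀ + Complex.exp (-X) ∈ S.cutPlane η₀) :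
    UnderlyingEq S.opT S.opA (S.rho₁ + S.rho₂) (S.underlyingLog η₀ w) X := by
  obtain ⟨w', h1, h2⟩ := hw _ hX
  rw [UnderlyingEq, (S.hasDerivAt_underlyingLog h1).deriv]
  rw [zero_smul, zero_add] at h2
  have hT : S.opT (S.underlyingLog η₀ w X) = Complex.exp ((1 + (S.rho₁ + S.rho₂)) * X) •
      w (η₀ + Complex.exp (-X)) := by
    funext a
    rw [opT_apply, underlyingLog, Pi.smul_apply, smul_eq_mul, mul_left_comm,
      mul_inv_cancel_left₀ (S.diffT_ne_zero a)]
  funext a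
  have h3 := congrFun h2 a
  rw [smul_one_sub_diagonal_mulVec, pt'_sub] at h3
  have h0 := S.diffT_ne_zero a
  rw [hT]
  simp only [Pi.smul_apply, Pi.sub_apply, Pi.add_apply, smul_eq_mul, map_smul, opT_apply,
    opA_apply, ← h3]
  simp only [underlyingLog]
  field_simp
  ring

theorem differentiableOn_underlyingLog {η₀ : ℂ} {w : ℂ → S.Idx → ℂ} {T : S.Idx → ℂ}
    {A : Matrix S.Idx S.Idx ℂ} (hw : IsONFSolution T A (S.cutPlane η₀) w) {W₀ : Set ℂ}
    (hW₀ : ∀ X ∈ W₀, η₀ + Complex.exp (-X) ∈ S.cutPlane η₀) :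
    DifferentiableOn ℂ (S.underlyingLog η₀ w) W₀ := by
  intro X hX
  obtain ⟨w', h1, -⟩ := hw _ (hW₀ X hX)
  exact (S.hasDerivAt_underlyingLog h1).differentiableAt.differentiableWithinAt

theorem analyticAt_underlyingLog {η₀ : ℂ} {w : ℂ → S.Idx → ℂ} {X : ℂ}
    (hw : AnalyticAt ℂ w (η₀ + Complex.exp (-X))) : AnalyticAt ℂ (S.underlyingLog η₀ w) X := by
  have h : ∀ᶠ Y in 𝓝 X, DifferentiableAt ℂ (S.underlyingLog η₀ w) Y := by
    have hc : Tendsto (fun X => η₀ + Complex.exp (-X)) (𝓝 X) (𝓝 (η₀ + Complex.exp (-X))) :=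
      Continuous.tendsto (by fun_prop) X
    filter_upwards [hc.eventually hw.eventually_analyticAt] with Y hY
    exact (S.hasDerivAt_underlyingLog hY.differentiableAt.hasDerivAt).differentiableAt
  exact Complex.analyticAt_iff_eventually_differentiableAt.2 h

theorem underlyingLog_sum_add {κ : Type*} [Fintype κ] (η₀ : ℂ) (C : κ → ℂ)
    (w : κ → ℂ → S.Idx → ℂ) (h : ℂ → S.Idx → ℂ) (X : ℂ) :
    S.underlyingLog η₀ (fun x => (∑ b, C b • w b x) + h x) X =
      (∑ b, C b • S.underlyingLog η₀ (w b) X) + S.underlyingLog η₀ h X := by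
  funext a
  simp only [underlyingLog, Pi.add_apply, Finset.sum_apply, Pi.smul_apply, smul_eq_mul, mul_add,
    Finset.mul_sum]
  congr 1
  exact Finset.sum_congr rfl fun b _ => by ring

variable (S)

/-- `log (t_i - t_{p+1})` with imaginary part `θ_i`. -/
noncomputable def logPt (i : Fin S.p) : ℂ :=
  Real.log ‖S.pt i - S.tLast‖ + S.ang i * Complex.I

@[simp]
theorem logPt_im (i : Fin S.p) : (S.logPt i).im = S.ang i := by simp [logPt]

theorem exp_logPt (i : Fin S.p) : Complex.exp (S.logPt i) = S.pt i - S.tLast := by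
  have h := S.theta_arg i
  rw [logPt, Complex.exp_add, ← Complex.ofReal_exp,
    Real.exp_log (norm_pos_iff.2 (sub_ne_zero.2 (S.pt_ne_tLast i)))]
  exact h.symm

theorem tLast_add_exp_logPt (i : Fin S.p) : S.tLast + Complex.exp (S.logPt i) = S.pt i := by
  rw [exp_logPt]; ring

theorem add_exp_neg_logPt (η₀ : ℂ) (i : Fin S.p) :
    η₀ + Complex.exp (-S.logPt i) = S.pt' η₀ i := by
  rw [Complex.exp_neg, exp_logPt, pt', one_div]

theorem factor_eq (a : S.Idx) : S.factor a =
    Complex.exp (Real.pi * Complex.I * S.lam a.1 a.2.1 +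
      (2 * S.lam a.1 a.2.1 - S.rho₁ - S.rho₂) * S.logPt a.1) := by
  rw [factor, powNear, Complex.exp_add]
  congr 3
  rw [← exp_logPt, ← Complex.exp_add]
  have e : S.logPt a.1 + -(S.ang a.1 * Complex.I) = (Real.log ‖S.pt a.1 - S.tLast‖ : ℂ) := by
    rw [logPt]; ring
  rw [e, ← Complex.ofReal_exp, ← Complex.ofReal_log (Real.exp_pos _).le, Real.log_exp, logPt]

theorem factor_ne_zero (a : S.Idx) : S.factor a ≠ 0 := by
  rw [factor_eq]; exact Complex.exp_ne_zero _

variable {S}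

theorem tendsto_add_exp_neg (η₀ : ℂ) (i : Fin S.p) {W₀ : Set ℂ}
    (hW₀ : ∀ X ∈ W₀, η₀ + Complex.exp (-X) ∈ S.cutPlane η₀) :
    Tendsto (fun X => η₀ + Complex.exp (-X)) (𝓝[W₀] (S.logPt i))
      (𝓝[S.cutPlane η₀] (S.pt' η₀ i)) := by
  refine tendsto_nhdsWithin_iff.2 ⟨?_, eventually_mem_nhdsWithin.mono hW₀⟩
  rw [← add_exp_neg_logPt]
  exact (Continuous.tendsto (by fun_prop) _).mono_left nhdsWithin_le_nhds

/-- The local form of `underlyingLog w`; the leading coefficient accounts for the factor in the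
connection formula. -/
theorem exists_underlyingLog_localForm {η₀ : ℂ} {a : S.Idx} {w : ℂ → S.Idx → ℂ}
    (hw : S.IsW η₀ 0 a w) {W₀ : Set ℂ}
    (hW₀ : ∀ X ∈ W₀, η₀ + Complex.exp (-X) ∈ S.cutPlane η₀)
    (him : ∀ X ∈ W₀, (X - S.logPt a.1).im ≠ 0) :
    ∃ g : ℂ → S.Idx → ℂ, AnalyticAt ℂ g (S.logPt a.1) ∧
      Complex.exp (-(S.lam a.1 a.2.1 * S.logPt a.1)) • g (S.logPt a.1) =
        (S.factor a)⁻¹ • Pi.single a 1 ∧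
      ∀ᶠ X in 𝓝[W₀] (S.logPt a.1), S.underlyingLog η₀ w X =
        powNear 0 (X - S.logPt a.1) (S.lam a.1 a.2.1) • g X := by
  obtain ⟨g, hg, hg1, hwg⟩ := hasLocalForm_iff.1 hw.2
  rw [zero_add] at hwg
  obtain ⟨ψ, hψ, hψ0, hψτ, hψe⟩ := exists_powNear_add_exp_neg (F := 𝓝[W₀] (S.logPt a.1))
    (b := η₀)
    nhdsWithin_le_nhds (eventually_mem_nhdsWithin.mono him) (S.lam a.1 a.2.1)
  rw [logPt_im, add_exp_neg_logPt] at hψe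
  refine ⟨fun X => ψ X • S.underlyingLog η₀ g X, hψ.fun_smul (analyticAt_underlyingLog
    (by rwa [add_exp_neg_logPt])), ?_, ?_⟩
  · funext b
    simp only [underlyingLog, add_exp_neg_logPt, hg1, Pi.smul_apply, smul_eq_mul]
    rcases eq_or_ne b a with rfl | hb
    · have hT : S.diffT b = Complex.exp (S.logPt b.1) := by rw [exp_logPt, diffT]
      rw [Pi.single_eq_same, hψτ, hT, factor_eq, ← Complex.exp_neg, ← Complex.exp_neg, mul_one,
        mul_one, ← Complex.exp_add, ← Complex.exp_add, ← Complex.exp_add]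
      congr 1
      ring
    · rw [Pi.single_eq_of_ne hb]
      simp
  · filter_upwards [hψe, (tendsto_add_exp_neg η₀ a.1 hW₀).eventually hwg] with X e1 e2
    funext b
    simp only [underlyingLog, e2, Pi.smul_apply, smul_eq_mul, e1]
    ring

end ExtendedOkuboSystem

/-! ### Transfer of solutions and of connection formulas -/

namespace ExtendedOkuboSystem

open Set Filter

variable {S : ExtendedOkuboSystem}

/-- The geometry for two neighbouring singular points `t_i`, `t_j`. The strip `W₀` is the image of
the sector `D` under the branch `l` of `log (x - t_{p+1})`, with `log (t_i - t_{p+1})` and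
`log (t_j - t_{p+1})` on its boundary, and `e ^ (-W₀)` lies in the cut plane. -/
structure StripSetting (S : ExtendedOkuboSystem) (η₀ : ℂ) (i j : Fin S.p) (D W₀ W : Set ℂ) (c : ℂ)
    (l : ℂ → ℂ) : Prop where
  isOpen_sector : IsOpen D
  isPreconnected_sector : IsPreconnected D
  pt_notMem : ∀ k, S.pt k ∉ D
  tLast_notMem : S.tLast ∉ D
  pt_mem_closure : ∀ k, k = i ∨ k = j → S.pt k ∈ closure D
  offCut_sector : ∀ k, k = i ∨ k = j → OffCut D (S.pt k) (S.ang k)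
  conv : ∀ k, k = i ∨ k = j → ConvSetting W₀ W wideStrip c (S.logPt k)
  im_ne : ∀ k, k = i ∨ k = j → ∀ X ∈ W₀, (X - S.logPt k).im ≠ 0
  mem_cutPlane : ∀ X ∈ W₀, η₀ + Complex.exp (-X) ∈ S.cutPlane η₀
  isLogBranch : IsLogBranch S.tLast D W₀ l
  analyticAt_log : ∀ k, k = i ∨ k = j → AnalyticAt ℂ l (S.pt k)
  log_pt : ∀ k, k = i ∨ k = j → l (S.pt k) = S.logPt k

namespace StripSetting

variable {η₀ c : ℂ} {i j : Fin S.p} {D W₀ W : Set ℂ} {l : ℂ → ℂ}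

/-- A connection formula for `u` in the logarithmic variable gives one for the solutions of the
rank `2n` system with upper halves `u`. -/
theorem extendedSolution_connection (hs : StripSetting S η₀ i j D W₀ W c l) {k : Fin S.p}
    (hk : k = i ∨ k = j) {κ : Type*} [Fintype κ] {C : κ → ℂ} {u H : ℂ → S.Idx → ℂ}
    {v : κ → ℂ → S.Idx → ℂ} (hv : ∀ b, DifferentiableOn ℂ (v b) W₀)
    (hH : AnalyticAt ℂ H (S.logPt k))
    (h : ∀ᶠ X in 𝓝[W₀] S.logPt k, u X = (∑ b, C b • v b X) + H X) :
    ∃ F : ℂ → S.Idx ⊕ S.Idx' → ℂ, AnalyticAt ℂ F (S.pt k) ∧ ∀ᶠ x in 𝓝[D] S.pt k,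
      S.extendedSolution u l x = (∑ b, C b • S.extendedSolution (v b) l x) + F x := by
  have hlk := hs.analyticAt_log k hk
  have hlt := hs.log_pt k hk
  refine ⟨S.extendedSolution H l, ?_, ?_⟩
  · rw [← hlt] at hH
    exact analyticAt_sum_elim (hH.comp hlk)
      ((analyticAt_mulVec S.Pinv (AnalyticAt.lowerPart hH)).comp hlk)
  · have hW₀ := (hs.conv k hk).isOpen_inner
    have ht := tendsto_logBranch hs.isLogBranch hlk
    rw [hlt] at ht
    filter_upwards [ht.eventually (eventually_nhds_of_eventually_nhdsWithin hW₀ h),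
      ht.eventually (nhdsWithin_le_nhds hH.eventually_analyticAt)] with x hx hHx
    have e : lowerPart S.opT S.opA u (l x) = (∑ b, C b • lowerPart S.opT S.opA (v b) (l x)) +
        lowerPart S.opT S.opA H (l x) := by
      rw [lowerPart_congr hx.2]
      exact lowerPart_sum_add (fun b => (hv b).differentiableAt (hW₀.mem_nhds hx.1))
        hHx.differentiableAt
    funext s
    rcases s with a | b
    · simp [extendedSolution, hx.2.self_of_nhds]
    · simp [extendedSolution, e, Matrix.mulVec_add, Matrix.mulVec_sum, Matrix.mulVec_smul]

/-- The solutions of the rank `2n` system obtained from the solutions of the underlying system have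
the prescribed local forms, and their connection coefficients are those of the underlying system
up to the factors. -/
theorem exists_solutions (hs : StripSetting S η₀ i j D W₀ W c l) (hS : S.Generic)
    {w : S.Idx → ℂ → S.Idx → ℂ} (hw : ∀ a, S.IsW η₀ 0 a (w a)) :
    ∃ U : S.Idx → ℂ → S.Idx ⊕ S.Idx' → ℂ,
      (∀ a : S.Idx, a.1 = i ∨ a.1 = j → S.IsU D a (U a)) ∧
      ∀ k m, k = i ∨ k = j → m = i ∨ m = j → ∀ (a : S.Block k) (C : S.Block m → ℂ),
        IsConnectionFormula (S.cutPlane η₀) (S.pt' η₀ m) (w ⟨k, a⟩) (fun b => w ⟨m, b⟩) C →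
        IsConnectionFormula D (S.pt m) (U ⟨k, a⟩) (fun b => U ⟨m, b⟩)
          (fun b => S.factor ⟨k, a⟩ / S.factor ⟨m, b⟩ * C b) := by
  set σ := S.rho₁ + S.rho₂ with hσ
  set p := S.rho₁ * S.rho₂ with hp
  obtain ⟨κ, hκd, hκ0, hκe⟩ := exists_kernel σ p (-(1 + σ + p))
  have hκ : IsKernel wideStrip σ p κ := ⟨hκd, hκ0, hκe⟩
  have hi := hs.conv i (Or.inl rfl)
  set f : S.Idx → ℂ → S.Idx → ℂ := fun a => S.underlyingLog η₀ (w a) with hf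
  have hfd : ∀ a, DifferentiableOn ℂ (f a) W₀ := fun a =>
    differentiableOn_underlyingLog (hw a).1 hs.mem_cutPlane
  have hR : ∀ a : S.Idx, ∃ R : ℂ → S.Idx → ℂ, a.1 = i ∨ a.1 = j →
      DifferentiableOn ℂ R W ∧ HasLocalForm D (S.pt a.1) (S.ang a.1) (S.lam a.1 a.2.1)
        (Sum.elim ((S.factor a)⁻¹ • Pi.single a 1) 0)
        (S.extendedSolution (fun X => f a X + segConv κ (f a) c X + R X) l) ∧
      ∀ X ∈ W₀, extOp S.opT S.opA σ p (fun X => f a X + segConv κ (f a) c X + R X) X = 0 := by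
    intro a
    by_cases ha : a.1 = i ∨ a.1 = j
    swap
    · exact ⟨0, fun h => absurd h ha⟩
    have hc := hs.conv a.1 ha
    have hlam := hS.lam_notInt a.1 a.2.1
    obtain ⟨g, hg, hg1, hfg⟩ := exists_underlyingLog_localForm (hw a) hs.mem_cutPlane
      (hs.im_ne a.1 ha)
    obtain ⟨R, G, hR, hG, hGg, huG, h0⟩ := hc.exists_transform hκ hlam (hfd a)
      (fun X hX => underlyingEq_underlyingLog (hw a).1 (hs.mem_cutPlane X hX)) hg hfg
    refine ⟨R, fun _ => ⟨hR, ?_, h0⟩⟩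
    have hlt := hs.log_pt a.1 ha
    have hud : DifferentiableOn ℂ (fun X => f a X + segConv κ (f a) c X + R X) W₀ := by
      refine ((hfd a).fun_add fun X hX => ?_).fun_add (hR.mono hc.subset)
      exact (hasDerivAt_segConv hc.isOpen_inner hc.starConvex hc.segDiffs
        (fun Z hZ => (hκd.differentiableAt (hc.isOpen_kernel.mem_nhds hZ)).hasDerivAt)
        (hκd.deriv hc.isOpen_kernel).continuousOn (hfd a)
        hX).differentiableAt.differentiableWithinAt
    have key := S.exists_extendedSolution_localForm hc.isOpen_inner hs.isLogBranch
      (hs.analyticAt_log a.1 ha) (by rw [hlt, tLast_add_exp_logPt])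
      (by rw [hlt]; exact hc.mem_closure) (by rw [hlt]; exact hc.offCut)
      (by rw [hlt]; exact hs.im_ne a.1 ha) hlam hud h0 (G := G) (by rwa [hlt])
      (by rwa [hlt])
    rwa [hlt, logPt_im, hGg, hg1] at key
  choose R hR using hR
  set u : S.Idx → ℂ → S.Idx → ℂ := fun a X => f a X + segConv κ (f a) c X + R a X with hu
  have hud : ∀ a : S.Idx, a.1 = i ∨ a.1 = j → DifferentiableOn ℂ (u a) W₀ := by
    intro a ha
    refine ((hfd a).fun_add fun X hX => ?_).fun_add ((hR a ha).1.mono hi.subset)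
    exact (hasDerivAt_segConv hi.isOpen_inner hi.starConvex hi.segDiffs
      (fun Z hZ => (hκd.differentiableAt (hi.isOpen_kernel.mem_nhds hZ)).hasDerivAt)
      (hκd.deriv hi.isOpen_kernel).continuousOn (hfd a)
        hX).differentiableAt.differentiableWithinAt
  refine ⟨fun a x => S.factor a • S.extendedSolution (u a) l x, ?_, ?_⟩
  · intro a ha
    obtain ⟨-, h1, h2⟩ := hR a ha
    constructor
    · intro x hx
      obtain ⟨u', e1, e2⟩ := S.isONFSolution_extendedSolution hi.isOpen_inner hs.isLogBranch
        (hud a ha) h2 x hx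
      refine ⟨S.factor a • u', e1.fun_const_smul _, ?_⟩
      rw [Matrix.mulVec_smul, Matrix.mulVec_smul, e2]
    · obtain ⟨g, hg, hg1, hgu⟩ := hasLocalForm_iff.1 h1
      refine hasLocalForm_iff.2 ⟨fun x => S.factor a • g x, hg.fun_const_smul, ?_, ?_⟩
      · funext s
        simp only [hg1]
        rcases s with b | b
        · simp [Pi.single_apply, S.factor_ne_zero a]
        · simp
      · filter_upwards [hgu] with x hx
        rw [hx, smul_comm]
  · rintro k m hk hm a C ⟨h, hh, hC⟩
    have hcm := hs.conv m hm
    have hfC : ∀ᶠ X in 𝓝[W₀] S.logPt m, f ⟨k, a⟩ X =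
        (∑ b, C b • f ⟨m, b⟩ X) + S.underlyingLog η₀ h X := by
      filter_upwards [(tendsto_add_exp_neg η₀ m hs.mem_cutPlane).eventually hC] with X hX
      rw [← underlyingLog_sum_add]
      funext s
      simp only [hf, underlyingLog, hX]
    obtain ⟨H, hH, hH'⟩ := hcm.exists_analyticAt_transform_sub hκd (hfd _) (fun b => hfd ⟨m, b⟩)
      (hR ⟨k, a⟩ hk).1 (fun b => (hR ⟨m, b⟩ hm).1)
      (analyticAt_underlyingLog (by rwa [add_exp_neg_logPt])) hfC
    obtain ⟨F, hF, hF'⟩ := hs.extendedSolution_connection hm (u := u ⟨k, a⟩)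
      (fun b => hud ⟨m, b⟩ hm) hH hH'
    refine ⟨fun x => S.factor ⟨k, a⟩ • F x, hF.fun_const_smul, ?_⟩
    filter_upwards [hF'] with x hx
    simp only [hx, smul_add, Finset.smul_sum, smul_smul]
    congr 1
    refine Finset.sum_congr rfl fun b _ => ?_
    congr 1
    field_simp [S.factor_ne_zero]

end StripSetting

end ExtendedOkuboSystem

/-! ### Geometry of the sectors -/

theorem exp_mem_slitPlane_of_abs_im_lt {z : ℂ} (hz : |z.im| < Real.pi) :
    Complex.exp z ∈ Complex.slitPlane := by
  rw [abs_lt] at hz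
  rw [Complex.mem_slitPlane_iff_arg]
  refine ⟨?_, Complex.exp_ne_zero _⟩
  rw [← Complex.log_im, Complex.log_exp hz.1 hz.2.le]
  exact hz.2.ne

/-- The branch of `log (x - b)` with imaginary part in `(φ - π, φ + π]`. -/
noncomputable def logBranch (b : ℂ) (φ : ℝ) (x : ℂ) : ℂ :=
  Complex.log ((x - b) * Complex.exp (-(φ * Complex.I))) + φ * Complex.I

theorem logBranch_add_exp (b : ℂ) {φ : ℝ} {X : ℂ} (hX : |X.im - φ| < Real.pi) :
    logBranch b φ (b + Complex.exp X) = X := by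
  rw [abs_lt] at hX
  rw [logBranch, add_sub_cancel_left, ← Complex.exp_add, Complex.log_exp]
  · ring
  · simpa using hX.1
  · simpa using hX.2.le

theorem analyticAt_logBranch (b : ℂ) {φ : ℝ} {X : ℂ} (hX : |X.im - φ| < Real.pi) :
    AnalyticAt ℂ (logBranch b φ) (b + Complex.exp X) := by
  have h : (b + Complex.exp X - b) * Complex.exp (-(φ * Complex.I)) ∈ Complex.slitPlane := by
    rw [add_sub_cancel_left, ← Complex.exp_add]
    exact exp_mem_slitPlane_of_abs_im_lt (by simpa [sub_eq_add_neg] using hX)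
  have h1 : AnalyticAt ℂ (fun x => Complex.log ((x - b) * Complex.exp (-(φ * Complex.I))))
      (b + Complex.exp X) := AnalyticAt.clog (by fun_prop) h
  exact h1.add analyticAt_const

theorem hasDerivAt_logBranch (b : ℂ) {φ : ℝ} {X : ℂ} (hX : |X.im - φ| < Real.pi) :
    HasDerivAt (logBranch b φ) (Complex.exp (-X)) (b + Complex.exp X) := by
  have h : (b + Complex.exp X - b) * Complex.exp (-(φ * Complex.I)) ∈ Complex.slitPlane := by
    rw [add_sub_cancel_left, ← Complex.exp_add]
    exact exp_mem_slitPlane_of_abs_im_lt (by simpa [sub_eq_add_neg] using hX)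
  refine (((((hasDerivAt_id (b + Complex.exp X)).sub_const b).mul_const
    (Complex.exp (-(φ * Complex.I)))).clog h).add_const (φ * Complex.I)).congr_deriv ?_
  rw [id, add_sub_cancel_left, one_mul, Complex.exp_neg X]
  field_simp

/-- The open horizontal strip `α < Im X < β`. -/
def openStrip (α β : ℝ) : Set ℂ := Complex.im ⁻¹' Set.Ioo α β

theorem isOpen_openStrip (α β : ℝ) : IsOpen (openStrip α β) :=
  isOpen_Ioo.preimage Complex.continuous_im

theorem convex_openStrip (α β : ℝ) : Convex ℝ (openStrip α β) :=
  (convex_Ioo α β).linear_preimage Complex.imLm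

namespace ExtendedOkuboSystem

open Set Filter

variable (S : ExtendedOkuboSystem)

theorem sector_eq_image (α β : ℝ) :
    S.sector α β = (fun X => S.tLast + Complex.exp X) '' openStrip α β := by
  ext x
  constructor
  · rintro ⟨s, φ, hs, h1, h2, rfl⟩
    refine ⟨Real.log s + φ * Complex.I, by simp [openStrip, h1, h2], ?_⟩
    simp only
    rw [Complex.exp_add, ← Complex.ofReal_exp, Real.exp_log hs]
  · rintro ⟨X, hX, rfl⟩
    refine ⟨Real.exp X.re, X.im, Real.exp_pos _, hX.1, hX.2, ?_⟩
    simp only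
    rw [Complex.ofReal_exp, ← Complex.exp_add, Complex.re_add_im]

/-- A bound on `δ` for which neighbouring sectors overlap. -/
theorem exists_delta : ∃ δ₀ : ℝ, 0 < δ₀ ∧ ∀ δ : ℝ, 0 < δ → δ < δ₀ →
    δ < Real.pi ∧ ∀ i : Fin S.p, 2 * δ < S.angNext i - S.ang i := by
  have h : ∀ᶠ δ : ℝ in 𝓝[>] 0, δ < Real.pi ∧ ∀ i : Fin S.p, 2 * δ < S.angNext i - S.ang i := by
    refine Filter.Eventually.and ?_ (eventually_all.2 fun i => ?_)
    · exact nhdsWithin_le_nhds (eventually_lt_nhds Real.pi_pos)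
    · have hi : 0 < S.angNext i - S.ang i :=
        sub_pos.2 (S.theta_strictMono (Fin.castSucc_lt_succ (i := i)))
      have : Tendsto (fun δ : ℝ => 2 * δ) (𝓝 0) (𝓝 (2 * 0)) := Continuous.tendsto (by fun_prop) 0
      exact nhdsWithin_le_nhds (this.eventually_lt_const (by simpa using hi))
  obtain ⟨δ₀, h0, h1⟩ := mem_nhdsGT_iff_exists_Ioo_subset.1 h
  exact ⟨δ₀, h0, fun δ hδ hδ' => h1 ⟨hδ, hδ'⟩⟩

variable {S}

theorem angNext_eq {i j : Fin S.p} (hij : (i : ℕ) + 1 = j) : S.angNext i = S.ang j := by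
  unfold angNext ang
  congr 1
  exact Fin.ext hij

theorem angPrev_eq {i j : Fin S.p} (hij : (i : ℕ) + 1 = j) : S.angPrev j = S.ang i := by
  unfold angPrev ang
  rw [if_neg (by omega)]
  congr 1
  exact Fin.ext (by simp; omega)

theorem theta_zero_le (i : Fin (S.p + 1)) : S.theta 0 ≤ S.theta i :=
  S.theta_strictMono.monotone (Fin.zero_le i)

theorem ang_lt_last (i : Fin S.p) : S.ang i < S.theta (Fin.last S.p) :=
  S.theta_strictMono (Fin.castSucc_lt_last i)

theorem ang_lt_ang {i j : Fin S.p} (hij : (i : ℕ) + 1 = j) : S.ang i < S.ang j :=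
  S.theta_strictMono (Fin.lt_def.2 (by simp; omega))

theorem ang_lt_ang_add {i j : Fin S.p} : S.ang j < S.ang i + 2 * Real.pi := by
  have h1 := S.theta_last_lt
  have h2 := S.ang_lt_last j
  have h3 := S.theta_zero_le i.castSucc
  have h4 : S.ang i = S.theta i.castSucc := rfl
  linarith

theorem sectorPlus_union_sectorMinus {i j : Fin S.p} (hij : (i : ℕ) + 1 = j) {δ : ℝ} (hδ : 0 < δ)
    (hδπ : δ < Real.pi) (hδi : 2 * δ < S.angNext i - S.ang i) :
    S.sectorPlus δ i ∪ S.sectorMinus δ j = S.sector (S.ang i) (S.ang j) := by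
  rw [angNext_eq hij] at hδi
  have hgap : S.ang j < S.ang i + 2 * Real.pi := ang_lt_ang_add
  rw [sectorPlus, sectorMinus, angNext_eq hij, angPrev_eq hij]
  simp only [sector_eq_image, ← image_union]
  congr 1
  unfold openStrip
  rw [← preimage_union]
  congr 1
  ext φ
  simp only [mem_union, mem_Ioo, lt_min_iff, max_lt_iff]
  constructor
  · rintro (h | h)
    · exact ⟨h.1, by linarith [h.2.1]⟩
    · exact ⟨by linarith [h.1.1], h.2⟩
  · rintro ⟨h1, h2⟩
    by_cases h : φ < S.ang j - δ ∧ φ < S.ang i + Real.pi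
    · exact Or.inl ⟨h1, h⟩
    · rw [not_and_or, not_lt, not_lt] at h
      refine Or.inr ⟨?_, h2⟩
      rcases h with h | h <;> constructor <;> linarith

/-- Between two neighbouring angles there is no other angle, modulo `2π`. -/
theorem exp_ne_exp_of_mem_openStrip {i j m : Fin S.p} (hij : (i : ℕ) + 1 = j) {X Y : ℂ}
    (hX : X ∈ openStrip (S.ang i) (S.ang j)) (hY : Y.im = S.ang m) :
    Complex.exp X ≠ Complex.exp Y := by
  intro h
  obtain ⟨n, hn⟩ := Complex.exp_eq_exp_iff_exists_int.1 h
  have him : X.im = S.ang m + n * (2 * Real.pi) := by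
    rw [hn, ← hY]; simp
  obtain ⟨h1, h2⟩ := hX
  rw [him] at h1 h2
  have hpi := Real.two_pi_pos
  have b1 : S.ang m < S.ang i + 2 * Real.pi := ang_lt_ang_add
  have b2 : S.ang j < S.ang m + 2 * Real.pi := ang_lt_ang_add
  have n1 : (n : ℝ) < 1 := by
    by_contra hc; push Not at hc; nlinarith
  have n2 : (-1 : ℝ) < n := by
    by_contra hc; push Not at hc; nlinarith
  have n0 : n = 0 := by
    have u1 : n < 1 := by exact_mod_cast n1
    have u2 : -1 < n := by exact_mod_cast n2
    omega
  rw [n0, Int.cast_zero, zero_mul, add_zero] at h1 h2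
  have l1 : i.castSucc < m.castSucc := S.theta_strictMono.lt_iff_lt.1 h1
  have l2 : m.castSucc < j.castSucc := S.theta_strictMono.lt_iff_lt.1 h2
  rw [Fin.lt_def] at l1 l2
  simp only [Fin.val_castSucc] at l1 l2
  omega

theorem exists_stripSetting (η₀ : ℂ) {i j : Fin S.p} (hij : (i : ℕ) + 1 = j) :
    ∃ W₀ W c l, StripSetting S η₀ i j (S.sector (S.ang i) (S.ang j)) W₀ W c l := by
  set α := S.ang i with hα
  set β := S.ang j with hβ
  have hαβ : α < β := ang_lt_ang hij
  have hgap : β < α + 2 * Real.pi := ang_lt_ang_add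
  set φ : ℝ := (α + β) / 2 with hφ
  set ε : ℝ := (α + 2 * Real.pi - β) / 4 with hε
  have hε0 : 0 < ε := by rw [hε]; linarith
  have hmem : ∀ k : Fin S.p, k = i ∨ k = j → (S.logPt k).im = α ∨ (S.logPt k).im = β := by
    rintro k (rfl | rfl) <;> simp [hα, hβ]
  have hφpt : ∀ k : Fin S.p, k = i ∨ k = j → |(S.logPt k).im - φ| < Real.pi := by
    intro k hk
    rw [abs_lt]
    rcases hmem k hk with h | h <;> rw [h, hφ] <;> constructor <;> linarith
  have hφX : ∀ X ∈ openStrip α β, |X.im - φ| < Real.pi := by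
    rintro X ⟨h1, h2⟩
    rw [abs_lt, hφ]
    constructor <;> linarith
  have him : ∀ k : Fin S.p, k = i ∨ k = j → ∀ X ∈ openStrip α β, (X - S.logPt k).im ≠ 0 := by
    rintro k hk X ⟨h1, h2⟩
    rw [Complex.sub_im, sub_ne_zero]
    rcases hmem k hk with h | h <;> rw [h]
    · exact h1.ne'
    · exact h2.ne
  have hcl : ∀ k : Fin S.p, k = i ∨ k = j → S.logPt k ∈ closure (openStrip α β) := by
    intro k hk
    rw [openStrip, Complex.closure_preimage_im, closure_Ioo hαβ.ne, mem_preimage]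
    rcases hmem k hk with h | h <;> rw [h]
    · exact left_mem_Icc.2 hαβ.le
    · exact right_mem_Icc.2 hαβ.le
  have hl : IsLogBranch S.tLast (S.sector α β) (openStrip α β) (logBranch S.tLast φ) := by
    rw [sector_eq_image]
    refine ⟨?_, ?_, ?_⟩ <;> rintro _ ⟨X, hX, rfl⟩ <;> simp only
    · rwa [logBranch_add_exp _ (hφX X hX)]
    · rw [logBranch_add_exp _ (hφX X hX)]
    · rw [logBranch_add_exp _ (hφX X hX)]
      exact hasDerivAt_logBranch _ (hφX X hX)
  have han : ∀ k, k = i ∨ k = j → AnalyticAt ℂ (logBranch S.tLast φ) (S.pt k) := by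
    intro k hk
    rw [← tLast_add_exp_logPt]
    exact analyticAt_logBranch _ (hφpt k hk)
  have hlpt : ∀ k, k = i ∨ k = j → logBranch S.tLast φ (S.pt k) = S.logPt k := by
    intro k hk
    rw [← tLast_add_exp_logPt]
    exact logBranch_add_exp _ (hφpt k hk)
  refine ⟨openStrip α β, openStrip (α - ε) (β + ε), φ * Complex.I, logBranch S.tLast φ, ?_⟩
  refine ⟨?_, ?_, ?_, ?_, ?_, ?_, ?_, him, ?_, hl, han, hlpt⟩
  · rw [sector_eq_image]
    exact ((Homeomorph.addLeft S.tLast).isOpenMap.comp Complex.isOpenMap_exp) _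
      (isOpen_openStrip α β)
  · rw [sector_eq_image]
    exact (convex_openStrip α β).isPreconnected.image _ (by fun_prop)
  · intro k hk
    rw [sector_eq_image] at hk
    obtain ⟨X, hX, hXk⟩ := hk
    rw [← tLast_add_exp_logPt] at hXk
    exact exp_ne_exp_of_mem_openStrip hij hX (logPt_im S k) (add_left_cancel hXk)
  · intro h
    rw [sector_eq_image] at h
    obtain ⟨X, hX, hXk⟩ := h
    exact Complex.exp_ne_zero X (add_eq_left.1 hXk)
  · intro k hk
    rw [sector_eq_image, ← tLast_add_exp_logPt]
    exact map_mem_closure (f := fun X => S.tLast + Complex.exp X) (by fun_prop) (hcl k hk)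
      fun X hX => mem_image_of_mem _ hX
  · intro k hk
    have ht := tendsto_logBranch hl (han k hk)
    rw [hlpt k hk] at ht
    have hpi : ∀ᶠ X in 𝓝 (S.logPt k), |(X - S.logPt k).im| < Real.pi := by
      have : Tendsto (fun X : ℂ => |(X - S.logPt k).im|) (𝓝 (S.logPt k))
          (𝓝 |(S.logPt k - S.logPt k).im|) := Continuous.tendsto (by fun_prop) _
      exact this.eventually_lt_const (by simp [Real.pi_pos])
    filter_upwards [self_mem_nhdsWithin, ht.eventually (nhdsWithin_le_nhds hpi)] with x hx h1
    have h2 := im_mul_im_exp_sub_one_pos (him k hk _ (hl.mapsTo hx)) h1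
    have h3 : (x - S.pt k) * Complex.exp (-(S.ang k * Complex.I)) =
        (Real.exp (S.logPt k).re : ℂ) *
          (Complex.exp (logBranch S.tLast φ x - S.logPt k) - 1) := by
      have e : Complex.exp (S.logPt k) * Complex.exp (-(S.ang k * Complex.I)) =
          Real.exp (S.logPt k).re := by
        rw [← Complex.exp_add, Complex.ofReal_exp, ← logPt_im]
        congr 1
        linear_combination -(Complex.re_add_im (S.logPt k))
      rw [← e, Complex.exp_sub]
      nth_rewrite 1 [← hl.add_exp x hx, ← tLast_add_exp_logPt]
      field_simp
      ring
    rw [h3, Complex.mem_slitPlane_iff]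
    right
    rw [Complex.im_ofReal_mul]
    exact mul_ne_zero (Real.exp_pos _).ne' (right_ne_zero_of_mul h2.ne')
  · intro k hk
    refine ⟨isOpen_openStrip _ _, convex_openStrip _ _, isOpen_openStrip _ _, isOpen_wideStrip,
      fun X hX => ⟨by linarith [hX.1], by linarith [hX.2]⟩, ?_, ?_, ?_, hcl k hk, ?_⟩
    · rintro X ⟨h1, h2⟩ Y ⟨h3, h4⟩
      change |(X - Y).im| < 2 * Real.pi
      rw [Complex.sub_im, abs_lt]
      constructor <;> linarith
    · constructor <;> simp [hφ] <;> linarith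
    · change _ ∈ Ioo _ _
      rcases hmem k hk with h | h <;> rw [h] <;> constructor <;> linarith
    · intro X hX
      rw [Complex.mem_slitPlane_iff]
      right
      simpa using him k hk X hX
  · intro X hX m s hs h
    have hs0 : 0 < s := by linarith
    have h1 : Complex.exp (-X) = s * Complex.exp (-S.logPt m) := by
      rw [add_right_inj] at h
      rw [h, ← add_exp_neg_logPt]; ring
    have h2 : Complex.exp X = Complex.exp (S.logPt m - Real.log s) := by
      rw [Complex.exp_neg, Complex.exp_neg] at h1
      rw [Complex.exp_sub, ← Complex.ofReal_exp, Real.exp_log hs0, ← inv_inv (Complex.exp X), h1,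
        mul_inv, inv_inv]
      field_simp
    exact exp_ne_exp_of_mem_openStrip hij hX (m := m) (by simp) h2

end ExtendedOkuboSystem

/-! ### Uniqueness of connection coefficients -/

section Independence

open Set Filter

/-- Functions with independent leading coefficients and non-integral exponents, distinct modulo
`ℤ`, are independent modulo holomorphic functions. -/
theorem eq_zero_of_sum_localForm_add {ι : Type} [Fintype ι] [DecidableEq ι] {κ : Type} [Fintype κ]
    {ρ : κ → Type} [∀ k, Fintype (ρ k)] {D : Set ℂ} (hDo : IsOpen D) {b : ℂ} (hb : b ∈ closure D)
    {c : ℝ} (hcut : OffCut D b c) {μ : κ → ℂ} (hμ : ∀ k h, k ≠ h → NotInt (μ k - μ h))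
    (hμ0 : ∀ k, NotInt (μ k)) {pos : (Σ k, ρ k) → ι} (hpos : Function.Injective pos)
    {v : (Σ k, ρ k) → ℂ → ι → ℂ}
    (hv : ∀ a, HasLocalForm D b c (μ a.1) (Pi.single (pos a) 1) (v a)) {C : (Σ k, ρ k) → ℂ}
    {f : ℂ → ι → ℂ} (hf : AnalyticAt ℂ f b)
    (h : ∀ᶠ x in 𝓝[D] b, (∑ a, C a • v a x) + f x = 0) :
    C = 0 ∧ ∀ᶠ x in 𝓝 b, f x = 0 := by
  choose g hg hg1 hgv using fun a => hasLocalForm_iff.1 (hv a)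
  obtain ⟨h1, h2⟩ := powNear_independent' hDo hb hcut hμ hμ0
    (g := fun k x => ∑ l, C ⟨k, l⟩ • g ⟨k, l⟩ x)
    (fun k => Finset.analyticAt_fun_sum _ fun l _ => (hg ⟨k, l⟩).fun_const_smul) hf (by
      filter_upwards [h, eventually_all.2 hgv] with x hx hxv
      rw [← hx, Fintype.sum_sigma]
      congr 1
      refine Finset.sum_congr rfl fun k _ => ?_
      rw [Finset.smul_sum]
      refine Finset.sum_congr rfl fun l _ => ?_
      rw [hxv, smul_comm])
  refine ⟨?_, h2⟩
  funext a
  obtain ⟨k, l⟩ := a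
  have h3 := congrFun (h1 k).self_of_nhds (pos ⟨k, l⟩)
  simp only [hg1, Finset.sum_apply, Pi.smul_apply, Pi.zero_apply, smul_eq_mul] at h3
  rw [Finset.sum_eq_single l] at h3
  · simpa using h3
  · intro l' _ hl'
    rw [Pi.single_eq_of_ne, mul_zero]
    intro he
    have := hpos he
    simp only [Sigma.mk.injEq, heq_eq_eq, true_and] at this
    exact hl' this.symm
  · simp

theorem IsConnectionFormula.unique {ι : Type} [Fintype ι] [DecidableEq ι] {κ : Type} [Fintype κ]
    {ρ : κ → Type} [∀ k, Fintype (ρ k)] {D : Set ℂ} (hDo : IsOpen D) {b : ℂ} (hb : b ∈ closure D)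
    {c : ℝ} (hcut : OffCut D b c) {μ : κ → ℂ} (hμ : ∀ k h, k ≠ h → NotInt (μ k - μ h))
    (hμ0 : ∀ k, NotInt (μ k)) {pos : (Σ k, ρ k) → ι} (hpos : Function.Injective pos)
    {v : (Σ k, ρ k) → ℂ → ι → ℂ}
    (hv : ∀ a, HasLocalForm D b c (μ a.1) (Pi.single (pos a) 1) (v a)) {u : ℂ → ι → ℂ}
    {C C' : (Σ k, ρ k) → ℂ} (hC : IsConnectionFormula D b u v C)
    (hC' : IsConnectionFormula D b u v C') : C = C' := by
  obtain ⟨f, hf, hfC⟩ := hC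
  obtain ⟨f', hf', hfC'⟩ := hC'
  refine sub_eq_zero.1 (eq_zero_of_sum_localForm_add hDo hb hcut hμ hμ0 hpos hv (C := C - C')
    (hf.fun_sub hf') ?_).1
  filter_upwards [hfC, hfC'] with x h1 h2
  rw [h1] at h2
  simp only [Pi.sub_apply, sub_smul, Finset.sum_sub_distrib]
  linear_combination (norm := module) h2

end Independence

/-! ### Solutions on the cut plane -/

namespace ExtendedOkuboSystem

open Set Filter

variable (S : ExtendedOkuboSystem)

/-- The plane cut along the single ray through `t'_i`. -/
def slitAt (η₀ : ℂ) (i : Fin S.p) : Set ℂ :=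
  {z : ℂ | (z - S.pt' η₀ i) * (-(S.pt i - S.tLast)⁻¹)⁻¹ ∈ Complex.slitPlane}

variable {S}

theorem mem_slitAt_iff {η₀ : ℂ} {i : Fin S.p} {z : ℂ} :
    z ∈ S.slitAt η₀ i ↔ 1 - (z - η₀) * (S.pt i - S.tLast) ∈ Complex.slitPlane := by
  have h := sub_ne_zero.2 (S.pt_ne_tLast i)
  have e : (z - S.pt' η₀ i) * (-(S.pt i - S.tLast)⁻¹)⁻¹ =
      1 - (z - η₀) * (S.pt i - S.tLast) := by
    rw [pt', inv_neg, inv_inv]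
    field_simp
    ring
  rw [slitAt, mem_ofPred_eq, e]

theorem cutPlane_eq (η₀ : ℂ) : S.cutPlane η₀ = ⋂ i, S.slitAt η₀ i := by
  ext z
  rw [mem_iInter]
  refine forall_congr' fun i => ?_
  have h := sub_ne_zero.2 (S.pt_ne_tLast i)
  rw [mem_slitAt_iff, Complex.mem_slitPlane_iff]
  constructor
  · intro hz
    by_contra hc
    push Not at hc
    obtain ⟨h1, h2⟩ := hc
    set y := (z - η₀) * (S.pt i - S.tLast) with hy
    have hy' : y = (y.re : ℂ) := by
      apply Complex.ext
      · simp
      · simpa using h2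
    refine hz y.re (by simpa using h1) ?_
    rw [← hy', hy, pt']
    field_simp
    ring
  · rintro hz s hs rfl
    have e : 1 - (η₀ + (S.pt' η₀ i - η₀) * s - η₀) * (S.pt i - S.tLast) = ((1 - s : ℝ) : ℂ) := by
      rw [pt']
      push_cast
      field_simp
      ring
    rw [e, Complex.ofReal_re, Complex.ofReal_im] at hz
    rcases hz with h1 | h1
    · linarith
    · exact h1 rfl

theorem starConvex_slitAt (η₀ : ℂ) (i : Fin S.p) : StarConvex ℝ η₀ (S.slitAt η₀ i) := by
  have h := inv_ne_zero (sub_ne_zero.2 (S.pt_ne_tLast i))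
  have e : S.pt' η₀ i + -(S.pt i - S.tLast)⁻¹ = η₀ := by rw [pt']; ring
  have := starConvex_slit (b := S.pt' η₀ i) (neg_ne_zero.2 h)
  rw [e] at this
  exact this

theorem isOpen_slitAt (η₀ : ℂ) (i : Fin S.p) : IsOpen (S.slitAt η₀ i) := isOpen_slit _ _

theorem isOpen_cutPlane (η₀ : ℂ) : IsOpen (S.cutPlane η₀) := by
  rw [cutPlane_eq]
  exact isOpen_iInter_of_finite (isOpen_slitAt η₀)

theorem starConvex_cutPlane (η₀ : ℂ) : StarConvex ℝ η₀ (S.cutPlane η₀) := by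
  rw [cutPlane_eq]
  exact starConvex_iInter fun i => starConvex_slitAt η₀ i

theorem mem_cutPlane_self (η₀ : ℂ) : η₀ ∈ S.cutPlane η₀ := by
  rw [cutPlane_eq, mem_iInter]
  intro i
  simp [mem_slitAt_iff]

theorem isPreconnected_cutPlane (η₀ : ℂ) : IsPreconnected (S.cutPlane η₀) :=
  ((starConvex_cutPlane η₀).isPathConnected (mem_cutPlane_self η₀)).isConnected.isPreconnected

theorem pt'_notMem_cutPlane (η₀ : ℂ) (i : Fin S.p) : S.pt' η₀ i ∉ S.cutPlane η₀ := fun h =>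
  h i 1 le_rfl (by simp)

theorem pt'_mem_slitAt (η₀ : ℂ) {i m : Fin S.p} (him : i ≠ m) : S.pt' η₀ i ∈ S.slitAt η₀ m := by
  have hi := sub_ne_zero.2 (S.pt_ne_tLast i)
  rw [mem_slitAt_iff, Complex.mem_slitPlane_iff]
  by_contra hc
  push Not at hc
  obtain ⟨h1, h2⟩ := hc
  set y := (S.pt' η₀ i - η₀) * (S.pt m - S.tLast) with hy
  have hy' : y = (y.re : ℂ) := by
    apply Complex.ext
    · simp
    · simpa using h2
  have hy1 : 1 ≤ y.re := by simpa using h1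
  have h3 : Complex.exp (S.logPt m) = Complex.exp (S.logPt i + Real.log y.re) := by
    rw [Complex.exp_add, ← Complex.ofReal_exp, Real.exp_log (by linarith), ← hy', exp_logPt,
      exp_logPt, hy, pt']
    field_simp
    ring
  obtain ⟨n, hn⟩ := Complex.exp_eq_exp_iff_exists_int.1 h3
  have h4 : S.ang m = S.ang i + n * (2 * Real.pi) := by
    have := congrArg Complex.im hn
    simpa using this
  have b1 : S.ang m < S.ang i + 2 * Real.pi := ang_lt_ang_add
  have b2 : S.ang i < S.ang m + 2 * Real.pi := ang_lt_ang_add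
  have hpi := Real.two_pi_pos
  have n1 : (n : ℝ) < 1 := by
    by_contra hc; push Not at hc; nlinarith
  have n2 : (-1 : ℝ) < n := by
    by_contra hc; push Not at hc; nlinarith
  have n0 : n = 0 := by
    have u1 : n < 1 := by exact_mod_cast n1
    have u2 : -1 < n := by exact_mod_cast n2
    omega
  rw [n0, Int.cast_zero, zero_mul, add_zero] at h4
  have := S.theta_strictMono.injective h4
  exact him (Fin.castSucc_injective _ this).symm

/-- Near `t'_i` the cut plane is the plane cut along a single ray. -/
theorem exists_cutPlane_inter_ball (η₀ : ℂ) (i : Fin S.p) : ∃ r₀ : ℝ, 0 < r₀ ∧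
    ∀ r, r ≤ r₀ → S.cutPlane η₀ ∩ Metric.ball (S.pt' η₀ i) r =
      S.slitAt η₀ i ∩ Metric.ball (S.pt' η₀ i) r := by
  have h : ∀ᶠ z in 𝓝 (S.pt' η₀ i), ∀ m, i ≠ m → z ∈ S.slitAt η₀ m :=
    eventually_all.2 fun m => by
      by_cases him : i = m
      · exact Eventually.of_forall fun z h => absurd him h
      · filter_upwards [(isOpen_slitAt η₀ m).mem_nhds (pt'_mem_slitAt η₀ him)] with z hz _ using hz
  obtain ⟨r₀, hr₀, hr⟩ := Metric.eventually_nhds_iff_ball.1 h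
  refine ⟨r₀, hr₀, fun r hrr => ?_⟩
  ext z
  rw [cutPlane_eq]
  simp only [mem_inter_iff, mem_iInter]
  refine ⟨fun h => ⟨h.1 i, h.2⟩, fun h => ⟨fun m => ?_, h.2⟩⟩
  by_cases him : i = m
  · exact him ▸ h.1
  · exact hr z (Metric.ball_subset_ball hrr h.2) m him

theorem exists_mem_cutPlane_inter_ball (η₀ : ℂ) (i : Fin S.p) : ∃ r₀ : ℝ, 0 < r₀ ∧
    ∀ r, 0 < r → r ≤ r₀ → ∃ z ∈ S.cutPlane η₀ ∩ Metric.ball (S.pt' η₀ i) r,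
      StarConvex ℝ z (S.cutPlane η₀ ∩ Metric.ball (S.pt' η₀ i) r) := by
  obtain ⟨r₀, hr₀, h⟩ := exists_cutPlane_inter_ball η₀ i
  refine ⟨r₀, hr₀, fun r hr hrr => ?_⟩
  rw [h r hrr]
  have ha : -(S.pt i - S.tLast)⁻¹ ≠ 0 :=
    neg_ne_zero.2 (inv_ne_zero (sub_ne_zero.2 (S.pt_ne_tLast i)))
  set a := -(S.pt i - S.tLast)⁻¹ with ha'
  -- a point `b + ε a` on the axis of the slit, close to its end point `b`
  obtain ⟨ε, hε, hεr⟩ : ∃ ε : ℝ, 0 < ε ∧ ε * ‖a‖ < r := by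
    refine ⟨r / (2 * ‖a‖), by positivity, ?_⟩
    have : 0 < ‖a‖ := norm_pos_iff.2 ha
    field_simp
    norm_num
  have hεa : (ε : ℂ) * a ≠ 0 := mul_ne_zero (by exact_mod_cast hε.ne') ha
  have hset : S.slitAt η₀ i =
      {z : ℂ | (z - S.pt' η₀ i) * ((ε : ℂ) * a)⁻¹ ∈ Complex.slitPlane} := by
    ext z
    rw [slitAt, mem_ofPred_eq, mem_ofPred_eq, ← ha', mul_inv, mul_left_comm, ← Complex.ofReal_inv]
    simp only [Complex.mem_slitPlane_iff, Complex.re_ofReal_mul, Complex.im_ofReal_mul]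
    have : 0 < ε⁻¹ := inv_pos.2 hε
    simp [hε, hε.ne']
  have hball : S.pt' η₀ i + ε * a ∈ Metric.ball (S.pt' η₀ i) r := by
    rw [Metric.mem_ball, dist_eq_norm, add_sub_cancel_left, norm_mul, Complex.norm_real,
      Real.norm_of_nonneg hε.le]
    exact hεr
  refine ⟨S.pt' η₀ i + ε * a, ⟨?_, hball⟩, ?_⟩
  · rw [hset, mem_ofPred_eq, add_sub_cancel_left, mul_inv_cancel₀ hεa]
    exact Complex.one_mem_slitPlane
  · rw [hset]
    exact (starConvex_slit hεa).inter ((convex_ball _ _).starConvex hball)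

theorem pt'_mem_closure_cutPlane (η₀ : ℂ) (i : Fin S.p) :
    S.pt' η₀ i ∈ closure (S.cutPlane η₀) := by
  obtain ⟨r₀, hr₀, h⟩ := exists_mem_cutPlane_inter_ball η₀ i
  rw [Metric.mem_closure_iff]
  intro ε hε
  obtain ⟨z, hz, -⟩ := h (min ε r₀) (lt_min hε hr₀) (min_le_right _ _)
  refine ⟨z, hz.1, ?_⟩
  rw [dist_comm]
  exact (Metric.mem_ball.1 hz.2).trans_le (min_le_left _ _)

theorem cutPlane_slit (η₀ : ℂ) (i : Fin S.p) {z : ℂ} (hz : z ∈ S.cutPlane η₀) :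
    (z - S.pt' η₀ i) * Complex.exp (-(((-S.ang i - Real.pi : ℝ) : ℂ) * Complex.I)) ∈
      Complex.slitPlane := by
  rw [cutPlane_eq, mem_iInter] at hz
  have h := hz i
  rw [slitAt, mem_ofPred_eq, inv_neg, inv_inv] at h
  have hn : 0 < ‖S.pt i - S.tLast‖ := norm_pos_iff.2 (sub_ne_zero.2 (S.pt_ne_tLast i))
  have e : Complex.exp (-(((-S.ang i - Real.pi : ℝ) : ℂ) * Complex.I)) =
      ((‖S.pt i - S.tLast‖⁻¹ : ℝ) : ℂ) * -(S.pt i - S.tLast) := by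
    have h1 : -(((-S.ang i - Real.pi : ℝ) : ℂ) * Complex.I) =
        S.ang i * Complex.I + Real.pi * Complex.I := by push_cast; ring
    have h2 : S.pt i - S.tLast = (‖S.pt i - S.tLast‖ : ℂ) * Complex.exp (S.ang i * Complex.I) :=
      S.theta_arg i
    have hn' : (‖S.pt i - S.tLast‖ : ℂ) ≠ 0 := by exact_mod_cast hn.ne'
    rw [h1, Complex.exp_add, Complex.exp_pi_mul_I]
    nth_rewrite 2 [h2]
    push_cast
    field_simp
  rw [e, mul_left_comm]
  rw [Complex.mem_slitPlane_iff] at h ⊢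
  rw [Complex.re_ofReal_mul, Complex.im_ofReal_mul]
  refine h.imp (fun h => mul_pos (inv_pos.2 hn) h) fun h => mul_ne_zero (inv_pos.2 hn).ne' h

theorem offCut_cutPlane (η₀ : ℂ) (i : Fin S.p) :
    OffCut (S.cutPlane η₀) (S.pt' η₀ i) (-S.ang i - Real.pi) :=
  eventually_mem_nhdsWithin.mono fun _ hz => cutPlane_slit η₀ i hz

theorem pt'_injective (η₀ : ℂ) : Function.Injective (S.pt' η₀) := by
  intro i m h
  by_contra hne
  have h1 := pt'_mem_slitAt η₀ (S := S) hne
  rw [h, mem_slitAt_iff, pt'] at h1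
  have := sub_ne_zero.2 (S.pt_ne_tLast m)
  rw [add_sub_cancel_left, one_div, inv_mul_cancel₀ this, sub_self] at h1
  exact Complex.slitPlane_ne_zero h1 rfl

/-- A local solution at `t'_i` extends to the cut plane. -/
theorem exists_solution_cutPlane (η₀ : ℂ) (i : Fin S.p) {A : Matrix S.Idx S.Idx ℂ} {s : ℂ}
    {g : ℂ → S.Idx → ℂ} {r : ℝ} (hr : 0 < r)
    (hg : DifferentiableOn ℂ g (Metric.ball (S.pt' η₀ i) r))
    (hge : ∀ x ∈ Metric.ball (S.pt' η₀ i) r,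
      OkuboFactorEq (fun b : S.Idx => S.pt' η₀ b.1) A (S.pt' η₀ i) s g x) :
    ∃ y, IsONFSolution (fun b : S.Idx => S.pt' η₀ b.1) A (S.cutPlane η₀) y ∧
      HasLocalForm (S.cutPlane η₀) (S.pt' η₀ i) (-S.ang i - Real.pi) s (g (S.pt' η₀ i)) y := by
  set c : ℝ := -S.ang i - Real.pi with hc
  obtain ⟨r₀, hr₀, h⟩ := exists_mem_cutPlane_inter_ball η₀ i
  obtain ⟨z, hz, hstar⟩ := h (min r r₀) (lt_min hr hr₀) (min_le_right _ _)
  set N := S.cutPlane η₀ ∩ Metric.ball (S.pt' η₀ i) (min r r₀) with hN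
  have hNo : IsOpen N := (isOpen_cutPlane η₀).inter Metric.isOpen_ball
  have hNc : IsPreconnected N := (hstar.isPathConnected hz).isConnected.isPreconnected
  have hT : ∀ b : S.Idx, S.pt' η₀ b.1 ∉ S.cutPlane η₀ := fun b => pt'_notMem_cutPlane η₀ b.1
  have hNr : ∀ x ∈ N, x ∈ Metric.ball (S.pt' η₀ i) r := fun x hx =>
    Metric.ball_subset_ball (min_le_left _ _) hx.2
  have hloc : IsONFSolution (fun b : S.Idx => S.pt' η₀ b.1) A N
      (fun x => powNear c (x - S.pt' η₀ i) s • g x) := fun x hx =>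
    (okuboFactorEq_iff (cutPlane_slit η₀ i hx.1)
      (hg.differentiableAt (Metric.isOpen_ball.mem_nhds (hNr x hx)))
      (Eventually.of_forall fun _ => rfl)).2 (hge x (hNr x hx))
  obtain ⟨y, hyz, hy⟩ := exists_linear_ode_solution_at (isOpen_cutPlane η₀)
    (starConvex_cutPlane η₀) (mem_cutPlane_self η₀) (differentiableOn_okuboField (A := A) hT) hz.1
    (powNear c (z - S.pt' η₀ i) s • g z)
  refine ⟨y, (isONFSolution_iff hT).2 hy, hasLocalForm_iff.2 ⟨g, hg.analyticAt
    (Metric.ball_mem_nhds _ hr), rfl, ?_⟩⟩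
  have heq := linear_ode_eqOn hNo hNc
    ((differentiableOn_okuboField (A := A) hT).continuousOn.mono inter_subset_left)
    (fun x hx => hy x hx.1) ((isONFSolution_iff fun b hb => hT b hb.1).1 hloc) hz hyz
  filter_upwards [self_mem_nhdsWithin, mem_nhdsWithin_of_mem_nhds
    (Metric.ball_mem_nhds (S.pt' η₀ i) (lt_min hr hr₀))] with x h1 h2 using heq ⟨h1, h2⟩

end ExtendedOkuboSystem

/-! ### The solutions of the underlying system and their connection coefficients -/

namespace ExtendedOkuboSystem

open Set Filter

variable {S : ExtendedOkuboSystem}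

theorem A_apply_of_fst_eq (i : Fin S.p) (a b : S.Idx) (ha : a.1 = i) (hb : b.1 = i) :
    S.A a b = if a = b then S.lam a.1 a.2.1 else 0 := by
  obtain ⟨i', a⟩ := a
  obtain ⟨j', b⟩ := b
  obtain rfl : i' = i := ha
  obtain rfl : j' = i' := hb
  simp [S.A_diag]

theorem diagonalBlock_underlying (η₀ : ℂ) (i : Fin S.p) :
    DiagonalBlock (fun b : S.Idx => S.pt' η₀ b.1) S.A (S.pt' η₀ i) (fun b => S.lam b.1 b.2.1) :=
  fun a b ha hb => A_apply_of_fst_eq i a b (pt'_injective η₀ ha) (pt'_injective η₀ hb)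

theorem diagonalBlock_extended (i : Fin S.p) :
    DiagonalBlock S.bigT S.bigA (S.pt i) (Sum.elim (fun b => S.lam b.1 b.2.1) 0) := by
  rintro (a | a) (b | b) ha hb
  · simp only [bigA, Matrix.fromBlocks_apply₁₁, Sum.inl.injEq, Sum.elim_inl]
    exact A_apply_of_fst_eq i a b (S.pt_injective ha) (S.pt_injective hb)
  · exact absurd hb.symm (S.pt_ne_tLast i)
  · exact absurd ha.symm (S.pt_ne_tLast i)
  · exact absurd ha.symm (S.pt_ne_tLast i)

theorem Generic.lam_add_ne_zero (hS : S.Generic) (i : Fin S.p) (k : Fin (S.r i)) (m : ℕ) :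
    S.lam i k + m ≠ 0 := fun h =>
  hS.lam_notInt i k (-m) (by push_cast; linear_combination h)

theorem Generic.lam_add_ne_lam (hS : S.Generic) (i : Fin S.p) (k h : Fin (S.r i)) {m : ℕ}
    (hm : 1 ≤ m) : S.lam i k + m ≠ S.lam i h := by
  intro he
  by_cases hkh : k = h
  · subst hkh
    have : (m : ℂ) = 0 := add_eq_left.1 he
    have : m = 0 := by exact_mod_cast this
    omega
  · exact hS.lam_sub_lam i k h hkh (-m) (by push_cast; linear_combination he)

theorem Generic.lam_add_ne_lam_of_fst_eq (hS : S.Generic) (a b : S.Idx) (hab : b.1 = a.1) {m : ℕ}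
    (hm : 1 ≤ m) : S.lam a.1 a.2.1 + m ≠ S.lam b.1 b.2.1 := by
  obtain ⟨i, a⟩ := a
  obtain ⟨j, b⟩ := b
  obtain rfl : j = i := hab
  exact hS.lam_add_ne_lam j a.1 b.1 hm

theorem Generic.exists_isW (hS : S.Generic) (η₀ : ℂ) (a : S.Idx) : ∃ w, S.IsW η₀ 0 a w := by
  obtain ⟨g, r, hr, hg1, hg, hge⟩ := exists_okuboFactor (s := S.lam a.1 a.2.1)
    (diagonalBlock_underlying η₀ a.1) (fun m _ => hS.lam_add_ne_zero a.1 a.2.1 m)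
    (fun b hb m hm => hS.lam_add_ne_lam_of_fst_eq a b (pt'_injective η₀ hb) hm)
    (e := Pi.single a 1) (fun b hb => by
      rw [Pi.single_eq_of_ne, mul_zero]
      rintro rfl
      exact hb rfl) (fun b hb => by
      rw [Matrix.mulVec_single_one, Matrix.col_apply,
        A_apply_of_fst_eq a.1 b a (pt'_injective η₀ hb) rfl, Pi.single_apply]
      split_ifs with h
      · rw [h, mul_one]
      · rw [mul_zero])
  obtain ⟨y, hy, hyl⟩ := exists_solution_cutPlane η₀ a.1 hr hg hge
  rw [hg1] at hyl
  refine ⟨y, ?_, ?_⟩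
  · rwa [zero_smul, zero_add]
  · rwa [zero_add]

theorem Generic.isW_eqOn (hS : S.Generic) (η₀ : ℂ) {a : S.Idx} {w w' : ℂ → S.Idx → ℂ}
    (hw : S.IsW η₀ 0 a w) (hw' : S.IsW η₀ 0 a w') : EqOn w w' (S.cutPlane η₀) := by
  have h1 : IsONFSolution (fun b : S.Idx => S.pt' η₀ b.1) S.A (S.cutPlane η₀) w := by
    simpa only [zero_smul, zero_add] using hw.1
  have h1' : IsONFSolution (fun b : S.Idx => S.pt' η₀ b.1) S.A (S.cutPlane η₀) w' := by
    simpa only [zero_smul, zero_add] using hw'.1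
  have h2 : HasLocalForm (S.cutPlane η₀) (S.pt' η₀ a.1) (-S.ang a.1 - Real.pi)
      (S.lam a.1 a.2.1) (Pi.single a 1) w := by simpa only [zero_add] using hw.2
  have h2' : HasLocalForm (S.cutPlane η₀) (S.pt' η₀ a.1) (-S.ang a.1 - Real.pi)
      (S.lam a.1 a.2.1) (Pi.single a 1) w' := by simpa only [zero_add] using hw'.2
  have hl : ∀ b : S.Idx, S.pt' η₀ b.1 = S.pt' η₀ a.1 → ∀ m : ℕ, 1 ≤ m →
      S.lam a.1 a.2.1 + m ≠ S.lam b.1 b.2.1 := fun b hb m hm =>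
    hS.lam_add_ne_lam_of_fst_eq a b (pt'_injective η₀ hb) hm
  have hT : ∀ b : S.Idx, S.pt' η₀ b.1 ∉ S.cutPlane η₀ := fun b => pt'_notMem_cutPlane η₀ b.1
  exact localForm_eqOn (T := fun b : S.Idx => S.pt' η₀ b.1) (A := S.A) (s := S.lam a.1 a.2.1)
    (lam := fun b => S.lam b.1 b.2.1) (isOpen_cutPlane η₀) (isPreconnected_cutPlane η₀)
    (pt'_mem_closure_cutPlane η₀ a.1) (pt'_notMem_cutPlane η₀ a.1) hT (offCut_cutPlane η₀ a.1)
    (diagonalBlock_underlying η₀ a.1) (fun m _ => hS.lam_add_ne_zero a.1 a.2.1 m)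
    hl h1 h1' h2 h2'

/-- For every index outside the block at `t'_j` there is a solution holomorphic at `t'_j` whose
initial vector has the unit vector at that index as its part outside the block. -/
theorem Generic.exists_holomorphic_solution (hS : S.Generic) (η₀ : ℂ) (j : Fin S.p) (a : S.Idx)
    (ha : a.1 ≠ j) : ∃ y h : ℂ → S.Idx → ℂ,
      IsONFSolution (fun b : S.Idx => S.pt' η₀ b.1) S.A (S.cutPlane η₀) y ∧
      AnalyticAt ℂ h (S.pt' η₀ j) ∧ (∀ᶠ x in 𝓝[S.cutPlane η₀] S.pt' η₀ j, y x = h x) ∧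
      ∀ b : S.Idx, b.1 ≠ j → h (S.pt' η₀ j) b = (Pi.single a 1 : S.Idx → ℂ) b := by
  set e : S.Idx → ℂ := fun b => if b.1 = j then -((S.lam b.1 b.2.1)⁻¹ * S.A b a) else
    (Pi.single a 1 : S.Idx → ℂ) b with he
  have hAe : ∀ b : S.Idx, b.1 = j → (S.A *ᵥ e) b = 0 := by
    intro b hb
    have hlam : S.lam b.1 b.2.1 ≠ 0 := by simpa using hS.lam_add_ne_zero b.1 b.2.1 0
    rw [(diagonalBlock_underlying η₀ j).mulVec_apply e (by rw [hb]), Finset.sum_eq_single a]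
    · have h1 : S.pt' η₀ a.1 ≠ S.pt' η₀ j := fun h => ha (pt'_injective η₀ h)
      simp only [he, if_pos hb, if_neg ha, if_neg h1, Pi.single_eq_same]
      field_simp
      ring
    · intro c _ hc
      split_ifs with h
      · rfl
      · have : c.1 ≠ j := fun h' => h (by rw [h'])
        simp [he, this, Pi.single_eq_of_ne hc]
    · simp
  obtain ⟨g, r, hr, hg1, hg, hge⟩ := exists_okuboFactor (s := 0)
    (diagonalBlock_underlying η₀ j) (fun m hm => by
      rw [zero_add, Nat.cast_ne_zero]; omega)
    (fun b _ m _ h => hS.lam_notInt b.1 b.2.1 m (by rw [← h]; simp))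
    (e := e) (fun b _ => zero_mul _) (fun b hb => by
      rw [zero_mul, hAe b (pt'_injective η₀ hb)])
  obtain ⟨y, hy, hyl⟩ := exists_solution_cutPlane η₀ j hr hg hge
  obtain ⟨h, hh, hh1, hyh⟩ := hasLocalForm_iff.1 hyl
  refine ⟨y, h, hy, hh, hyh.mono fun x hx => by simpa using hx, fun b hb => ?_⟩
  rw [hh1, hg1, he]
  exact if_neg hb

theorem sum_idx_eq {M : Type*} [AddCommMonoid M] (j : Fin S.p) (F : S.Idx → M) :
    ∑ a, F a = ∑ b : S.Block j, F ⟨j, b⟩ + ∑ a : S.Idx, if a.1 = j then 0 else F a := by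
  rw [Fintype.sum_sigma, Fintype.sum_sigma (fun a : S.Idx => if a.1 = j then 0 else F a),
    ← Finset.add_sum_erase _ _ (Finset.mem_univ j),
    ← Finset.add_sum_erase Finset.univ
      (fun i => ∑ b : S.Block i, if i = j then 0 else F ⟨i, b⟩) (Finset.mem_univ j)]
  simp only [if_true, Finset.sum_const_zero, zero_add]
  congr 1
  refine Finset.sum_congr rfl fun i hi => ?_
  simp [Finset.ne_of_mem_erase hi]

theorem position_injective (j : Fin S.p) :
    Function.Injective fun b : S.Block j => (⟨j, b⟩ : S.Idx) := sigma_mk_injective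

/-- The solutions belonging to `t'_j` and those holomorphic at `t'_j` form a basis of the solution
space, so connection coefficients exist. -/
theorem Generic.exists_connection (hS : S.Generic) (η₀ : ℂ) (j : Fin S.p)
    {w : S.Idx → ℂ → S.Idx → ℂ} (hw : ∀ a, S.IsW η₀ 0 a (w a)) (a : S.Idx) :
    ∃ c : S.Block j → ℂ, IsConnectionFormula (S.cutPlane η₀) (S.pt' η₀ j) (w a)
      (fun b => w ⟨j, b⟩) c := by
  have hw1 : ∀ a, IsONFSolution (fun b : S.Idx => S.pt' η₀ b.1) S.A (S.cutPlane η₀) (w a) :=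
    fun a => by simpa only [zero_smul, zero_add] using (hw a).1
  have hw2 : ∀ b : S.Block j, HasLocalForm (S.cutPlane η₀) (S.pt' η₀ j) (-S.ang j - Real.pi)
      (S.lam j b.1) (Pi.single (⟨j, b⟩ : S.Idx) 1) (w ⟨j, b⟩) :=
    fun b => by simpa only [zero_add] using (hw ⟨j, b⟩).2
  have hT : ∀ b : S.Idx, S.pt' η₀ b.1 ∉ S.cutPlane η₀ := fun b => pt'_notMem_cutPlane η₀ b.1
  choose! y h hy hh hyh hh1 using hS.exists_holomorphic_solution η₀ j
  set Y : S.Idx → ℂ → S.Idx → ℂ := fun b => if b.1 = j then w b else y b with hY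
  have hYsol : ∀ b, ∀ x ∈ S.cutPlane η₀,
      HasDerivAt (Y b) (okuboField (fun b : S.Idx => S.pt' η₀ b.1) S.A x (Y b x)) x := by
    intro b
    by_cases hb : b.1 = j
    · simp only [hY, if_pos hb]
      exact (isONFSolution_iff hT).1 (hw1 b)
    · simp only [hY, if_neg hb]
      exact (isONFSolution_iff hT).1 (hy b hb)
  have hsum : ∀ (c : S.Idx → ℂ) (x : ℂ), ∑ b, c b • Y b x =
      (∑ b : S.Block j, c ⟨j, b⟩ • w ⟨j, b⟩ x) +
        ∑ b : S.Idx, if b.1 = j then 0 else c b • y b x := by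
    intro c x
    rw [sum_idx_eq j]
    congr 1
    · simp [hY]
    · refine Finset.sum_congr rfl fun b _ => ?_
      split_ifs with hb
      · rfl
      · simp [hY, hb]
  have hhol : ∀ c : S.Idx → ℂ, AnalyticAt ℂ
      (fun x => ∑ b : S.Idx, if b.1 = j then 0 else c b • h b x) (S.pt' η₀ j) := by
    intro c
    refine Finset.analyticAt_fun_sum _ fun b _ => ?_
    by_cases hb : b.1 = j
    · simpa [hb] using analyticAt_const
    · simpa [hb] using (hh b hb).fun_const_smul (c := c b)
  have hyh' : ∀ᶠ x in 𝓝[S.cutPlane η₀] S.pt' η₀ j, ∀ b : S.Idx, b.1 ≠ j → y b x = h b x :=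
    eventually_all.2 fun b => by
      by_cases hb : b.1 = j
      · exact Eventually.of_forall fun x hx => absurd hb hx
      · exact (hyh b hb).mono fun x hx _ => hx
  have hsplit : ∀ c : S.Idx → ℂ, ∀ᶠ x in 𝓝[S.cutPlane η₀] S.pt' η₀ j, ∑ b, c b • Y b x =
      (∑ b : S.Block j, c ⟨j, b⟩ • w ⟨j, b⟩ x) +
        ∑ b : S.Idx, if b.1 = j then 0 else c b • h b x := by
    intro c
    filter_upwards [hyh'] with x hx
    rw [hsum]
    congr 1
    refine Finset.sum_congr rfl fun b _ => ?_
    split_ifs with hb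
    · rfl
    · rw [hx b hb]
  have hli : LinearIndependent ℂ fun b => Y b η₀ := by
    refine linearIndependent_of_linear_ode (isOpen_cutPlane η₀) (isPreconnected_cutPlane η₀)
      (differentiableOn_okuboField hT).continuousOn hYsol (mem_cutPlane_self η₀) fun c hc => ?_
    obtain ⟨h1, h2⟩ := eq_zero_of_sum_localForm_add (isOpen_cutPlane η₀)
      (pt'_mem_closure_cutPlane η₀ j) (offCut_cutPlane η₀ j) (hS.lam_sub_lam j) (hS.lam_notInt j)
      (position_injective j) hw2 (C := fun b => c ⟨j, b⟩) (hhol c) (by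
        filter_upwards [hsplit c, self_mem_nhdsWithin] with x hx hxD
        rw [← hx]
        exact hc hxD)
    funext b
    by_cases hb : b.1 = j
    · obtain ⟨i, b⟩ := b
      obtain rfl : i = j := hb
      exact congrFun h1 b
    · have h3 := congrFun h2.self_of_nhds b
      rw [Finset.sum_apply, Finset.sum_eq_single b] at h3
      · simpa [hb, hh1 b hb b hb] using h3
      · intro b' _ hb'
        split_ifs with hj
        · rfl
        · rw [Pi.smul_apply, hh1 b' hj b hb, Pi.single_eq_of_ne hb'.symm, smul_zero]
      · simp
  obtain ⟨c, hc⟩ := linear_ode_span (isOpen_cutPlane η₀) (isPreconnected_cutPlane η₀)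
    (differentiableOn_okuboField hT).continuousOn hYsol (mem_cutPlane_self η₀) hli
    ((isONFSolution_iff hT).1 (hw1 a))
  refine ⟨fun b => c ⟨j, b⟩, _, hhol c, ?_⟩
  filter_upwards [hsplit c, self_mem_nhdsWithin] with x hx hxD
  rw [← hx]
  exact hc hxD

theorem Generic.connection_unique (hS : S.Generic) (η₀ : ℂ) (j : Fin S.p)
    {w : S.Idx → ℂ → S.Idx → ℂ} (hw : ∀ a, S.IsW η₀ 0 a (w a)) {u : ℂ → S.Idx → ℂ}
    {c c' : S.Block j → ℂ}
    (hc : IsConnectionFormula (S.cutPlane η₀) (S.pt' η₀ j) u (fun b => w ⟨j, b⟩) c)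
    (hc' : IsConnectionFormula (S.cutPlane η₀) (S.pt' η₀ j) u (fun b => w ⟨j, b⟩) c') : c = c' :=
  IsConnectionFormula.unique (isOpen_cutPlane η₀) (pt'_mem_closure_cutPlane η₀ j)
    (offCut_cutPlane η₀ j) (hS.lam_sub_lam j) (hS.lam_notInt j) (position_injective j)
    (fun b => by simpa only [zero_add] using (hw ⟨j, b⟩).2) hc hc'

/-! ### The rank `2n` system -/

theorem Generic.isU_eqOn (hS : S.Generic) {η₀ : ℂ} {i j : Fin S.p} {D W₀ W : Set ℂ} {c : ℂ}
    {l : ℂ → ℂ} (hs : StripSetting S η₀ i j D W₀ W c l) {a : S.Idx} (ha : a.1 = i ∨ a.1 = j)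
    {U U' : ℂ → S.Idx ⊕ S.Idx' → ℂ} (hU : S.IsU D a U) (hU' : S.IsU D a U') : EqOn U U' D := by
  refine localForm_eqOn hs.isOpen_sector hs.isPreconnected_sector (hs.pt_mem_closure a.1 ha)
    (hs.pt_notMem a.1) ?_ (hs.offCut_sector a.1 ha) (diagonalBlock_extended a.1)
    (fun m _ => hS.lam_add_ne_zero a.1 a.2.1 m) ?_ hU.1 hU'.1 hU.2 hU'.2
  · rintro (b | b)
    · exact hs.pt_notMem b.1
    · exact hs.tLast_notMem
  · rintro (b | b) hb m hm
    · exact hS.lam_add_ne_lam_of_fst_eq a b (S.pt_injective hb) hm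
    · exact absurd hb.symm (S.pt_ne_tLast a.1)

theorem Generic.connectionCoefficients (hS : S.Generic) {η₀ : ℂ} {i j : Fin S.p} {D W₀ W : Set ℂ}
    {c : ℂ} {l : ℂ → ℂ} (hs : StripSetting S η₀ i j D W₀ W c l) {w : S.Idx → ℂ → S.Idx → ℂ}
    {U : S.Idx → ℂ → S.Idx ⊕ S.Idx' → ℂ} (hw : ∀ a, S.IsW η₀ 0 a (w a))
    (hU : ∀ a : S.Idx, a.1 = i ∨ a.1 = j → S.IsU D a (U a)) {k m : Fin S.p}
    (hk : k = i ∨ k = j) (hm : m = i ∨ m = j) : S.ConnectionCoefficients η₀ D w U k m := by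
  obtain ⟨V, hV, hVC⟩ := hs.exists_solutions hS hw
  intro a
  obtain ⟨C, hC⟩ := hS.exists_connection η₀ m hw ⟨k, a⟩
  refine ⟨C, fun C' => ⟨fun hC' => hS.connection_unique η₀ m hw hC' hC, fun h => h ▸ hC⟩, ?_⟩
  have hUC : IsConnectionFormula D (S.pt m) (U ⟨k, a⟩) (fun b => U ⟨m, b⟩)
      (fun b => S.factor ⟨k, a⟩ / S.factor ⟨m, b⟩ * C b) := by
    obtain ⟨f, hf, h⟩ := hVC k m hk hm a C hC
    refine ⟨f, hf, ?_⟩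
    filter_upwards [h, self_mem_nhdsWithin] with x hx hxD
    rw [hS.isU_eqOn hs (a := ⟨k, a⟩) hk (hU _ hk) (hV _ hk) hxD, hx]
    congr 1
    refine Finset.sum_congr rfl fun b _ => ?_
    rw [hS.isU_eqOn hs (a := ⟨m, b⟩) hm (hU _ hm) (hV _ hm) hxD]
  refine fun C' => ⟨fun hC' => ?_, fun h => h ▸ hUC⟩
  exact IsConnectionFormula.unique hs.isOpen_sector (hs.pt_mem_closure m hm)
    (hs.offCut_sector m hm) (hS.lam_sub_lam m) (hS.lam_notInt m)
    (Sum.inl_injective.comp (position_injective m)) (fun b => (hU ⟨m, b⟩ hm).2) hC' hUC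

end ExtendedOkuboSystem

theorem mainTheorem2 (S : ExtendedOkuboSystem) (hS : S.Generic) (η₀ : ℂ) :
    (∀ a : S.Idx, ∃ w, S.IsW η₀ 0 a w ∧
      ∀ w', S.IsW η₀ 0 a w' → Set.EqOn w' w (S.cutPlane η₀)) ∧
    ∃ δ₀ : ℝ, 0 < δ₀ ∧ ∀ δ : ℝ, 0 < δ → δ < δ₀ →
      ∀ i j : Fin S.p, (i : ℕ) + 1 = (j : ℕ) →
        (∀ a : S.Idx, a.1 = i ∨ a.1 = j →
          ∃ U, S.IsU (S.sectorPlus δ i ∪ S.sectorMinus δ j) a U ∧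
            ∀ U', S.IsU (S.sectorPlus δ i ∪ S.sectorMinus δ j) a U' →
              Set.EqOn U' U (S.sectorPlus δ i ∪ S.sectorMinus δ j)) ∧
        ∀ (w : S.Idx → ℂ → S.Idx → ℂ) (U : S.Idx → ℂ → S.Idx ⊕ S.Idx' → ℂ),
          (∀ a : S.Idx, S.IsW η₀ 0 a (w a)) →
          (∀ a : S.Idx, a.1 = i ∨ a.1 = j →
            S.IsU (S.sectorPlus δ i ∪ S.sectorMinus δ j) a (U a)) →
          S.ConnectionCoefficients η₀ (S.sectorPlus δ i ∪ S.sectorMinus δ j) w U i j ∧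
          S.ConnectionCoefficients η₀ (S.sectorPlus δ i ∪ S.sectorMinus δ j) w U j i := by
  refine ⟨fun a => ?_, ?_⟩
  · obtain ⟨w, hw⟩ := hS.exists_isW η₀ a
    exact ⟨w, hw, fun w' hw' => hS.isW_eqOn η₀ hw' hw⟩
  obtain ⟨δ₀, hδ₀, hδ⟩ := S.exists_delta
  refine ⟨δ₀, hδ₀, fun δ h0 h1 i j hij => ?_⟩
  obtain ⟨hδπ, hδi⟩ := hδ δ h0 h1
  rw [ExtendedOkuboSystem.sectorPlus_union_sectorMinus hij h0 hδπ (hδi i)]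
  obtain ⟨W₀, W, c, l, hs⟩ := ExtendedOkuboSystem.exists_stripSetting (S := S) η₀ hij
  refine ⟨fun a ha => ?_, fun w U hw hU => ?_⟩
  · choose w hw using hS.exists_isW η₀
    obtain ⟨U, hU, -⟩ := hs.exists_solutions hS hw
    exact ⟨U a, hU a ha, fun U' hU' => hS.isU_eqOn hs ha hU' (hU a ha)⟩
  · exact ⟨hS.connectionCoefficients hs hw hU (Or.inl rfl) (Or.inr rfl),
      hS.connectionCoefficients hs hw hU (Or.inr rfl) (Or.inl rfl)⟩
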